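/- Let $K$ be an infinite field, $S=K[x_1,\dots,x_n]$ the standard graded polynomial ring, $\mathfrak m=(x_1,\dots,x_n)$, and $M$ a finitely generated ($\mathbb Z$-)graded $S$-module. For a sequence $y=y_1,\dots,y_n$ of linear forms put $$A_p=\big((y_1,\dots,y_{p-1})M:_M y_p\big)/(y_1,\dots,y_{p-1})M,\qquad H_i(p)=H_i(y_1,\dots,y_p;M)\ \text{(Koszul homology)},$$ and let $\phi_{a,b}:H_a(b)\to H_a(b)$ be multiplication by $y_{b+1}$ (up to sign). "For generic $y$" means: for all $y$ whose $n\times n$ matrix of coefficients lies in some nonempty Zariski-open subset of the space of $n\times n$ matrices over $K$. For integers $i,p\ge 1$ let $$A_{i,p}=\{(a,b)\in\mathbb N^2: 1\le b\le p-1,\ \max(i-p+b,1)\le a\le i\}.$$ Let $\beta_i(M)=\dim_K\operatorname{Tor}_i^S(K,M)$. For generic $y$, and for all $1\le p\le n$ and $i\ge 1$, the spaces $A_p$ and $H_i(p)$ are finite-dimensional over $K$, and their dimensions do not depend on the generic $y$; denote these generic values by $\alpha_p=\alpha_p(M)$ and $h_i(p)=h_i(p,M)$. Moreover: **Proposition 1.1.**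 (a) $h_i(p)\le\sum_{j=1}^{p-i+1}\binom{p-j}{i-1}\alpha_j$ for all $i\ge 1$ and $1\le p\le n$ (the sum is empty if $i>p$). (b) For generic $y$ and for all $i\ge1$ and $1\le p\le n$ the following are equivalent: (i) $h_i(p)=\sum_{j=1}^{p-i+1}\binom{p-j}{i-1}\alpha_j$; (ii) $\phi_{a,b}=0$ for all $(a,b)\in A_{i,p}$; (iii) $\mathfrak m H_a(b)=0$ for all $(a,b)\in A_{i,p}$. **Corollary 1.2.** (a) For all $i\ge 1$, $\beta_i(M)$ is finite and $\beta_i(M)\le\sum_{j=1}^{n-i+1}\binom{n-j}{i-1}\alpha_j$. (b) For generic $y$ and for all $i\ge 1$: $\beta_i(M)=\sum_{j=1}^{n-i+1}\binom{n-j}{i-1}\alpha_j$ if and only if $\mathfrak m H_a(b)=0$ for all $(a,b)\in A_{i,n}$. (c) For generic $y$: $\beta_i(M)=\sum_{j=1}^{n-i+1}\binom{n-j}{i-1}\alpha_j$ for all $i\ge1$ if and only if $\mathfrak m H_a(b)=0$ for all $a\ge 1$ and all $1\le b\le n$. -/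

import Mathlib

open CategoryTheory

universe u

noncomputable section

namespace RigidBetti

section Koszul

variable {R : Type*} [CommRing R]

/-- The differential of the Koszul complex `K(z; M)` of a sequence `z = (z_1, …, z_p)`.
An element `∑ e_s ⊗ m_s` of `⋀ R^p ⊗ M` is written as the function `s ↦ m_s` on the subsets `s`
of `{1, …, p}`. Since `∂ (e_s ⊗ m) = ∑_{j ∈ s} (-1)^{#{k ∈ s, k < j}} e_{s ∖ {j}} ⊗ z_j m`, the
coefficient of `∂ m` at `t` is `∑_{j ∉ t} (-1)^{#{k ∈ t, k < j}} z_j m_{t ∪ {j}}`. -/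
def koszulDiff (M : Type*) [AddCommGroup M] [Module R M] {p : ℕ} (z : Fin p → R) :
    (Finset (Fin p) → M) →ₗ[R] (Finset (Fin p) → M) :=
  LinearMap.pi fun t => ∑ j ∈ tᶜ,
    ((-1 : R) ^ (t.filter (fun k => k < j)).card * z j) • LinearMap.proj (insert j t)

/-- The component `K_i(z; M)` of homological degree `i`: only subsets with `i` elements occur. -/
def koszulChains (R : Type*) [CommRing R] (M : Type*) [AddCommGroup M] [Module R M] (p i : ℕ) :
    Submodule R (Finset (Fin p) → M) where
  carrier := {m | ∀ s, s.card ≠ i → m s = 0}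
  add_mem' := fun ha hb s hs => by simp [ha s hs, hb s hs]
  zero_mem' := fun _ _ => rfl
  smul_mem' := fun r _ ha s hs => by simp [ha s hs]

variable (M : Type*) [AddCommGroup M] [Module R M]

/-- The Koszul cycles of degree `i`. -/
def koszulCycles {p : ℕ} (z : Fin p → R) (i : ℕ) : Submodule R (Finset (Fin p) → M) :=
  koszulChains R M p i ⊓ LinearMap.ker (koszulDiff M z)

/-- The Koszul boundaries of degree `i`. -/
def koszulBoundaries {p : ℕ} (z : Fin p → R) (i : ℕ) : Submodule R (Finset (Fin p) → M) :=
  (koszulChains R M p (i + 1)).map (koszulDiff M z)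

/-- The Koszul homology `H_i(y_1, …, y_p; M)` of the first `p` terms of a sequence
`y_1, y_2, …` (the value `y 0` is not used). -/
abbrev KoszulHomology (y : ℕ → R) (p i : ℕ) : Type _ :=
  ↥(koszulCycles M (fun k : Fin p => y (k + 1)) i) ⧸
    (koszulBoundaries M (fun k : Fin p => y (k + 1)) i).submoduleOf
      (koszulCycles M (fun k : Fin p => y (k + 1)) i)

/-- The map `φ_{a,b} : H_a(y_1, …, y_b; M) → H_a(y_1, …, y_b; M)`, multiplication by `y_{b+1}`. -/
def koszulMul (y : ℕ → R) (a b : ℕ) : KoszulHomology M y b a →ₗ[R] KoszulHomology M y b a :=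
  LinearMap.lsmul R (KoszulHomology M y b a) (y (b + 1))

/-- The submodule `(y_1, …, y_{p-1}) M`. -/
def partialSubmodule (y : ℕ → R) (p : ℕ) : Submodule R M :=
  Ideal.span {r : R | ∃ j : ℕ, 1 ≤ j ∧ j < p ∧ r = y j} • (⊤ : Submodule R M)

/-- The submodule `(y_1, …, y_{p-1}) M :_M y_p`. -/
def colonSubmodule (y : ℕ → R) (p : ℕ) : Submodule R M :=
  (partialSubmodule M y p).comap (LinearMap.lsmul R M (y p))

/-- The module `A_p = ((y_1, …, y_{p-1}) M :_M y_p) / (y_1, …, y_{p-1}) M`. -/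
abbrev AnnihilatorModule (y : ℕ → R) (p : ℕ) : Type _ :=
  ↥(colonSubmodule M y p) ⧸ (partialSubmodule M y p).submoduleOf (colonSubmodule M y p)

end Koszul

section Generic

variable {K : Type u} [Field K] {n : ℕ}

/-- The linear form `y_p = ∑_k c_{p,k} x_k`, for `1 ≤ p ≤ n`, of a sequence of `n` linear forms
given by its coefficient matrix `c`. (For other `p` the value is `0`; it plays no role.) -/
def linearForm (c : Fin n → Fin n → K) (p : ℕ) : MvPolynomial (Fin n) K :=
  if h : 1 ≤ p ∧ p ≤ n then
    ∑ k : Fin n, MvPolynomial.C (c ⟨p - 1, by omega⟩ k) * MvPolynomial.X k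
  else 0

/-- `P` holds for a generic sequence of `n` linear forms: it holds for all coefficient matrices
in some basic open set `{f ≠ 0}`, `f ≠ 0`, of the affine space of `n × n` matrices. Over an
infinite field these are nonempty, and they form a basis of the nonempty Zariski-open sets. -/
def Generically (P : (Fin n → Fin n → K) → Prop) : Prop :=
  ∃ f : MvPolynomial (Fin n × Fin n) K, f ≠ 0 ∧
    ∀ c : Fin n → Fin n → K, MvPolynomial.eval (fun q => c q.1 q.2) f ≠ 0 → P c

open Classical in
/-- The value that a number `F` attached to a sequence of linear forms takes for a generic
sequence (and `0` if there is no such value). -/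
def genericValue (F : (Fin n → Fin n → K) → ℕ) : ℕ :=
  if h : ∃ a : ℕ, Generically (fun c => F c = a) then h.choose else 0

variable (K n)
variable (M : Type u) [AddCommGroup M] [Module K M] [Module (MvPolynomial (Fin n) K) M]
  [IsScalarTower K (MvPolynomial (Fin n) K) M]

/-- The generic annihilator number `α_p(M) = dim_K A_p`. -/
def genericAnnihilatorNumber (p : ℕ) : ℕ :=
  genericValue (fun c : Fin n → Fin n → K => Module.finrank K (AnnihilatorModule M (linearForm c) p))

/-- The number `h_i(p) = h_i(p, M) = dim_K H_i(y_1, …, y_p; M)` for generic `y`. -/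
def genericKoszulNumber (i p : ℕ) : ℕ :=
  genericValue (fun c : Fin n → Fin n → K => Module.finrank K (KoszulHomology M (linearForm c) p i))

/-- The graded maximal ideal `𝔪 = (x_1, …, x_n)`. -/
def gradedMaximalIdeal : Ideal (MvPolynomial (Fin n) K) :=
  Ideal.span (Set.range MvPolynomial.X)

end Generic

section Betti

variable (K : Type u) [Field K] (n : ℕ)
variable (M : Type u) [AddCommGroup M] [Module (MvPolynomial (Fin n) K) M]

/-- `Tor_i^S(K, M)` as a `K`-vector space, where `S = K[x_1, …, x_n]` and `K = S/𝔪`. -/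
abbrev TorSpace (i : ℕ) : Type u :=
  (ModuleCat.restrictScalars (MvPolynomial.C : K →+* MvPolynomial (Fin n) K)).obj
    (((Tor' (ModuleCat.{u} (MvPolynomial (Fin n) K)) i).obj
      (ModuleCat.of _ (MvPolynomial (Fin n) K ⧸ gradedMaximalIdeal K n))).obj (ModuleCat.of _ M))

/-- The Betti number `β_i(M) = dim_K Tor_i^S(K, M)`. -/
def bettiNumber (i : ℕ) : ℕ := Module.finrank K (TorSpace K n M i)

end Betti

/-- The index set `A_{i,p}` of pairs `(a, b)` of natural numbers with `1 ≤ b ≤ p - 1` and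
`max (i - p + b) 1 ≤ a ≤ i`. -/
def indexSet (i p : ℕ) : Set (ℕ × ℕ) :=
  {q | 1 ≤ q.2 ∧ (q.2 : ℤ) ≤ (p : ℤ) - 1 ∧
    max ((i : ℤ) - (p : ℤ) + (q.2 : ℤ)) 1 ≤ (q.1 : ℤ) ∧ q.1 ≤ i}

/-- The upper bound `∑_{j=1}^{p-i+1} C(p-j, i-1) α_j(M)`, used for `i ≥ 1`; the sum is empty
if `i > p`. -/
def annihilatorBound (K : Type u) [Field K] (n : ℕ) (M : Type u) [AddCommGroup M] [Module K M]
    [Module (MvPolynomial (Fin n) K) M] [IsScalarTower K (MvPolynomial (Fin n) K) M]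
    (i p : ℕ) : ℕ :=
  ∑ j ∈ Finset.Icc 1 (p + 1 - i), (p - j).choose (i - 1) * genericAnnihilatorNumber K n M j

end RigidBetti

end

set_option linter.unusedSectionVars false

namespace RigidBetti

/-! ### The Koszul complex of one more element as a mapping cone. -/

section KoszulCone

variable {R : Type*} [CommRing R] {M : Type*} [AddCommGroup M] [Module R M]

/-! The numerical core is the long exact sequence of a mapping cone. Adding `y_{p+1}` to the
sequence gives H_{i+1}(p) → H_{i+1}(p) → H_{i+1}(p+1) → H_i(p) → H_i(p), with multiplication by
`y_{p+1}` at both ends. Writing r_a(b) for the rank of φ_{a,b}, one gets h_{i+1}(p+1) = h_{i+1}(p) +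
h_i(p) - r_{i+1}(p) - r_i(p) for i ≥ 1, and h_1(p+1) = h_1(p) + α_{p+1} - r_1(p), because A_{p+1} is
the kernel of `y_{p+1}` on H_0(p) = M/(y_1, …, y_p)M. The binomial sums satisfy the same Pascal
recursion without the defects r. Hence they bound h_i(p), and equality means that every r_a(b)
entering the recursion vanishes; these are indexed exactly by A_{i,p}
(`le_binomialBound_and_eq_iff`).

The main work is to show that all dimensions are finite and generically constant. In a fixed
internal degree the Koszul differential is a linear family of maps on a finite-dimensional space, so
its rank is generically constant and maximal. It remains to confine the homology in positive
homological degree, for every prefix of a generic sequence, to one finite window of internal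
degrees. For the full sequence, dimension shifting along syzygies gives an upper bound D independent
of the basis of linear forms (`exists_koszulVanish`). For shorter prefixes, vanishing in all degrees
above D follows from vanishing in the single degree D + 1 (`koszulVanish_of_forall_degree`), which
is finitely many open conditions. They are satisfiable: prime avoidance over the infinite field
gives a basis whose annihilator modules are 𝔪-power torsion, and then torsion together with
injectivity of multiplication in high degrees forces vanishing
(`koszulVanish_of_annihilatorTorsion`).

Constancy of the h's forces constancy of the ranks r by the recursion. So if `y_{b+1}` kills H_a(b),
a generic perturbation `y_{b+1} + t x_l` kills it too, and therefore so does each variable `x_l`: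
vanishing of φ_{a,b} is the same as 𝔪 H_a(b) = 0. The Betti numbers enter because the Koszul complex
of a basis of linear forms resolves K, so that Tor_i(K, M) is H_i(n). -/

theorem koszulDiff_apply {p : ℕ} (z : Fin p → R) (m : Finset (Fin p) → M) (t : Finset (Fin p)) :
    koszulDiff M z m t =
      ∑ j ∈ tᶜ, ((-1 : R) ^ (t.filter (fun k => k < j)).card * z j) • m (insert j t) := by
  simp [koszulDiff]

/-- The first `p` indices, as subsets of `Fin (p + 1)`. -/
def embedSet {p : ℕ} (t : Finset (Fin p)) : Finset (Fin (p + 1)) := t.map Fin.castSuccEmb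

/-- The subset of `Fin p` obtained by forgetting the last index. -/
def forgetLast {p : ℕ} (s : Finset (Fin (p + 1))) : Finset (Fin p) :=
  Finset.univ.filter fun k => k.castSucc ∈ s

theorem mem_embedSet {p : ℕ} {t : Finset (Fin p)} {k : Fin p} :
    k.castSucc ∈ embedSet t ↔ k ∈ t := by
  simp [embedSet]

theorem last_notMem_embedSet {p : ℕ} (t : Finset (Fin p)) : Fin.last p ∉ embedSet t := by
  simp [embedSet, Fin.castSucc_ne_last]

theorem card_embedSet {p : ℕ} (t : Finset (Fin p)) : (embedSet t).card = t.card := by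
  simp [embedSet]

theorem card_insert_last {p : ℕ} (t : Finset (Fin p)) :
    (insert (Fin.last p) (embedSet t)).card = t.card + 1 := by
  rw [Finset.card_insert_of_notMem (last_notMem_embedSet t), card_embedSet]

theorem forgetLast_embedSet {p : ℕ} (t : Finset (Fin p)) : forgetLast (embedSet t) = t := by
  ext k; simp [forgetLast, mem_embedSet]

theorem forgetLast_insert {p : ℕ} (t : Finset (Fin p)) :
    forgetLast (insert (Fin.last p) (embedSet t)) = t := by
  ext k; simp [forgetLast, mem_embedSet, Fin.castSucc_ne_last]

theorem embedSet_forgetLast {p : ℕ} {s : Finset (Fin (p + 1))} (h : Fin.last p ∉ s) :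
    embedSet (forgetLast s) = s := by
  ext k
  refine Fin.lastCases ?_ (fun k => ?_) k
  · simp [h, last_notMem_embedSet]
  · simp [mem_embedSet, forgetLast]

theorem insert_embedSet_forgetLast {p : ℕ} {s : Finset (Fin (p + 1))} (h : Fin.last p ∈ s) :
    insert (Fin.last p) (embedSet (forgetLast s)) = s := by
  ext k
  refine Fin.lastCases ?_ (fun k => ?_) k
  · simp [h]
  · simp [mem_embedSet, forgetLast, Fin.castSucc_ne_last]

theorem embedSet_insert {p : ℕ} (t : Finset (Fin p)) (k : Fin p) :
    embedSet (insert k t) = insert k.castSucc (embedSet t) := by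
  simp [embedSet, Finset.map_insert]

/-- The part of a Koszul chain not involving the last basis vector. -/
def lowPart {p : ℕ} (m : Finset (Fin (p + 1)) → M) : Finset (Fin p) → M :=
  fun t => m (embedSet t)

/-- The coefficient of the last basis vector in a Koszul chain. -/
def highPart {p : ℕ} (m : Finset (Fin (p + 1)) → M) : Finset (Fin p) → M :=
  fun t => m (insert (Fin.last p) (embedSet t))

/-- The chain with given low and high part. -/
def glue {p : ℕ} (a b : Finset (Fin p) → M) : Finset (Fin (p + 1)) → M :=
  fun s => if Fin.last p ∈ s then b (forgetLast s) else a (forgetLast s)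

/-- Multiplication of a chain by `(-1)` to its homological degree. -/
def signed (R : Type*) [CommRing R] [Module R M] {p : ℕ} (m : Finset (Fin p) → M) :
    Finset (Fin p) → M :=
  fun t => ((-1 : R) ^ t.card) • m t

@[simp] theorem lowPart_glue {p : ℕ} (a b : Finset (Fin p) → M) : lowPart (glue a b) = a := by
  funext t; simp [lowPart, glue, last_notMem_embedSet, forgetLast_embedSet]

@[simp] theorem highPart_glue {p : ℕ} (a b : Finset (Fin p) → M) : highPart (glue a b) = b := by
  funext t; simp [highPart, glue, forgetLast_insert]

theorem chain_ext {p : ℕ} {m m' : Finset (Fin (p + 1)) → M} (h₁ : lowPart m = lowPart m')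
    (h₂ : highPart m = highPart m') : m = m' := by
  funext s
  by_cases h : Fin.last p ∈ s
  · have := congrFun h₂ (forgetLast s)
    simpa [highPart, insert_embedSet_forgetLast h] using this
  · have := congrFun h₁ (forgetLast s)
    simpa [lowPart, embedSet_forgetLast h] using this

@[simp] theorem lowPart_add {p : ℕ} (m m' : Finset (Fin (p + 1)) → M) :
    lowPart (m + m') = lowPart m + lowPart m' := rfl
@[simp] theorem highPart_add {p : ℕ} (m m' : Finset (Fin (p + 1)) → M) :
    highPart (m + m') = highPart m + highPart m' := rfl
@[simp] theorem lowPart_sub {p : ℕ} (m m' : Finset (Fin (p + 1)) → M) :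
    lowPart (m - m') = lowPart m - lowPart m' := rfl
@[simp] theorem highPart_sub {p : ℕ} (m m' : Finset (Fin (p + 1)) → M) :
    highPart (m - m') = highPart m - highPart m' := rfl
@[simp] theorem lowPart_smul {p : ℕ} (r : R) (m : Finset (Fin (p + 1)) → M) :
    lowPart (r • m) = r • lowPart m := rfl
@[simp] theorem highPart_smul {p : ℕ} (r : R) (m : Finset (Fin (p + 1)) → M) :
    highPart (r • m) = r • highPart m := rfl
@[simp] theorem lowPart_zero {p : ℕ} : lowPart (0 : Finset (Fin (p + 1)) → M) = 0 := rfl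
@[simp] theorem highPart_zero {p : ℕ} : highPart (0 : Finset (Fin (p + 1)) → M) = 0 := rfl

@[simp] theorem signed_zero {p : ℕ} : signed R (0 : Finset (Fin p) → M) = 0 := by
  funext t; simp [signed]

theorem compl_embedSet {p : ℕ} (t : Finset (Fin p)) :
    (embedSet t)ᶜ = insert (Fin.last p) (embedSet tᶜ) := by
  ext k
  refine Fin.lastCases ?_ (fun k => ?_) k
  · simp [last_notMem_embedSet]
  · simp [mem_embedSet, Fin.castSucc_ne_last]

theorem compl_insert_last {p : ℕ} (t : Finset (Fin p)) :
    (insert (Fin.last p) (embedSet t))ᶜ = embedSet tᶜ := by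
  ext k
  refine Fin.lastCases ?_ (fun k => ?_) k
  · simp [last_notMem_embedSet]
  · simp [mem_embedSet, Fin.castSucc_ne_last]

theorem card_filter_embedSet {p : ℕ} (t : Finset (Fin p)) (j : Fin p) :
    ((embedSet t).filter (fun k => k < j.castSucc)).card = (t.filter (fun k => k < j)).card := by
  rw [embedSet, Finset.filter_map, Finset.card_map]
  congr 1

theorem filter_embedSet_last {p : ℕ} (t : Finset (Fin p)) :
    ((embedSet t).filter (fun k => k < Fin.last p)) = embedSet t := by
  refine Finset.filter_true_of_mem fun k hk => ?_
  refine lt_of_le_of_ne (Fin.le_last k) ?_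
  rintro rfl
  exact last_notMem_embedSet t hk

/-- All of `t` precedes the last index, so removing that index from `t ∪ {last}` costs the sign
`(-1)^{#t}`. Together with `highPart_koszulDiff` this exhibits the complex as the cone of
multiplication by the last term. -/
theorem lowPart_koszulDiff {p : ℕ} (z : Fin (p + 1) → R) (m : Finset (Fin (p + 1)) → M) :
    lowPart (koszulDiff M z m) =
      koszulDiff M (fun k => z k.castSucc) (lowPart m) + z (Fin.last p) • signed R (highPart m) := by
  funext t
  simp only [lowPart, koszulDiff_apply, Pi.add_apply, Pi.smul_apply, signed, highPart]
  rw [compl_embedSet, Finset.sum_insert (last_notMem_embedSet _), filter_embedSet_last,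
    card_embedSet, add_comm, smul_smul, mul_comm]
  congr 1
  rw [show embedSet tᶜ = tᶜ.map Fin.castSuccEmb from rfl, Finset.sum_map]
  refine Finset.sum_congr rfl fun j _ => ?_
  rw [Fin.coe_castSuccEmb, card_filter_embedSet, embedSet_insert]

theorem highPart_koszulDiff {p : ℕ} (z : Fin (p + 1) → R) (m : Finset (Fin (p + 1)) → M) :
    highPart (koszulDiff M z m) = koszulDiff M (fun k => z k.castSucc) (highPart m) := by
  funext t
  simp only [koszulDiff_apply, highPart]
  rw [compl_insert_last, show embedSet tᶜ = tᶜ.map Fin.castSuccEmb from rfl, Finset.sum_map]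
  refine Finset.sum_congr rfl fun j _ => ?_
  rw [Fin.coe_castSuccEmb, Finset.filter_insert, if_neg (not_lt.2 (Fin.le_last _)),
    card_filter_embedSet, embedSet_insert, Finset.insert_comm]

theorem koszulDiff_signed {p : ℕ} (z : Fin p → R) (m : Finset (Fin p) → M) :
    koszulDiff M z (signed R m) = - signed R (koszulDiff M z m) := by
  funext t
  simp only [koszulDiff_apply, signed, Pi.neg_apply, Finset.smul_sum, ← Finset.sum_neg_distrib]
  refine Finset.sum_congr rfl fun j hj => ?_
  rw [Finset.card_insert_of_notMem (by simpa using hj), smul_smul, smul_smul, ← neg_smul]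
  congr 1; ring

/-- Induction over the cone: the two cross terms cancel because the differential anticommutes with
`signed`. -/
theorem koszulDiff_koszulDiff {p : ℕ} (z : Fin p → R) (m : Finset (Fin p) → M) :
    koszulDiff M z (koszulDiff M z m) = 0 := by
  induction p with
  | zero =>
    funext t
    rw [koszulDiff_apply]
    exact Finset.sum_eq_zero fun j _ => j.elim0
  | succ p ih =>
    refine chain_ext ?_ ?_
    · rw [lowPart_koszulDiff, lowPart_koszulDiff, highPart_koszulDiff, map_add, ih, map_smul,
        koszulDiff_signed]
      simp
    · rw [highPart_koszulDiff, highPart_koszulDiff, ih]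
      simp

theorem mem_koszulChains {p i : ℕ} {m : Finset (Fin p) → M} :
    m ∈ koszulChains R M p i ↔ ∀ s, s.card ≠ i → m s = 0 := Iff.rfl

theorem mem_koszulChains_succ {p i : ℕ} {m : Finset (Fin (p + 1)) → M} :
    m ∈ koszulChains R M (p + 1) (i + 1) ↔
      lowPart m ∈ koszulChains R M p (i + 1) ∧ highPart m ∈ koszulChains R M p i := by
  simp only [mem_koszulChains]
  constructor
  · intro h
    refine ⟨fun t ht => h _ (by rwa [card_embedSet]), fun t ht => h _ ?_⟩
    rw [card_insert_last]; omega
  · rintro ⟨h₁, h₂⟩ s hs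
    by_cases h : Fin.last p ∈ s
    · have := h₂ (forgetLast s) (fun h' => hs ?_)
      · simpa [highPart, insert_embedSet_forgetLast h] using this
      · rw [← insert_embedSet_forgetLast h, card_insert_last, h']
    · have := h₁ (forgetLast s) (fun h' => hs ?_)
      · simpa [lowPart, embedSet_forgetLast h] using this
      · rw [← embedSet_forgetLast h, card_embedSet, h']

theorem mem_koszulChains_zero {p : ℕ} {m : Finset (Fin (p + 1)) → M} :
    m ∈ koszulChains R M (p + 1) 0 ↔
      lowPart m ∈ koszulChains R M p 0 ∧ highPart m = 0 := by
  simp only [mem_koszulChains]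
  constructor
  · intro h
    refine ⟨fun t ht => h _ (by rwa [card_embedSet]), funext fun t => h _ ?_⟩
    rw [card_insert_last]; omega
  · rintro ⟨h₁, h₂⟩ s hs
    by_cases h : Fin.last p ∈ s
    · have := congrFun h₂ (forgetLast s)
      simpa [highPart, insert_embedSet_forgetLast h] using this
    · have := h₁ (forgetLast s) (fun h' => hs ?_)
      · simpa [lowPart, embedSet_forgetLast h] using this
      · rw [← embedSet_forgetLast h, card_embedSet, h']

theorem koszulDiff_mem {p i : ℕ} (z : Fin p → R) {m : Finset (Fin p) → M}
    (hm : m ∈ koszulChains R M p (i + 1)) : koszulDiff M z m ∈ koszulChains R M p i := by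
  intro s hs
  rw [koszulDiff_apply]
  refine Finset.sum_eq_zero fun j hj => ?_
  rw [hm _ ?_, smul_zero]
  rw [Finset.card_insert_of_notMem (by simpa using hj)]; omega

theorem koszulDiff_chains_zero {p : ℕ} (z : Fin p → R) {m : Finset (Fin p) → M}
    (hm : m ∈ koszulChains R M p 0) : koszulDiff M z m = 0 := by
  funext s
  rw [koszulDiff_apply]
  refine Finset.sum_eq_zero fun j hj => ?_
  rw [hm _ ?_, smul_zero]
  rw [Finset.card_insert_of_notMem (by simpa using hj)]; omega

theorem signed_of_mem {p i : ℕ} {m : Finset (Fin p) → M} (hm : m ∈ koszulChains R M p i) :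
    signed R m = ((-1 : R) ^ i) • m := by
  funext t
  by_cases h : t.card = i
  · simp [signed, h]
  · simp [signed, hm t h]

theorem koszulChains_eq_zero {p i : ℕ} (h : p < i) {m : Finset (Fin p) → M}
    (hm : m ∈ koszulChains R M p i) : m = 0 := by
  funext s
  refine hm s fun hs => ?_
  have := s.card_le_univ
  simp only [Fintype.card_fin] at this
  omega

variable (y : ℕ → R)

/-- The Koszul differential of the first `p` terms of `y`. -/
abbrev kdiff (M : Type*) [AddCommGroup M] [Module R M] (y : ℕ → R) (p : ℕ) :
    (Finset (Fin p) → M) →ₗ[R] (Finset (Fin p) → M) :=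
  koszulDiff M (fun k : Fin p => y (k + 1))

/-- Cycles of degree `i` of the first `p` terms of `y`. -/
abbrev cyc (M : Type*) [AddCommGroup M] [Module R M] (y : ℕ → R) (p i : ℕ) :
    Submodule R (Finset (Fin p) → M) :=
  koszulCycles M (fun k : Fin p => y (k + 1)) i

/-- Boundaries of degree `i` of the first `p` terms of `y`. -/
abbrev bdy (M : Type*) [AddCommGroup M] [Module R M] (y : ℕ → R) (p i : ℕ) :
    Submodule R (Finset (Fin p) → M) :=
  koszulBoundaries M (fun k : Fin p => y (k + 1)) i

theorem lowPart_kdiff {p : ℕ} (m : Finset (Fin (p + 1)) → M) :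
    lowPart (kdiff M y (p + 1) m) =
      kdiff M y p (lowPart m) + y (p + 1) • signed R (highPart m) := by
  rw [kdiff, lowPart_koszulDiff]; rfl

theorem highPart_kdiff {p : ℕ} (m : Finset (Fin (p + 1)) → M) :
    highPart (kdiff M y (p + 1) m) = kdiff M y p (highPart m) := by
  rw [kdiff, highPart_koszulDiff]; rfl

variable {y}

theorem mem_cyc {p i : ℕ} {m : Finset (Fin p) → M} :
    m ∈ cyc M y p i ↔ m ∈ koszulChains R M p i ∧ kdiff M y p m = 0 := by
  simp [cyc, koszulCycles]

theorem mem_bdy {p i : ℕ} {m : Finset (Fin p) → M} :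
    m ∈ bdy M y p i ↔ ∃ a ∈ koszulChains R M p (i + 1), kdiff M y p a = m := by
  simp [bdy, koszulBoundaries]

/-- A cycle of the cone is a cycle (the high part) together with a chain witnessing that `y_{p+1}`
kills its class. -/
theorem mem_cyc_succ {p i : ℕ} {m : Finset (Fin (p + 1)) → M} :
    m ∈ cyc M y (p + 1) (i + 1) ↔
      lowPart m ∈ koszulChains R M p (i + 1) ∧ highPart m ∈ cyc M y p i ∧
        kdiff M y p (lowPart m) + ((-1 : R) ^ i * y (p + 1)) • highPart m = 0 := by
  rw [mem_cyc, mem_cyc, mem_koszulChains_succ]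
  constructor
  · rintro ⟨⟨h₁, h₂⟩, h₃⟩
    have hl := congrArg lowPart h₃
    have hh := congrArg highPart h₃
    rw [lowPart_kdiff, signed_of_mem h₂, smul_smul, mul_comm] at hl
    rw [highPart_kdiff] at hh
    exact ⟨h₁, ⟨h₂, hh⟩, hl⟩
  · rintro ⟨h₁, ⟨h₂, h₃⟩, h₄⟩
    refine ⟨⟨h₁, h₂⟩, chain_ext ?_ ?_⟩
    · rw [lowPart_kdiff, signed_of_mem h₂, smul_smul, mul_comm, h₄]; rfl
    · rw [highPart_kdiff, h₃]; rfl

theorem mem_bdy_succ {p i : ℕ} {m : Finset (Fin (p + 1)) → M} :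
    m ∈ bdy M y (p + 1) i ↔
      ∃ a ∈ koszulChains R M p (i + 1), ∃ b ∈ koszulChains R M p i,
        lowPart m = kdiff M y p a + ((-1 : R) ^ i * y (p + 1)) • b ∧
          highPart m = kdiff M y p b := by
  rw [mem_bdy]
  constructor
  · rintro ⟨x, hx, rfl⟩
    rw [mem_koszulChains_succ] at hx
    refine ⟨_, hx.1, _, hx.2, ?_, highPart_kdiff _ _⟩
    rw [lowPart_kdiff, signed_of_mem hx.2, smul_smul, mul_comm]
  · rintro ⟨a, ha, b, hb, h₁, h₂⟩
    refine ⟨glue a b, mem_koszulChains_succ.2 (by simpa using ⟨ha, hb⟩), chain_ext ?_ ?_⟩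
    · rw [lowPart_kdiff, lowPart_glue, highPart_glue, signed_of_mem hb, smul_smul, h₁, mul_comm]
    · rw [highPart_kdiff, highPart_glue, h₂]

theorem neg_one_pow_smul_mem {N : Type*} [AddCommGroup N] [Module R N] (P : Submodule R N) (i : ℕ)
    (r : R) {x : N} : ((-1 : R) ^ i * r) • x ∈ P ↔ r • x ∈ P := by
  rw [mul_smul]
  rcases neg_one_pow_eq_or R i with h | h <;> simp [h]

theorem glue_mem_cyc {p i : ℕ} {a : Finset (Fin p) → M} (ha : a ∈ cyc M y p i) :
    glue a 0 ∈ cyc M y (p + 1) i := by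
  cases i with
  | zero =>
    rw [mem_cyc] at ha ⊢
    have h : glue a 0 ∈ koszulChains R M (p + 1) 0 := mem_koszulChains_zero.2 (by simpa using ha.1)
    exact ⟨h, koszulDiff_chains_zero _ h⟩
  | succ i =>
    rw [mem_cyc_succ]
    simpa using mem_cyc.1 ha

/-- Exactness at the target of multiplication by `y_{p+1}` on H_i(p); the cone sign is absorbed into
the cycle `b`. -/
theorem glue_mem_bdy_iff {p i : ℕ} {a : Finset (Fin p) → M} :
    glue a 0 ∈ bdy M y (p + 1) i ↔ ∃ b ∈ cyc M y p i, a - y (p + 1) • b ∈ bdy M y p i := by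
  rw [mem_bdy_succ]
  simp only [lowPart_glue, highPart_glue]
  constructor
  · rintro ⟨x, hx, b, hb, h₁, h₂⟩
    refine ⟨(-1 : R) ^ i • b, Submodule.smul_mem _ _ (mem_cyc.2 ⟨hb, h₂.symm⟩), ?_⟩
    rw [h₁, smul_smul, mul_comm, add_sub_cancel_right]
    exact mem_bdy.2 ⟨x, hx, rfl⟩
  · rintro ⟨b, hb, h⟩
    obtain ⟨x, hx, h⟩ := mem_bdy.1 h
    rw [mem_cyc] at hb
    refine ⟨x, hx, (-1 : R) ^ i • b, Submodule.smul_mem _ _ hb.1, ?_, ?_⟩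
    · rw [h, smul_smul, mul_right_comm, ← mul_pow, neg_one_mul, neg_neg, one_pow, one_mul,
        sub_add_cancel]
    · rw [map_smul, hb.2, smul_zero]

/-- Exactness at `H_{i+1}(p+1)`. -/
theorem highPart_mem_bdy_iff {p i : ℕ} {m : Finset (Fin (p + 1)) → M}
    (hm : m ∈ cyc M y (p + 1) (i + 1)) :
    highPart m ∈ bdy M y p i ↔
      ∃ a ∈ cyc M y p (i + 1), m - glue a 0 ∈ bdy M y (p + 1) (i + 1) := by
  constructor
  · intro h
    obtain ⟨w, hw, h⟩ := mem_bdy.1 h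
    rw [mem_cyc_succ] at hm
    refine ⟨lowPart m - ((-1 : R) ^ (i + 1) * y (p + 1)) • w, mem_cyc.2 ⟨?_, ?_⟩, ?_⟩
    · exact Submodule.sub_mem _ hm.1 (Submodule.smul_mem _ _ hw)
    · rw [map_sub, map_smul, h, ← hm.2.2, pow_succ, mul_neg_one, neg_mul, neg_smul, sub_neg_eq_add]
    · rw [mem_bdy_succ]
      refine ⟨0, Submodule.zero_mem _, w, hw, ?_, ?_⟩
      · simp
      · simp [h]
  · rintro ⟨a, ha, h⟩
    obtain ⟨x, hx, b, hb, h₁, h₂⟩ := mem_bdy_succ.1 h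
    rw [highPart_sub, highPart_glue, sub_zero] at h₂
    exact mem_bdy.2 ⟨b, hb, h₂.symm⟩

/-- Exactness at the source of multiplication by `y_{p+1}` on `H_i(p)`. -/
theorem smul_mem_bdy_iff {p i : ℕ} {v : Finset (Fin p) → M} (hv : v ∈ cyc M y p i) :
    y (p + 1) • v ∈ bdy M y p i ↔ ∃ m ∈ cyc M y (p + 1) (i + 1), highPart m = v := by
  constructor
  · intro h
    rw [← neg_one_pow_smul_mem _ i] at h
    obtain ⟨a, ha, h⟩ := mem_bdy.1 h
    refine ⟨glue (-a) v, mem_cyc_succ.2 ?_, by simp⟩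
    simp [ha, hv, h]
  · rintro ⟨m, hm, rfl⟩
    rw [mem_cyc_succ] at hm
    rw [← neg_one_pow_smul_mem _ i, mem_bdy]
    refine ⟨-lowPart m, Submodule.neg_mem _ hm.1, ?_⟩
    rw [map_neg]
    exact neg_eq_of_add_eq_zero_right hm.2.2

/-- Identifies H_0(p) with M/(y_1, …, y_p)M. The index is `p + 1` because `partialSubmodule` uses
the terms strictly below its index. -/
theorem mem_bdy_zero_iff {p : ℕ} {v : Finset (Fin p) → M} :
    v ∈ bdy M y p 0 ↔ v ∈ koszulChains R M p 0 ∧ v ∅ ∈ partialSubmodule M y (p + 1) := by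
  induction p with
  | zero =>
    have h0 : partialSubmodule M y 1 = ⊥ := by
      have : {r : R | ∃ j : ℕ, 1 ≤ j ∧ j < 1 ∧ r = y j} = ∅ := by
        ext r; simp
      rw [partialSubmodule, this]; simp
    rw [h0, mem_bdy]
    constructor
    · rintro ⟨a, ha, rfl⟩
      rw [koszulChains_eq_zero (by omega) ha, map_zero]
      exact ⟨Submodule.zero_mem _, by simp⟩
    · rintro ⟨hv, h⟩
      refine ⟨0, Submodule.zero_mem _, ?_⟩
      rw [map_zero]
      funext s
      rw [Finset.eq_empty_of_isEmpty s]
      simpa using h.symm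
  | succ p ih =>
    have hP : partialSubmodule M y (p + 2) =
        partialSubmodule M y (p + 1) ⊔ (Ideal.span {y (p + 1)} • ⊤ : Submodule R M) := by
      rw [partialSubmodule, partialSubmodule, ← Submodule.sup_smul, ← Ideal.span_union]
      congr 2
      ext r
      change (∃ j, 1 ≤ j ∧ j < p + 2 ∧ r = y j) ↔ (∃ j, 1 ≤ j ∧ j < p + 1 ∧ r = y j) ∨ r = y (p + 1)
      constructor
      · rintro ⟨j, h1, h2, rfl⟩
        rcases Nat.lt_succ_iff_lt_or_eq.1 h2 with h | h
        · exact Or.inl ⟨j, h1, h, rfl⟩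
        · exact Or.inr (by rw [h])
      · rintro (⟨j, h1, h2, rfl⟩ | rfl)
        · exact ⟨j, h1, by omega, rfl⟩
        · exact ⟨p + 1, by omega, by omega, rfl⟩
    rw [mem_bdy_succ, mem_koszulChains_zero]
    have hlow : v ∅ = lowPart v ∅ := rfl
    rw [hP, Submodule.mem_sup, hlow]
    constructor
    · rintro ⟨a, ha, b, hb, h₁, h₂⟩
      have h3 := ih.1 (mem_bdy.2 ⟨a, ha, rfl⟩)
      refine ⟨⟨?_, ?_⟩, _, h3.2, y (p + 1) • b ∅, ?_, ?_⟩
      · rw [h₁]; exact Submodule.add_mem _ h3.1 (Submodule.smul_mem _ _ hb)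
      · rw [h₂]; exact koszulDiff_chains_zero _ hb
      · exact Submodule.smul_mem_smul (Ideal.mem_span_singleton_self _) trivial
      · rw [h₁]; simp
    · rintro ⟨⟨h₁, h₂⟩, x, hx, w, hw, h₃⟩
      rw [Submodule.ideal_span_singleton_smul, Submodule.mem_smul_pointwise_iff_exists] at hw
      obtain ⟨b, -, rfl⟩ := hw
      have hsingle : ∀ c : M, Pi.single ∅ c ∈ koszulChains R M p 0 := fun c s hs =>
        Pi.single_eq_of_ne (fun h => hs (by rw [h, Finset.card_empty])) _
      obtain ⟨a, ha, h₄⟩ := mem_bdy.1 (ih.2 ⟨hsingle x, by simpa using hx⟩)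
      refine ⟨a, ha, Pi.single ∅ b, hsingle b, ?_, ?_⟩
      · rw [h₄]
        funext s
        by_cases hs : s = ∅
        · subst hs; simpa using h₃.symm
        · rw [h₁ s (by rwa [Ne, Finset.card_eq_zero])]
          simp [hs]
      · rw [h₂, kdiff, koszulDiff_chains_zero _ (hsingle b)]

end KoszulCone

/-! ### The long exact sequence in Koszul homology. -/

section LongExactSequence

variable {R : Type*} [CommRing R] {M : Type*} [AddCommGroup M] [Module R M] {y : ℕ → R}

/-- The homology class of a cycle. -/
def hclass (M : Type*) [AddCommGroup M] [Module R M] (y : ℕ → R) (p i : ℕ) :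
    cyc M y p i →ₗ[R] KoszulHomology M y p i :=
  Submodule.mkQ _

theorem hclass_surjective (p i : ℕ) : Function.Surjective (hclass M y p i) :=
  Submodule.mkQ_surjective _

theorem hclass_eq_zero {p i : ℕ} (v : cyc M y p i) :
    hclass M y p i v = 0 ↔ (v : Finset (Fin p) → M) ∈ bdy M y p i := by
  rw [hclass, Submodule.mkQ_apply, Submodule.Quotient.mk_eq_zero]
  rfl

/-- The chain map `K(y_1, …, y_p) → K(y_1, …, y_{p+1})` on cycles. -/
def glueCyc (y : ℕ → R) (p i : ℕ) : cyc M y p i →ₗ[R] cyc M y (p + 1) i where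
  toFun a := ⟨glue a 0, glue_mem_cyc a.2⟩
  map_add' a b := Subtype.ext (chain_ext (by simp) (by simp))
  map_smul' r a := Subtype.ext (chain_ext (by simp) (by simp))

/-- The map sending a cycle to the coefficient of the last basis vector. -/
def highCyc (y : ℕ → R) (p i : ℕ) : cyc M y (p + 1) (i + 1) →ₗ[R] cyc M y p i where
  toFun a := ⟨highPart a, (mem_cyc_succ.1 a.2).2.1⟩
  map_add' a b := Subtype.ext (by simp)
  map_smul' r a := Subtype.ext (by simp)

/-- The map `H_i(y_1, …, y_p) → H_i(y_1, …, y_{p+1})`. -/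
def inclHom (M : Type*) [AddCommGroup M] [Module R M] (y : ℕ → R) (p i : ℕ) :
    KoszulHomology M y p i →ₗ[R] KoszulHomology M y (p + 1) i :=
  Submodule.mapQ _ _ (glueCyc y p i) (by
    intro a ha
    have ha : (a : Finset (Fin p) → M) ∈ bdy M y p i := ha
    change glue (a : Finset (Fin p) → M) 0 ∈ bdy M y (p + 1) i
    exact glue_mem_bdy_iff.2 ⟨0, Submodule.zero_mem _, by simpa using ha⟩)

/-- The map `H_{i+1}(y_1, …, y_{p+1}) → H_i(y_1, …, y_p)`. -/
def connHom (M : Type*) [AddCommGroup M] [Module R M] (y : ℕ → R) (p i : ℕ) :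
    KoszulHomology M y (p + 1) (i + 1) →ₗ[R] KoszulHomology M y p i :=
  Submodule.mapQ _ _ (highCyc y p i) (by
    intro a ha
    have ha : (a : Finset (Fin (p + 1)) → M) ∈ bdy M y (p + 1) (i + 1) := ha
    change highPart (a : Finset (Fin (p + 1)) → M) ∈ bdy M y p i
    exact (highPart_mem_bdy_iff a.2).2 ⟨0, Submodule.zero_mem _, by
      rwa [show glue (0 : Finset (Fin p) → M) 0 = 0 from chain_ext (by simp) (by simp), sub_zero]⟩)

theorem inclHom_hclass (p i : ℕ) (v : cyc M y p i) :
    inclHom M y p i (hclass M y p i v) = hclass M y (p + 1) i (glueCyc y p i v) := rfl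

theorem connHom_hclass (p i : ℕ) (v : cyc M y (p + 1) (i + 1)) :
    connHom M y p i (hclass M y (p + 1) (i + 1) v) = hclass M y p i (highCyc y p i v) := rfl

theorem koszulMul_hclass (p i : ℕ) (v : cyc M y p i) :
    koszulMul M y i p (hclass M y p i v) = hclass M y p i (y (p + 1) • v) := rfl

theorem exact_koszulMul_inclHom (p i : ℕ) :
    Function.Exact (koszulMul M y i p) (inclHom M y p i) := by
  intro x
  obtain ⟨v, rfl⟩ := hclass_surjective p i x
  rw [inclHom_hclass, hclass_eq_zero]
  change glue (v : Finset (Fin p) → M) 0 ∈ _ ↔ _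
  rw [glue_mem_bdy_iff]
  constructor
  · rintro ⟨b, hb, h⟩
    refine ⟨hclass M y p i ⟨b, hb⟩, ?_⟩
    rw [koszulMul_hclass, ← sub_eq_zero, ← map_sub, hclass_eq_zero, ← neg_mem_iff]
    simpa using h
  · rintro ⟨x, hx⟩
    obtain ⟨w, rfl⟩ := hclass_surjective p i x
    rw [koszulMul_hclass, eq_comm, ← sub_eq_zero, ← map_sub, hclass_eq_zero] at hx
    exact ⟨w, w.2, hx⟩

theorem exact_inclHom_connHom (p i : ℕ) :
    Function.Exact (inclHom M y p (i + 1)) (connHom M y p i) := by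
  intro x
  obtain ⟨v, rfl⟩ := hclass_surjective (p + 1) (i + 1) x
  rw [connHom_hclass, hclass_eq_zero]
  change highPart (v : Finset (Fin (p + 1)) → M) ∈ _ ↔ _
  rw [highPart_mem_bdy_iff v.2]
  constructor
  · rintro ⟨b, hb, h⟩
    refine ⟨hclass M y p (i + 1) ⟨b, hb⟩, ?_⟩
    rw [inclHom_hclass, eq_comm, ← sub_eq_zero, ← map_sub, hclass_eq_zero]
    exact h
  · rintro ⟨x, hx⟩
    obtain ⟨w, rfl⟩ := hclass_surjective p (i + 1) x
    rw [inclHom_hclass, eq_comm, ← sub_eq_zero, ← map_sub, hclass_eq_zero] at hx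
    exact ⟨w, w.2, hx⟩

theorem exact_connHom_koszulMul (p i : ℕ) :
    Function.Exact (connHom M y p i) (koszulMul M y i p) := by
  intro x
  obtain ⟨v, rfl⟩ := hclass_surjective p i x
  rw [koszulMul_hclass, hclass_eq_zero]
  change y (p + 1) • (v : Finset (Fin p) → M) ∈ _ ↔ _
  rw [smul_mem_bdy_iff v.2]
  constructor
  · rintro ⟨m, hm, h⟩
    refine ⟨hclass M y (p + 1) (i + 1) ⟨m, hm⟩, ?_⟩
    rw [connHom_hclass]
    congr 1
    exact Subtype.ext h
  · rintro ⟨x, hx⟩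
    obtain ⟨w, rfl⟩ := hclass_surjective (p + 1) (i + 1) x
    rw [connHom_hclass, eq_comm, ← sub_eq_zero, ← map_sub, hclass_eq_zero] at hx
    rw [← smul_mem_bdy_iff v.2]
    have h₂ := (smul_mem_bdy_iff (highCyc y p i w).2).2 ⟨w, w.2, rfl⟩
    have h₃ := Submodule.add_mem _ (Submodule.smul_mem _ (y (p + 1)) hx) h₂
    rwa [← smul_add, Submodule.coe_sub, sub_add_cancel] at h₃

theorem single_mem_chains {p : ℕ} (x : M) : Pi.single ∅ x ∈ koszulChains R M p 0 :=
  fun s hs => Pi.single_eq_of_ne (fun h => hs (by rw [h, Finset.card_empty])) _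

theorem single_mem_cyc {p : ℕ} (x : M) : Pi.single ∅ x ∈ cyc M y p 0 :=
  mem_cyc.2 ⟨single_mem_chains x, koszulDiff_chains_zero _ (single_mem_chains x)⟩

/-- The inclusion of the colon submodule into the cycles of degree zero. -/
def colonToCyc (M : Type*) [AddCommGroup M] [Module R M] (y : ℕ → R) (p : ℕ) :
    colonSubmodule M y (p + 1) →ₗ[R] cyc M y p 0 where
  toFun x := ⟨Pi.single ∅ x, single_mem_cyc _⟩
  map_add' a b := Subtype.ext (Pi.single_add _ _ _)
  map_smul' r a := Subtype.ext (Pi.single_smul _ _ _)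

/-- The map `A_{p+1} → H_0(y_1, …, y_p)`. -/
def annToHom (M : Type*) [AddCommGroup M] [Module R M] (y : ℕ → R) (p : ℕ) :
    AnnihilatorModule M y (p + 1) →ₗ[R] KoszulHomology M y p 0 :=
  Submodule.mapQ _ _ (colonToCyc M y p) (by
    intro a ha
    have ha : (a : M) ∈ partialSubmodule M y (p + 1) := ha
    change Pi.single ∅ (a : M) ∈ bdy M y p 0
    exact mem_bdy_zero_iff.2 ⟨single_mem_chains _, by simpa using ha⟩)

theorem annToHom_injective (p : ℕ) : Function.Injective (annToHom M y p) := by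
  rw [injective_iff_map_eq_zero]
  intro x hx
  obtain ⟨a, rfl⟩ := Submodule.mkQ_surjective _ x
  have hx : hclass M y p 0 (colonToCyc M y p a) = 0 := hx
  rw [hclass_eq_zero, mem_bdy_zero_iff] at hx
  rw [Submodule.mkQ_apply, Submodule.Quotient.mk_eq_zero]
  have h := hx.2
  change (Pi.single ∅ (a : M) : Finset (Fin p) → M) ∅ ∈ _ at h
  rwa [Pi.single_eq_same] at h

theorem chains_zero_eq_single {p : ℕ} {v : Finset (Fin p) → M} (hv : v ∈ koszulChains R M p 0) :
    v = Pi.single ∅ (v ∅) := by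
  funext s
  by_cases hs : s = ∅
  · subst hs; simp
  · rw [hv s (by rwa [Ne, Finset.card_eq_zero])]
    simp [hs]

/-- A_{p+1} is the kernel of `y_{p+1}` on H_0(p). It replaces H_0(p), which may be
infinite-dimensional, at the end of the long exact sequence. -/
theorem exact_annToHom_koszulMul (p : ℕ) :
    Function.Exact (annToHom M y p) (koszulMul M y 0 p) := by
  intro x
  obtain ⟨v, rfl⟩ := hclass_surjective p 0 x
  rw [koszulMul_hclass, hclass_eq_zero]
  change y (p + 1) • (v : Finset (Fin p) → M) ∈ _ ↔ _
  constructor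
  · intro h
    refine ⟨Submodule.Quotient.mk ⟨(v : Finset (Fin p) → M) ∅, ?_⟩, ?_⟩
    · exact (mem_bdy_zero_iff.1 h).2
    · change hclass M y p 0 (colonToCyc M y p _) = _
      congr 1
      exact Subtype.ext (chains_zero_eq_single (mem_cyc.1 v.2).1).symm
  · rintro ⟨x, hx⟩
    obtain ⟨a, rfl⟩ := Submodule.mkQ_surjective _ x
    have hx : hclass M y p 0 (colonToCyc M y p a) = _ := hx
    rw [← sub_eq_zero, ← map_sub, hclass_eq_zero] at hx
    have ha : y (p + 1) • (Pi.single ∅ (a : M) : Finset (Fin p) → M) ∈ bdy M y p 0 := by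
      refine mem_bdy_zero_iff.2 ⟨Submodule.smul_mem _ _ (single_mem_chains _), ?_⟩
      rw [Pi.smul_apply, Pi.single_eq_same]
      exact a.2
    have h₃ := Submodule.sub_mem _ ha (Submodule.smul_mem _ (y (p + 1)) hx)
    rw [← smul_sub, Submodule.coe_sub] at h₃
    change y (p + 1) • (Pi.single ∅ (a : M) - (Pi.single ∅ (a : M) - (v : Finset (Fin p) → M))) ∈ _
      at h₃
    rwa [sub_sub_cancel] at h₃

end LongExactSequence

/-! ### Dimension counts along the long exact sequence. -/

section Dimension

variable {K : Type*} [Field K] {R : Type*} [CommRing R] [Algebra K R]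
  {M : Type*} [AddCommGroup M] [Module K M] [Module R M] [IsScalarTower K R M] (y : ℕ → R)

/-- The rank over `K` of `φ_{a,b}`. -/
noncomputable def mulRank (K : Type*) [Field K] [Algebra K R]
    (M : Type*) [AddCommGroup M] [Module K M] [Module R M] [IsScalarTower K R M] (y : ℕ → R)
    (a b : ℕ) : ℕ :=
  Module.finrank K (LinearMap.range ((koszulMul M y a b).restrictScalars K))

theorem finrank_eq_of_exact {V₁ V₂ V₃ V₄ V₅ : Type*} [AddCommGroup V₁] [AddCommGroup V₂]
    [AddCommGroup V₃] [AddCommGroup V₄] [AddCommGroup V₅] [Module K V₁] [Module K V₂]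
    [Module K V₃] [Module K V₄] [Module K V₅] [Module.Finite K V₂] [Module.Finite K V₃]
    (f₁ : V₁ →ₗ[K] V₂) (f₂ : V₂ →ₗ[K] V₃)
    (f₃ : V₃ →ₗ[K] V₄) (f₄ : V₄ →ₗ[K] V₅) (h₁ : Function.Exact f₁ f₂)
    (h₂ : Function.Exact f₂ f₃) (h₃ : Function.Exact f₃ f₄) :
    Module.finrank K V₃ + Module.finrank K (LinearMap.range f₁) =
      Module.finrank K V₂ + Module.finrank K (LinearMap.ker f₄) := by
  have e₂ := f₂.finrank_range_add_finrank_ker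
  have e₃ := f₃.finrank_range_add_finrank_ker
  rw [h₁.linearMap_ker_eq] at e₂
  rw [h₂.linearMap_ker_eq] at e₃
  rw [h₃.linearMap_ker_eq]
  omega

section

variable {V₁ V₂ V₃ V₄ V₅ : Type*} [AddCommGroup V₁] [AddCommGroup V₂]
    [AddCommGroup V₃] [AddCommGroup V₄] [AddCommGroup V₅] [Module K V₁] [Module K V₂]
    [Module K V₃] [Module K V₄] [Module K V₅] [Module R V₁] [Module R V₂]
    [Module R V₃] [Module R V₄] [Module R V₅] [IsScalarTower K R V₁] [IsScalarTower K R V₂]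
    [IsScalarTower K R V₃] [IsScalarTower K R V₄] [IsScalarTower K R V₅]

/-- Alternating dimension count; the outer spaces enter only through the ranks of `f₁` and `f₄`, and
need not be finite-dimensional. -/
theorem finrank_range_eq_of_exact [Module.Finite K V₂] [Module.Finite K V₃] [Module.Finite K V₄]
    (f₁ : V₁ →ₗ[R] V₂) (f₂ : V₂ →ₗ[R] V₃)
    (f₃ : V₃ →ₗ[R] V₄) (f₄ : V₄ →ₗ[R] V₅) (h₁ : Function.Exact f₁ f₂)
    (h₂ : Function.Exact f₂ f₃) (h₃ : Function.Exact f₃ f₄) :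
    Module.finrank K V₃ + Module.finrank K (LinearMap.range (f₁.restrictScalars K)) +
      Module.finrank K (LinearMap.range (f₄.restrictScalars K)) =
      Module.finrank K V₂ + Module.finrank K V₄ := by
  have h := finrank_eq_of_exact (f₁.restrictScalars K) (f₂.restrictScalars K)
    (f₃.restrictScalars K) (f₄.restrictScalars K) h₁ h₂ h₃
  have h' := (f₄.restrictScalars K).finrank_range_add_finrank_ker
  omega

theorem finite_of_exact [Module.Finite K V₁]
    (f₁ : V₁ →ₗ[R] V₃) (f₂ : V₂ →ₗ[R] V₃) (f₃ : V₃ →ₗ[R] V₄) (h₁ : Function.Exact f₁ f₃)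
    (h₂ : Function.Exact f₂ f₃) (h : Function.Injective f₂) : Module.Finite K V₂ := by
  have hk : Module.Finite K (LinearMap.ker (f₃.restrictScalars K)) := by
    rw [(show Function.Exact (f₁.restrictScalars K) (f₃.restrictScalars K) from
      h₁).linearMap_ker_eq]
    exact Module.Finite.range _
  rw [(show Function.Exact (f₂.restrictScalars K) (f₃.restrictScalars K) from
      h₂).linearMap_ker_eq] at hk
  exact Module.Finite.equiv (LinearEquiv.ofInjective (f₂.restrictScalars K) h).symm

/-- The variant for the bottom of the sequence: `V₄` will be H_0(p), of possibly infinite dimension,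
so the kernel of `f₄` is counted through `W` instead of by rank-nullity. -/
theorem finrank_eq_of_exact_of_exact [Module.Finite K V₂] [Module.Finite K V₃]
    {W : Type*} [AddCommGroup W] [Module K W] [Module R W] [IsScalarTower K R W]
    (f₁ : V₁ →ₗ[R] V₂) (f₂ : V₂ →ₗ[R] V₃)
    (f₃ : V₃ →ₗ[R] V₄) (f₄ : V₄ →ₗ[R] V₅) (g : W →ₗ[R] V₄) (h₁ : Function.Exact f₁ f₂)
    (h₂ : Function.Exact f₂ f₃) (h₃ : Function.Exact f₃ f₄) (h₄ : Function.Exact g f₄)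
    (hg : Function.Injective g) :
    Module.finrank K V₃ + Module.finrank K (LinearMap.range (f₁.restrictScalars K)) =
      Module.finrank K V₂ + Module.finrank K W := by
  have h := finrank_eq_of_exact (f₁.restrictScalars K) (f₂.restrictScalars K)
    (f₃.restrictScalars K) (f₄.restrictScalars K) h₁ h₂ h₃
  rwa [(show Function.Exact (g.restrictScalars K) (f₄.restrictScalars K) from
      h₄).linearMap_ker_eq, ← LinearEquiv.finrank_eq
      (LinearEquiv.ofInjective (g.restrictScalars K) hg)] at h

end

/-- Pascal's recursion for the dimensions, with the two ranks of multiplication as defect. -/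
theorem finrank_koszulHomology_succ (p i : ℕ) [Module.Finite K (KoszulHomology M y p (i + 1))]
    [Module.Finite K (KoszulHomology M y p i)]
    [Module.Finite K (KoszulHomology M y (p + 1) (i + 1))] :
    Module.finrank K (KoszulHomology M y (p + 1) (i + 1)) + mulRank K M y (i + 1) p
      + mulRank K M y i p =
      Module.finrank K (KoszulHomology M y p (i + 1)) + Module.finrank K (KoszulHomology M y p i) :=
  finrank_range_eq_of_exact (koszulMul M y (i + 1) p) (inclHom M y p (i + 1)) (connHom M y p i)
    (koszulMul M y i p) (exact_koszulMul_inclHom p (i + 1))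
    (exact_inclHom_connHom p i) (exact_connHom_koszulMul p i)

theorem finite_annihilatorModule (p : ℕ) [Module.Finite K (KoszulHomology M y (p + 1) 1)] :
    Module.Finite K (AnnihilatorModule M y (p + 1)) :=
  finite_of_exact (connHom M y p 0) (annToHom M y p) (koszulMul M y 0 p)
    (exact_connHom_koszulMul p 0) (exact_annToHom_koszulMul p) (annToHom_injective p)

theorem finrank_koszulHomology_one (p : ℕ) [Module.Finite K (KoszulHomology M y p 1)]
    [Module.Finite K (KoszulHomology M y (p + 1) 1)] :
    Module.finrank K (KoszulHomology M y (p + 1) 1) + mulRank K M y 1 p =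
      Module.finrank K (KoszulHomology M y p 1)
        + Module.finrank K (AnnihilatorModule M y (p + 1)) :=
  finrank_eq_of_exact_of_exact (koszulMul M y 1 p) (inclHom M y p 1) (connHom M y p 0)
    (koszulMul M y 0 p) (annToHom M y p) (exact_koszulMul_inclHom p 1)
    (exact_inclHom_connHom p 0) (exact_connHom_koszulMul p 0) (exact_annToHom_koszulMul p)
    (annToHom_injective p)

end Dimension

/-! ### Torsion of Koszul homology from torsion of the annihilator modules. -/

section Torsion

variable {R : Type*} [CommRing R] {M : Type*} [AddCommGroup M] [Module R M]

/-- `H_i(y_1, …, y_p; M)` is annihilated by a power of the ideal `I`. -/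
def KoszulTorsion (M : Type*) [AddCommGroup M] [Module R M] (I : Ideal R) (y : ℕ → R)
    (p i : ℕ) : Prop :=
  ∃ k : ℕ, ∀ f ∈ I ^ k, ∀ v ∈ cyc M y p i, f • v ∈ bdy M y p i

/-- `A_p` is annihilated by a power of the ideal `I`. -/
def AnnihilatorTorsion (M : Type*) [AddCommGroup M] [Module R M] (I : Ideal R) (y : ℕ → R)
    (p : ℕ) : Prop :=
  ∃ k : ℕ, ∀ f ∈ I ^ k, ∀ x ∈ colonSubmodule M y p, f • x ∈ partialSubmodule M y p

/-- Once `f` makes the high part a boundary, `f • v` comes, up to a boundary, from H_{i+1}(p), where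
`g` kills it. Only classes killed by `y_{p+1}` occur as high parts of cycles, so `h₂` asks for no
more; for `i = 0` these classes form A_{p+1}. -/
theorem koszulTorsion_succ {I : Ideal R} {y : ℕ → R} {p i : ℕ}
    (h₁ : KoszulTorsion M I y p (i + 1))
    (h₂ : ∃ k : ℕ, ∀ f ∈ I ^ k, ∀ v ∈ cyc M y p i, y (p + 1) • v ∈ bdy M y p i →
      f • v ∈ bdy M y p i) : KoszulTorsion M I y (p + 1) (i + 1) := by
  obtain ⟨k₁, h₁⟩ := h₁
  obtain ⟨k₂, h₂⟩ := h₂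
  refine ⟨k₁ + k₂, fun f hf v hv => ?_⟩
  rw [pow_add] at hf
  induction hf using Submodule.mul_induction_on' with
  | mem_mul_mem g hg f hf =>
    have hh : highPart v ∈ cyc M y p i := (mem_cyc_succ.1 hv).2.1
    have h := h₂ f hf _ hh ((smul_mem_bdy_iff hh).2 ⟨v, hv, rfl⟩)
    rw [← highPart_smul, highPart_mem_bdy_iff (Submodule.smul_mem _ _ hv)] at h
    obtain ⟨a, ha, h⟩ := h
    have h₃ : g • glue a 0 ∈ bdy M y (p + 1) (i + 1) := by
      rw [show g • glue a 0 = glue (g • a) 0 from chain_ext (by simp) (by simp)]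
      exact glue_mem_bdy_iff.2 ⟨0, Submodule.zero_mem _, by simpa using h₁ g hg a ha⟩
    have h₄ := Submodule.add_mem _ (Submodule.smul_mem _ g h) h₃
    rwa [← smul_add, sub_add_cancel, smul_smul] at h₄
  | add f _ g _ hf hg =>
    rw [add_smul]
    exact Submodule.add_mem _ hf hg

theorem koszulTorsion_of_annihilatorTorsion {I : Ideal R} {y : ℕ → R} {p : ℕ}
    (h : ∀ q < p, AnnihilatorTorsion M I y (q + 1)) (i : ℕ) :
    KoszulTorsion M I y p (i + 1) := by
  induction p generalizing i with
  | zero =>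
    refine ⟨0, fun f _ v hv => ?_⟩
    rw [koszulChains_eq_zero (by omega) (mem_cyc.1 hv).1, smul_zero]
    exact Submodule.zero_mem _
  | succ p ih =>
    have ih := ih fun q hq => h q (by omega)
    refine koszulTorsion_succ (ih i) ?_
    cases i with
    | zero =>
      obtain ⟨k, hk⟩ := h p (by omega)
      refine ⟨k, fun f hf v hv hv' => ?_⟩
      have hc := (mem_cyc.1 hv).1
      rw [mem_bdy_zero_iff] at hv' ⊢
      exact ⟨Submodule.smul_mem _ _ hc, hk f hf _ hv'.2⟩
    | succ i =>
      obtain ⟨k, hk⟩ := ih i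
      exact ⟨k, fun f hf v hv _ => hk f hf v hv⟩

end Torsion

/-! ### Internal degrees: vanishing above a bound, and ranks on finite windows. -/

section Grading

variable {K : Type*} [Field K] {n : ℕ} {M : Type*} [AddCommGroup M] [Module K M]
  [Module (MvPolynomial (Fin n) K) M] [IsScalarTower K (MvPolynomial (Fin n) K) M]

/-- The maps `π d` are the projections onto the homogeneous components of a grading of the
module `M` over the polynomial ring. -/
structure IsGradingProj (n : ℕ) [Module (MvPolynomial (Fin n) K) M] (π : ℤ → M →ₗ[K] M) :
    Prop where
  idem : ∀ d m, π d (π d m) = π d m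
  orth : ∀ d e m, d ≠ e → π d (π e m) = 0
  sum : ∀ m, ∃ T : Finset ℤ, ∑ d ∈ T, π d m = m
  smul_X : ∀ d (k : Fin n) m,
    π (d + 1) ((MvPolynomial.X k : MvPolynomial (Fin n) K) • m) =
      (MvPolynomial.X k : MvPolynomial (Fin n) K) • π d m

/-- Multiplication by the terms of `y` raises the degree by one. -/
def IsLinearSeq (π : ℤ → M →ₗ[K] M) (y : ℕ → MvPolynomial (Fin n) K) : Prop :=
  ∀ j d m, π (d + 1) (y j • m) = y j • π d m

variable {π : ℤ → M →ₗ[K] M}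

theorem C_smul_eq (a : K) (m : M) :
    (MvPolynomial.C a : MvPolynomial (Fin n) K) • m = a • m := by
  rw [← MvPolynomial.algebraMap_eq, algebraMap_smul]

theorem isLinearSeq_linearForm (hπ : IsGradingProj n π) (c : Fin n → Fin n → K) :
    IsLinearSeq π (linearForm c) := by
  intro j d m
  unfold linearForm
  split_ifs with h
  · simp only [Finset.sum_smul, map_sum, mul_smul, C_smul_eq, map_smul, hπ.smul_X]
  · simp

/-- The projection of the chains onto the homogeneous component of degree `d`, where the basis
vectors have degree one. -/
def chainProj (π : ℤ → M →ₗ[K] M) {p : ℕ} (d : ℤ) :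
    (Finset (Fin p) → M) →ₗ[K] (Finset (Fin p) → M) :=
  LinearMap.pi fun s => π (d - s.card) ∘ₗ LinearMap.proj s

theorem chainProj_apply {p : ℕ} (d : ℤ) (m : Finset (Fin p) → M) (s : Finset (Fin p)) :
    chainProj π d m s = π (d - s.card) (m s) := rfl

theorem chainProj_idem (hπ : IsGradingProj n π) {p : ℕ} (d : ℤ) (m : Finset (Fin p) → M) :
    chainProj π d (chainProj π d m) = chainProj π d m :=
  funext fun _ => hπ.idem _ _

theorem chainProj_orth (hπ : IsGradingProj n π) {p : ℕ} {d e : ℤ} (h : d ≠ e)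
    (m : Finset (Fin p) → M) : chainProj π d (chainProj π e m) = 0 :=
  funext fun _ => hπ.orth _ _ _ (by omega)

theorem lowPart_chainProj {p : ℕ} (d : ℤ) (m : Finset (Fin (p + 1)) → M) :
    lowPart (chainProj π d m) = chainProj π d (lowPart m) := by
  funext t
  simp only [lowPart, chainProj_apply, card_embedSet]

theorem highPart_chainProj {p : ℕ} (d : ℤ) (m : Finset (Fin (p + 1)) → M) :
    highPart (chainProj π (d + 1) m) = chainProj π d (highPart m) := by
  funext t
  simp only [highPart, chainProj_apply, card_insert_last]
  congr 2
  push_cast; ring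

theorem chainProj_mem_chains {p i : ℕ} (d : ℤ) {m : Finset (Fin p) → M}
    (hm : m ∈ koszulChains (MvPolynomial (Fin n) K) M p i) :
    chainProj π d m ∈ koszulChains (MvPolynomial (Fin n) K) M p i := by
  intro s hs
  rw [chainProj_apply, hm s hs, map_zero]

theorem chainProj_smul {y : ℕ → MvPolynomial (Fin n) K} (hy : IsLinearSeq π y) {p : ℕ} (j : ℕ)
    (d : ℤ) (m : Finset (Fin p) → M) :
    chainProj π (d + 1) (y j • m) = y j • chainProj π d m := by
  funext s
  rw [chainProj_apply, Pi.smul_apply, Pi.smul_apply, chainProj_apply,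
    show d + 1 - (s.card : ℤ) = d - s.card + 1 by ring, hy]

/-- Dropping a basis vector of degree one compensates for multiplication by a linear form. -/
theorem chainProj_kdiff {y : ℕ → MvPolynomial (Fin n) K} (hy : IsLinearSeq π y) {p : ℕ}
    (d : ℤ) (m : Finset (Fin p) → M) :
    chainProj π d (kdiff M y p m) = kdiff M y p (chainProj π d m) := by
  funext t
  rw [chainProj_apply, kdiff, koszulDiff_apply, koszulDiff_apply, map_sum]
  refine Finset.sum_congr rfl fun j hj => ?_
  rw [chainProj_apply, Finset.card_insert_of_notMem (by simpa using hj), mul_smul, mul_smul]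
  have h := hy (j + 1) (d - t.card - 1) (m (insert j t))
  rw [show d - (t.card : ℤ) - 1 + 1 = d - t.card by ring] at h
  rw [show d - ((t.card + 1 : ℕ) : ℤ) = d - t.card - 1 by push_cast; ring, ← h]
  rcases neg_one_pow_eq_or (MvPolynomial (Fin n) K) (t.filter (fun k => k < j)).card with h | h <;>
    simp [h]

variable {y : ℕ → MvPolynomial (Fin n) K}

theorem chainProj_mem_cyc (hy : IsLinearSeq π y) {p i : ℕ} (d : ℤ) {m : Finset (Fin p) → M}
    (hm : m ∈ cyc M y p i) : chainProj π d m ∈ cyc M y p i := by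
  rw [mem_cyc] at hm ⊢
  exact ⟨chainProj_mem_chains d hm.1, by rw [← chainProj_kdiff hy, hm.2, map_zero]⟩

theorem chainProj_mem_bdy (hy : IsLinearSeq π y) {p i : ℕ} (d : ℤ) {m : Finset (Fin p) → M}
    (hm : m ∈ bdy M y p i) : chainProj π d m ∈ bdy M y p i := by
  rw [mem_bdy] at hm ⊢
  obtain ⟨a, ha, rfl⟩ := hm
  exact ⟨_, chainProj_mem_chains d ha, (chainProj_kdiff hy _ _).symm⟩

/-- The homogeneous component `H_i(y_1, …, y_p; M)_d` vanishes. -/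
def KoszulVanish (π : ℤ → M →ₗ[K] M) (y : ℕ → MvPolynomial (Fin n) K) (p i : ℕ) (d : ℤ) : Prop :=
  ∀ v ∈ cyc M y p i, chainProj π d v = v → v ∈ bdy M y p i

theorem koszulVanish_of_lt {p i : ℕ} (h : p < i) (d : ℤ) : KoszulVanish π y p i d := by
  intro v hv _
  rw [koszulChains_eq_zero h (mem_cyc.1 hv).1]
  exact Submodule.zero_mem _

/-- The connecting map lowers the internal degree by one, so the kernel of `y_{p+1}` on H_i(p)_d
comes from H_{i+1}(p+1)_{d+1}. If that vanishes, multiplication is injective on H_i(p)_d. -/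
theorem mem_bdy_of_smul_mem_bdy (hπ : IsGradingProj n π) (hy : IsLinearSeq π y) {p i : ℕ} {d : ℤ}
    (h : KoszulVanish π y (p + 1) (i + 1) (d + 1)) {v : Finset (Fin p) → M}
    (hv : v ∈ cyc M y p i) (hd : chainProj π d v = v) (hs : y (p + 1) • v ∈ bdy M y p i) :
    v ∈ bdy M y p i := by
  obtain ⟨m, hm, rfl⟩ := (smul_mem_bdy_iff hv).1 hs
  have h₁ := h _ (chainProj_mem_cyc hy (d + 1) hm) (chainProj_idem hπ _ _)
  obtain ⟨a, ha, b, hb, -, h₂⟩ := mem_bdy_succ.1 h₁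
  rw [highPart_chainProj, hd] at h₂
  exact mem_bdy.2 ⟨b, hb, h₂.symm⟩

/-- The companion surjectivity: the cokernel of H_i(p)_d → H_i(p)_{d+1} embeds in H_i(p+1)_{d+1}. -/
theorem exists_sub_smul_mem_bdy (hπ : IsGradingProj n π) (hy : IsLinearSeq π y) {p i : ℕ} {d : ℤ}
    (h : KoszulVanish π y (p + 1) i (d + 1)) {v : Finset (Fin p) → M}
    (hv : v ∈ cyc M y p i) (hd : chainProj π (d + 1) v = v) :
    ∃ b ∈ cyc M y p i, chainProj π d b = b ∧ v - y (p + 1) • b ∈ bdy M y p i := by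
  have h₁ := h _ (glue_mem_cyc hv) (by
    refine chain_ext ?_ ?_
    · rw [lowPart_chainProj, lowPart_glue, hd]
    · rw [highPart_chainProj, highPart_glue, map_zero])
  obtain ⟨b, hb, h₂⟩ := glue_mem_bdy_iff.1 h₁
  refine ⟨_, chainProj_mem_cyc hy d hb, chainProj_idem hπ _ _, ?_⟩
  have h₃ := chainProj_mem_bdy hy (d + 1) h₂
  rwa [map_sub, hd, chainProj_smul hy] at h₃

theorem koszulVanish_add_one (hπ : IsGradingProj n π) (hy : IsLinearSeq π y) {p i : ℕ} {d : ℤ}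
    (h : KoszulVanish π y (p + 1) i (d + 1)) (h' : KoszulVanish π y p i d) :
    KoszulVanish π y p i (d + 1) := by
  intro v hv hd
  obtain ⟨b, hb, hbd, h₁⟩ := exists_sub_smul_mem_bdy hπ hy h hv hd
  have h₂ := Submodule.add_mem _ h₁ (Submodule.smul_mem _ (y (p + 1)) (h' b hb hbd))
  rwa [sub_add_cancel] at h₂

/-- Descending in `p` and ascending in the degree: where H_i(p+1) vanishes, multiplication by
`y_{p+1}` is onto, so H_i(p) stays zero once it is zero. This trades infinitely many vanishing
conditions for those in degree `D + 1`, which is what makes the vanishing a generic property. -/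
theorem koszulVanish_of_forall_degree (hπ : IsGradingProj n π) (hy : IsLinearSeq π y) {D : ℤ}
    {N : ℕ} (h : ∀ i, 1 ≤ i → ∀ d > D, KoszulVanish π y N i d)
    (h' : ∀ p ≤ N, ∀ i, 1 ≤ i → KoszulVanish π y p i (D + 1)) :
    ∀ p ≤ N, ∀ i, 1 ≤ i → ∀ d > D, KoszulVanish π y p i d := by
  intro p hp
  induction hp using Nat.decreasingInduction with
  | self => exact h
  | of_succ p hp ih =>
    intro i hi d hd
    obtain ⟨k, rfl⟩ := Int.le.dest (show D + 1 ≤ d from hd)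
    clear hd
    induction k with
    | zero => simpa using h' p (by omega) i hi
    | succ k ihk =>
      have := koszulVanish_add_one hπ hy (ih i hi (D + 1 + k + 1) (by omega)) ihk
      convert this using 1
      push_cast; ring

theorem chainProj_pow_smul (hy : IsLinearSeq π y) {p : ℕ} (j : ℕ)
    (d : ℤ) (m : Finset (Fin p) → M) (k : ℕ) :
    chainProj π (d + k) (y j ^ k • m) = y j ^ k • chainProj π d m := by
  induction k with
  | zero => simp
  | succ k ih =>
    rw [pow_succ', mul_smul, mul_smul, ← ih, ← chainProj_smul hy]
    congr 2
    push_cast; ring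

/-- A power of `y_{p+1}` kills H_i(p), while multiplication by `y_{p+1}` is injective in every
degree above `D`; hence nothing lives there. -/
theorem koszulVanish_of_torsion (hπ : IsGradingProj n π) (hy : IsLinearSeq π y) {D : ℤ} {p i : ℕ}
    (h : ∀ d > D, KoszulVanish π y (p + 1) (i + 1) d) {I : Ideal (MvPolynomial (Fin n) K)}
    (hI : y (p + 1) ∈ I) (ht : KoszulTorsion M I y p i) : ∀ d > D, KoszulVanish π y p i d := by
  intro d hd v hv hvd
  obtain ⟨k, hk⟩ := ht
  have h₁ := hk _ (Ideal.pow_mem_pow hI k) v hv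
  clear hk
  induction k with
  | zero => simpa using h₁
  | succ k ih =>
    refine ih (mem_bdy_of_smul_mem_bdy hπ hy (h (d + k + 1) (by omega))
      (Submodule.smul_mem _ _ hv) ?_ ?_)
    · rw [chainProj_pow_smul hy, hvd]
    · rwa [smul_smul, ← pow_succ']

/-- Descending induction on `p`. It is applied to one special sequence, to show that the open
conditions in degree `D + 1` are not void. -/
theorem koszulVanish_of_annihilatorTorsion (hπ : IsGradingProj n π) (hy : IsLinearSeq π y) {D : ℤ}
    {N : ℕ} (h : ∀ i, 1 ≤ i → ∀ d > D, KoszulVanish π y N i d)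
    {I : Ideal (MvPolynomial (Fin n) K)} (hI : ∀ j, y j ∈ I)
    (ht : ∀ q < N, AnnihilatorTorsion M I y (q + 1)) :
    ∀ p ≤ N, ∀ i, 1 ≤ i → ∀ d > D, KoszulVanish π y p i d := by
  intro p hp
  induction hp using Nat.decreasingInduction with
  | self => exact h
  | of_succ p hp ih =>
    intro i hi
    refine koszulVanish_of_torsion hπ hy (ih (i + 1) (by omega)) (hI _) ?_
    obtain ⟨i, rfl⟩ : ∃ j, i = j + 1 := ⟨i - 1, by omega⟩
    exact koszulTorsion_of_annihilatorTorsion (fun q hq => ht q (by omega)) i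

theorem sum_proj_of_subset (hπ : IsGradingProj n π) {T T' : Finset ℤ} (h : T ⊆ T') {m : M}
    (hm : ∑ d ∈ T, π d m = m) : ∑ d ∈ T', π d m = m := by
  conv_rhs => rw [← hm]
  refine (Finset.sum_subset h fun e _ he => ?_).symm
  rw [← hm, map_sum]
  exact Finset.sum_eq_zero fun d hd => hπ.orth _ _ _ (by rintro rfl; exact he hd)

theorem exists_sum_chainProj (hπ : IsGradingProj n π) {p : ℕ} (m : Finset (Fin p) → M) :
    ∃ T : Finset ℤ, ∀ T', T ⊆ T' → ∑ d ∈ T', chainProj π d m = m := by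
  choose T hT using fun s => hπ.sum (m s)
  refine ⟨Finset.univ.biUnion fun s => (T s).image (· + (s.card : ℤ)), fun T' hT' => ?_⟩
  funext s
  rw [Finset.sum_apply]
  simp only [chainProj_apply]
  have h : T s ⊆ T'.image (· - (s.card : ℤ)) := by
    intro d hd
    refine Finset.mem_image.2 ⟨d + s.card, hT' ?_, by ring⟩
    exact Finset.mem_biUnion.2 ⟨s, Finset.mem_univ _, Finset.mem_image_of_mem _ hd⟩
  have := sum_proj_of_subset hπ h (hT s)
  rwa [Finset.sum_image (by intro a _ b _ h; simpa using h)] at this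

/-- The chains of homological degree `i` whose internal degrees lie in `T`. -/
def windowChains (n : ℕ) [Module (MvPolynomial (Fin n) K) M] (π : ℤ → M →ₗ[K] M) (p i : ℕ)
    (T : Finset ℤ) : Submodule K (Finset (Fin p) → M) where
  carrier := {m | m ∈ koszulChains (MvPolynomial (Fin n) K) M p i ∧ ∑ d ∈ T, chainProj π d m = m}
  add_mem' := fun ha hb => ⟨Submodule.add_mem _ ha.1 hb.1, by
    simp only [map_add, Finset.sum_add_distrib, ha.2, hb.2]⟩
  zero_mem' := ⟨Submodule.zero_mem _, by simp⟩
  smul_mem' := fun r a ha => ⟨fun s hs => by simp [ha.1 s hs], by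
    simp only [map_smul, ← Finset.smul_sum, ha.2]⟩

theorem mem_windowChains {p i : ℕ} {T : Finset ℤ} {m : Finset (Fin p) → M} :
    m ∈ windowChains n π p i T ↔ m ∈ koszulChains (MvPolynomial (Fin n) K) M p i ∧
      ∑ d ∈ T, chainProj π d m = m := Iff.rfl

theorem sum_chainProj_idem (hπ : IsGradingProj n π) {p : ℕ} (T : Finset ℤ)
    (m : Finset (Fin p) → M) :
    ∑ d ∈ T, chainProj π d (∑ e ∈ T, chainProj π e m) = ∑ d ∈ T, chainProj π d m := by
  refine Finset.sum_congr rfl fun d hd => ?_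
  rw [map_sum, Finset.sum_eq_single d, chainProj_idem hπ]
  · intro e _ he
    exact chainProj_orth hπ he.symm _
  · exact fun h => (h hd).elim

theorem sum_chainProj_mem_windowChains (hπ : IsGradingProj n π) {p i : ℕ} (T : Finset ℤ)
    {m : Finset (Fin p) → M} (hm : m ∈ koszulChains (MvPolynomial (Fin n) K) M p i) :
    ∑ d ∈ T, chainProj π d m ∈ windowChains n π p i T :=
  ⟨Submodule.sum_mem _ fun _ _ => chainProj_mem_chains _ hm, sum_chainProj_idem hπ _ _⟩

instance finite_windowChains [∀ d, Module.Finite K (LinearMap.range (π d))] (p i : ℕ)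
    (T : Finset ℤ) : Module.Finite K (windowChains n π p i T) := by
  have h : windowChains n π p i T ≤ ⨆ d ∈ T, LinearMap.range (chainProj π (p := p) d) := by
    intro m hm
    rw [← hm.2]
    exact Submodule.sum_mem _ fun d hd => Submodule.mem_iSup_of_mem d
      (Submodule.mem_iSup_of_mem hd ⟨m, rfl⟩)
  have h₁ : ∀ d, Module.Finite K (LinearMap.range (chainProj π (p := p) d)) := by
    intro d
    let g : (∀ s : Finset (Fin p), LinearMap.range (π (d - s.card))) →ₗ[K] (Finset (Fin p) → M) :=
      LinearMap.pi fun s => (LinearMap.range (π (d - s.card))).subtype ∘ₗ LinearMap.proj s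
    have hle : LinearMap.range (chainProj π (p := p) d) ≤ LinearMap.range g := by
      rintro _ ⟨m, rfl⟩
      exact ⟨fun s => ⟨π (d - s.card) (m s), m s, rfl⟩, rfl⟩
    exact Submodule.finiteDimensional_of_le hle
  rw [← Finset.sup_eq_iSup] at h
  exact Submodule.finiteDimensional_of_le h

/-- The rank of the Koszul differential on the chains with internal degrees in `T`. -/
noncomputable def windowRank (π : ℤ → M →ₗ[K] M) (y : ℕ → MvPolynomial (Fin n) K) (p i : ℕ)
    (T : Finset ℤ) : ℕ :=
  Module.finrank K ((windowChains n π p i T).map ((kdiff M y p).restrictScalars K))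

/-- The cycles with internal degrees in `T`. -/
noncomputable def windowCycles (π : ℤ → M →ₗ[K] M) (y : ℕ → MvPolynomial (Fin n) K) (p i : ℕ)
    (T : Finset ℤ) : Submodule K (Finset (Fin p) → M) :=
  windowChains n π p i T ⊓ LinearMap.ker ((kdiff M y p).restrictScalars K)

theorem finrank_windowCycles [∀ d, Module.Finite K (LinearMap.range (π d))] (p i : ℕ)
    (T : Finset ℤ) :
    Module.finrank K (windowCycles π y p i T) + windowRank π y p i T =
      Module.finrank K (windowChains n π p i T) := by
  have h := (((kdiff M y p).restrictScalars K).domRestrict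
    (windowChains n π p i T)).finrank_range_add_finrank_ker
  rw [LinearMap.range_domRestrict] at h
  rw [LinearMap.ker_domRestrict, ← Submodule.finrank_map_subtype_eq,
    Submodule.map_comap_subtype] at h
  rw [← h, add_comm]
  rfl

theorem map_windowChains_le (hy : IsLinearSeq π y) (p i : ℕ) (T : Finset ℤ) :
    (windowChains n π p (i + 1) T).map ((kdiff M y p).restrictScalars K) ≤
      windowCycles π y p i T := by
  rintro _ ⟨a, ha, rfl⟩
  refine ⟨⟨koszulDiff_mem _ ha.1, ?_⟩, koszulDiff_koszulDiff _ _⟩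
  conv_rhs => rw [← ha.2]
  rw [map_sum]
  exact Finset.sum_congr rfl fun d _ => chainProj_kdiff hy _ _

theorem mem_map_windowChains (hπ : IsGradingProj n π) (hy : IsLinearSeq π y) {p i : ℕ}
    {T : Finset ℤ} {v : Finset (Fin p) → M} (hv : v ∈ windowCycles π y p i T) :
    v ∈ (windowChains n π p (i + 1) T).map ((kdiff M y p).restrictScalars K) ↔
      v ∈ bdy M y p i := by
  constructor
  · rintro ⟨a, ha, rfl⟩
    exact mem_bdy.2 ⟨a, ha.1, rfl⟩
  · intro h
    obtain ⟨a, ha, rfl⟩ := mem_bdy.1 h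
    refine ⟨_, sum_chainProj_mem_windowChains hπ T ha, ?_⟩
    have := hv.1.2
    conv_rhs => rw [← this]
    rw [map_sum]
    exact Finset.sum_congr rfl fun d _ => (chainProj_kdiff hy _ _).symm

/-- Boundaries lie in cycles, so vanishing says that the boundaries have at least the dimension of
the cycles. As a lower bound on ranks this is an open condition on the sequence. -/
theorem koszulVanish_iff_rank [∀ d, Module.Finite K (LinearMap.range (π d))]
    (hπ : IsGradingProj n π) (hy : IsLinearSeq π y) (p i : ℕ) (d : ℤ) :
    KoszulVanish π y p i d ↔ Module.finrank K (windowChains n π p i {d}) ≤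
      windowRank π y p i {d} + windowRank π y p (i + 1) {d} := by
  rw [← finrank_windowCycles (y := y), add_comm, Nat.add_le_add_iff_left, windowRank]
  have hfin : Module.Finite K (windowCycles π y p i {d}) :=
    Submodule.finiteDimensional_of_le inf_le_left
  have hW : ∀ v, v ∈ windowCycles π y p i {d} ↔ v ∈ cyc M y p i ∧ chainProj π d v = v := by
    intro v
    rw [windowCycles, Submodule.mem_inf, mem_windowChains, Finset.sum_singleton, mem_cyc]
    change (_ ∧ _) ∧ kdiff M y p v = 0 ↔ _
    tauto
  constructor
  · intro h
    refine Submodule.finrank_mono fun v hv => (mem_map_windowChains hπ hy hv).2 ?_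
    exact h v ((hW v).1 hv).1 ((hW v).1 hv).2
  · intro h v hv hd
    have he := Submodule.eq_of_le_of_finrank_le (map_windowChains_le hy p i {d}) h
    have hv' := (hW v).2 ⟨hv, hd⟩
    exact (mem_map_windowChains hπ hy hv').1 (by rwa [he])

/-- The homology class of a cycle with internal degrees in `T`. -/
noncomputable def windowClass (π : ℤ → M →ₗ[K] M) (y : ℕ → MvPolynomial (Fin n) K) (p i : ℕ)
    (T : Finset ℤ) : windowCycles π y p i T →ₗ[K] KoszulHomology M y p i :=
  (hclass M y p i).restrictScalars K ∘ₗ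
    { toFun := fun v => ⟨v, mem_cyc.2 ⟨v.2.1.1, v.2.2⟩⟩
      map_add' := fun _ _ => rfl
      map_smul' := fun _ _ => rfl }

/-- The homogeneous components of a cycle outside the window are cycles again, hence boundaries, and
may be dropped. -/
theorem windowClass_surjective (hπ : IsGradingProj n π) (hy : IsLinearSeq π y) {p i : ℕ}
    {T : Finset ℤ} (h : ∀ d ∉ T, KoszulVanish π y p i d) :
    Function.Surjective (windowClass π y p i T) := by
  intro x
  obtain ⟨v, rfl⟩ := hclass_surjective p i x
  have hv := mem_cyc.1 v.2
  refine ⟨⟨∑ d ∈ T, chainProj π d (v : Finset (Fin p) → M),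
    sum_chainProj_mem_windowChains hπ T hv.1, ?_⟩, ?_⟩
  · change kdiff M y p _ = 0
    rw [map_sum]
    exact Finset.sum_eq_zero fun d _ => by rw [← chainProj_kdiff hy, hv.2, map_zero]
  · obtain ⟨T', hT'⟩ := exists_sum_chainProj hπ (v : Finset (Fin p) → M)
    have hs := hT' (T' ∪ T) Finset.subset_union_left
    rw [← Finset.sum_sdiff (Finset.subset_union_right : T ⊆ T' ∪ T)] at hs
    change hclass M y p i _ = hclass M y p i v
    rw [eq_comm, ← sub_eq_zero, ← map_sub, hclass_eq_zero]
    change (v : Finset (Fin p) → M) - ∑ d ∈ T, chainProj π d (v : Finset (Fin p) → M) ∈ _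
    rw [← eq_sub_iff_add_eq] at hs
    rw [← hs]
    refine Submodule.sum_mem _ fun d hd => h d (Finset.mem_sdiff.1 hd).2 _
      (chainProj_mem_cyc hy d v.2) (chainProj_idem hπ _ _)

theorem finite_koszulHomology_of_window [∀ d, Module.Finite K (LinearMap.range (π d))]
    (hπ : IsGradingProj n π) (hy : IsLinearSeq π y) {p i : ℕ}
    {T : Finset ℤ} (h : ∀ d ∉ T, KoszulVanish π y p i d) :
    Module.Finite K (KoszulHomology M y p i) := by
  have hfin : Module.Finite K (windowCycles π y p i T) :=
    Submodule.finiteDimensional_of_le inf_le_left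
  exact Module.Finite.of_surjective _ (windowClass_surjective hπ hy h)

/-- The dimension of the homology depends on the sequence only through two ranks on a fixed space of
chains. -/
theorem finrank_koszulHomology_of_window [∀ d, Module.Finite K (LinearMap.range (π d))]
    (hπ : IsGradingProj n π) (hy : IsLinearSeq π y) {p i : ℕ}
    {T : Finset ℤ} (h : ∀ d ∉ T, KoszulVanish π y p i d) :
    Module.finrank K (KoszulHomology M y p i) + windowRank π y p i T
      + windowRank π y p (i + 1) T = Module.finrank K (windowChains n π p i T) := by
  have hfin : Module.Finite K (windowCycles π y p i T) :=
    Submodule.finiteDimensional_of_le inf_le_left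
  have h₁ := (windowClass π y p i T).finrank_range_add_finrank_ker
  rw [LinearMap.range_eq_top.2 (windowClass_surjective hπ hy h), finrank_top] at h₁
  have h₂ : Module.finrank K (LinearMap.ker (windowClass π y p i T)) =
      windowRank π y p (i + 1) T := by
    rw [← Submodule.finrank_map_subtype_eq, windowRank]
    have : ∀ v, v ∈ (LinearMap.ker (windowClass π y p i T)).map
        (windowCycles π y p i T).subtype ↔
        v ∈ (windowChains n π p (i + 1) T).map ((kdiff M y p).restrictScalars K) := by
      intro v
      constructor
      · rintro ⟨w, hw, rfl⟩
        exact (mem_map_windowChains hπ hy w.2).2 ((hclass_eq_zero _).1 hw)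
      · intro hv
        have hv' := map_windowChains_le hy p i T hv
        exact ⟨⟨v, hv'⟩, (hclass_eq_zero _).2 ((mem_map_windowChains hπ hy hv').1 hv), rfl⟩
    rw [Submodule.ext this]
  rw [← finrank_windowCycles (y := y)]
  omega

end Grading

/-! ### Functoriality of the Koszul complex, and acyclicity for regular sequences. -/

section Functoriality

variable {R : Type*} [CommRing R] {M N : Type*} [AddCommGroup M] [Module R M] [AddCommGroup N]
  [Module R N]

theorem koszulDiff_comp (g : M →ₗ[R] N) {p : ℕ} (z : Fin p → R) (m : Finset (Fin p) → M) :
    koszulDiff N z (fun s => g (m s)) = fun s => g (koszulDiff M z m s) := by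
  funext t
  simp only [koszulDiff_apply, map_sum, map_smul]

theorem koszulDiff_ringHom {R' : Type*} [CommRing R'] (g : R →+* R') {p : ℕ} (z : Fin p → R)
    (m : Finset (Fin p) → R) :
    koszulDiff R' (fun k => g (z k)) (fun s => g (m s)) = fun s => g (koszulDiff R z m s) := by
  funext t
  simp only [koszulDiff_apply, map_sum, smul_eq_mul, map_mul, map_pow, map_neg, map_one]

/-- The torsion lemma for the unit ideal: being annihilated by a power of `⊤` means being zero. -/
theorem cyc_le_bdy_of_regular {y : ℕ → R} {p : ℕ}
    (h : ∀ q < p, colonSubmodule M y (q + 1) ≤ partialSubmodule M y (q + 1)) (i : ℕ) :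
    cyc M y p (i + 1) ≤ bdy M y p (i + 1) := by
  obtain ⟨k, hk⟩ := koszulTorsion_of_annihilatorTorsion (M := M) (I := ⊤) (y := y) (p := p)
    (fun q hq => ⟨0, fun f _ x hx => Submodule.smul_mem _ _ (h q hq hx)⟩) i
  intro v hv
  simpa using hk 1 (by rw [Ideal.top_pow]; trivial) v hv

end Functoriality

/-! ### Graded free modules and acyclicity for bases of linear forms. -/

section Polynomial

variable {K : Type*} [Field K] {n : ℕ}

theorem linearForm_succ (c : Fin n → Fin n → K) (k : Fin n) :
    linearForm c (k + 1) = ∑ l, MvPolynomial.C (c k l) * MvPolynomial.X l := by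
  have h : 1 ≤ (k : ℕ) + 1 ∧ (k : ℕ) + 1 ≤ n := ⟨by omega, k.2⟩
  rw [linearForm, dif_pos h]
  simp

theorem linearForm_one (k : Fin n) :
    linearForm (fun i j => (1 : Matrix (Fin n) (Fin n) K) i j) (k + 1) = MvPolynomial.X k := by
  rw [linearForm_succ, Finset.sum_eq_single k]
  · simp
  · intro l _ hl
    simp [Matrix.one_apply_ne hl.symm]
  · simp

/-- The variables form a regular sequence: membership in an ideal generated by variables is tested
on monomials, and multiplying by a further variable does not change the exponents of the generating
ones. -/
theorem colon_le_partial_variables {q : ℕ} (hq : q < n) :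
    colonSubmodule (MvPolynomial (Fin n) K)
      (linearForm (fun i j => (1 : Matrix (Fin n) (Fin n) K) i j)) (q + 1) ≤
    partialSubmodule (MvPolynomial (Fin n) K)
      (linearForm (fun i j => (1 : Matrix (Fin n) (Fin n) K) i j)) (q + 1) := by
  have hP : partialSubmodule (MvPolynomial (Fin n) K)
      (linearForm (fun i j => (1 : Matrix (Fin n) (Fin n) K) i j)) (q + 1) =
      Ideal.span (MvPolynomial.X '' {k : Fin n | (k : ℕ) < q}) := by
    rw [partialSubmodule, smul_eq_mul, Ideal.mul_top]
    congr 1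
    ext r
    constructor
    · rintro ⟨j, h1, h2, rfl⟩
      refine ⟨⟨j - 1, by omega⟩, ?_, ?_⟩
      · change j - 1 < q; omega
      · rw [← linearForm_one]
        change linearForm _ (j - 1 + 1) = _
        rw [Nat.sub_add_cancel h1]
    · rintro ⟨k, hk, rfl⟩
      have hk : (k : ℕ) < q := hk
      exact ⟨k + 1, by omega, by omega, (linearForm_one k).symm⟩
  intro f hf
  rw [colonSubmodule, Submodule.mem_comap, hP, LinearMap.lsmul_apply, smul_eq_mul,
    show q + 1 = ((⟨q, hq⟩ : Fin n) : ℕ) + 1 from rfl, linearForm_one,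
    MvPolynomial.mem_ideal_span_X_image] at hf
  rw [hP, MvPolynomial.mem_ideal_span_X_image]
  intro s hs
  obtain ⟨k, hk, h⟩ := hf (Finsupp.single ⟨q, hq⟩ 1 + s) (by
    rw [MvPolynomial.mem_support_iff] at hs ⊢
    rwa [add_comm, mul_comm, MvPolynomial.coeff_mul_X])
  refine ⟨k, hk, ?_⟩
  have hne : k ≠ ⟨q, hq⟩ := by
    rintro rfl
    exact lt_irrefl _ (show q < q from hk)
  simpa [Finsupp.single_apply, hne.symm] using h

theorem sum_mul_linearForm (c d : Fin n → Fin n → K) (k : Fin n) :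
    ∑ l, MvPolynomial.C (d k l) * linearForm c (l + 1) =
      linearForm (fun i j => ∑ l, d i l * c l j) (k + 1) := by
  simp only [linearForm_succ, Finset.mul_sum, map_sum, Finset.sum_mul]
  rw [Finset.sum_comm]
  refine Finset.sum_congr rfl fun l _ => Finset.sum_congr rfl fun j _ => ?_
  rw [map_mul, mul_assoc]

theorem sum_inv_mul_linearForm (c : Fin n → Fin n → K) (hc : (Matrix.of c).det ≠ 0) (k : Fin n) :
    ∑ l, MvPolynomial.C ((Matrix.of c)⁻¹ k l) * linearForm c (l + 1) = MvPolynomial.X k := by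
  rw [sum_mul_linearForm c (fun i j => (Matrix.of c)⁻¹ i j), ← linearForm_one]
  congr 1
  funext i j
  exact congrFun₂ (Matrix.nonsing_inv_mul _ (isUnit_iff_ne_zero.2 hc)) i j

/-- The inverse matrix gives a change of coordinates `τ` taking the linear forms to the variables,
with `σ` going back; cycles are moved to the variables, bounded there, and the bounding chain is
moved back. -/
theorem cyc_le_bdy_polynomial (c : Fin n → Fin n → K) (hc : (Matrix.of c).det ≠ 0) (i : ℕ) :
    cyc (MvPolynomial (Fin n) K) (linearForm c) n (i + 1) ≤
      bdy (MvPolynomial (Fin n) K) (linearForm c) n (i + 1) := by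
  set C : Matrix (Fin n) (Fin n) K := Matrix.of c with hC
  set e : Fin n → Fin n → K := fun i j => (1 : Matrix (Fin n) (Fin n) K) i j with he
  let τ : MvPolynomial (Fin n) K →ₐ[K] MvPolynomial (Fin n) K :=
    MvPolynomial.aeval fun k : Fin n => linearForm (fun i j => C⁻¹ i j) (k + 1)
  let σ : MvPolynomial (Fin n) K →ₐ[K] MvPolynomial (Fin n) K :=
    MvPolynomial.aeval fun k : Fin n => linearForm c (k + 1)
  have hmap : ∀ (g : Fin n → MvPolynomial (Fin n) K) (d : Fin n → Fin n → K) (k : Fin n),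
      MvPolynomial.aeval (R := K) g (linearForm d (k + 1)) =
        ∑ l, MvPolynomial.C (d k l) * g l := by
    intro g d k
    rw [linearForm_succ, map_sum]
    refine Finset.sum_congr rfl fun l _ => ?_
    rw [map_mul, MvPolynomial.aeval_X, MvPolynomial.aeval_C, MvPolynomial.algebraMap_eq]
  have hτ : ∀ k : Fin n, τ (linearForm c (k + 1)) = linearForm e (k + 1) := by
    intro k
    rw [hmap, sum_mul_linearForm (fun i j => C⁻¹ i j) c k]
    congr 1
    funext i j
    exact congrFun₂ (Matrix.mul_nonsing_inv _ (isUnit_iff_ne_zero.2 hc)) i j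
  have hσ : ∀ k : Fin n, σ (linearForm e (k + 1)) = linearForm c (k + 1) := by
    intro k
    rw [linearForm_one, MvPolynomial.aeval_X]
  have hστ : ∀ f, σ (τ f) = f := by
    intro f
    change (σ.comp τ) f = AlgHom.id K _ f
    congr 1
    refine MvPolynomial.algHom_ext fun k => ?_
    rw [AlgHom.comp_apply, MvPolynomial.aeval_X, hmap]
    exact sum_inv_mul_linearForm c hc k
  have hd : ∀ (g : MvPolynomial (Fin n) K →ₐ[K] MvPolynomial (Fin n) K)
      (y y' : ℕ → MvPolynomial (Fin n) K) (_ : ∀ k : Fin n, g (y (k + 1)) = y' (k + 1))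
      (m : Finset (Fin n) → MvPolynomial (Fin n) K),
      kdiff _ y' n (fun s => g (m s)) = fun s => g (kdiff _ y n m s) := by
    intro g y y' h m
    have := koszulDiff_ringHom (g : MvPolynomial (Fin n) K →+* MvPolynomial (Fin n) K)
      (fun k : Fin n => y (k + 1)) m
    simp only [RingHom.coe_coe, h] at this
    exact this
  intro v hv
  rw [mem_cyc] at hv
  have h₁ : (fun s => τ (v s)) ∈ cyc (MvPolynomial (Fin n) K) (linearForm e) n (i + 1) := by
    refine mem_cyc.2 ⟨fun s hs => by beta_reduce; rw [hv.1 s hs, map_zero], ?_⟩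
    rw [hd τ _ _ hτ, hv.2]
    funext s; simp
  obtain ⟨a, ha, h₂⟩ := mem_bdy.1 (cyc_le_bdy_of_regular
    (fun q hq => colon_le_partial_variables hq) i h₁)
  refine mem_bdy.2 ⟨fun s => σ (a s), fun s hs => by beta_reduce; rw [ha s hs, map_zero], ?_⟩
  rw [hd σ _ _ hσ, h₂]
  funext s
  exact hστ _

theorem cyc_le_bdy_free (c : Fin n → Fin n → K) (hc : (Matrix.of c).det ≠ 0) (r i : ℕ) :
    cyc (Fin r → MvPolynomial (Fin n) K) (linearForm c) n (i + 1) ≤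
      bdy (Fin r → MvPolynomial (Fin n) K) (linearForm c) n (i + 1) := by
  intro v hv
  rw [mem_cyc] at hv
  have hex : ∀ j : Fin r, ∃ a ∈ koszulChains (MvPolynomial (Fin n) K) (MvPolynomial (Fin n) K) n
      (i + 1 + 1), kdiff _ (linearForm c) n a = fun s => v s j := by
    intro j
    refine mem_bdy.1 (cyc_le_bdy_polynomial c hc i (mem_cyc.2 ⟨fun s hs => ?_, ?_⟩))
    · beta_reduce; rw [hv.1 s hs]; rfl
    · have := koszulDiff_comp (LinearMap.proj (R := MvPolynomial (Fin n) K)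
        (φ := fun _ : Fin r => MvPolynomial (Fin n) K) j)
        (fun k : Fin n => linearForm c (k + 1)) v
      refine this.trans ?_
      rw [show koszulDiff _ (fun k : Fin n => linearForm c (k + 1)) v = 0 from hv.2]
      rfl
  choose a ha ha' using hex
  refine mem_bdy.2 ⟨fun s j => a j s, fun s hs => funext fun j => ha j s hs, ?_⟩
  funext s j
  have := koszulDiff_comp (LinearMap.proj (R := MvPolynomial (Fin n) K)
        (φ := fun _ : Fin r => MvPolynomial (Fin n) K) j)
        (fun k : Fin n => linearForm c (k + 1)) (fun s j => a j s)
  have h₁ := (congrFun this s).symm.trans (congrFun (ha' j) s)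
  exact h₁

/-- The projection of the polynomial ring onto the forms of degree `k`. -/
noncomputable def polyProj (K : Type*) [Field K] (n : ℕ) (k : ℤ) :
    MvPolynomial (Fin n) K →ₗ[K] MvPolynomial (Fin n) K :=
  if 0 ≤ k then MvPolynomial.homogeneousComponent k.toNat else 0

theorem coeff_polyProj (k : ℤ) (f : MvPolynomial (Fin n) K) (s : Fin n →₀ ℕ) :
    MvPolynomial.coeff s (polyProj K n k f) =
      if (s.degree : ℤ) = k then MvPolynomial.coeff s f else 0 := by
  unfold polyProj
  split_ifs with h₁ h₂ h₂
  · rw [MvPolynomial.coeff_homogeneousComponent, if_pos (by omega)]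
  · rw [MvPolynomial.coeff_homogeneousComponent, if_neg (by omega)]
  · omega
  · simp

theorem isGradingProj_polyProj : IsGradingProj n (polyProj K n) where
  idem d f := by
    ext s; simp only [coeff_polyProj]; split_ifs <;> rfl
  orth d e f h := by
    ext s; simp only [coeff_polyProj, MvPolynomial.coeff_zero]; split_ifs <;> first | rfl | omega
  sum f := by
    refine ⟨f.support.image fun s => (s.degree : ℤ), ?_⟩
    ext s
    rw [MvPolynomial.coeff_sum]
    simp only [coeff_polyProj]
    rw [Finset.sum_ite_eq]
    split_ifs with h
    · rfl
    · rw [eq_comm, ← MvPolynomial.notMem_support_iff]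
      exact fun hs => h (Finset.mem_image_of_mem _ hs)
  smul_X d k f := by
    ext s
    rw [smul_eq_mul, smul_eq_mul, coeff_polyProj, MvPolynomial.coeff_X_mul',
      MvPolynomial.coeff_X_mul', coeff_polyProj]
    by_cases h : k ∈ s.support
    · rw [if_pos h, if_pos h]
      have hs : s.degree = (s - Finsupp.single k 1).degree + 1 := by
        conv_lhs => rw [← tsub_add_cancel_of_le (Finsupp.single_le_iff.2
          (Nat.one_le_iff_ne_zero.2 (Finsupp.mem_support_iff.1 h)) : Finsupp.single k 1 ≤ s)]
        rw [map_add, Finsupp.degree_single]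
      congr 1
      rw [hs]; push_cast; simp
    · rw [if_neg h, if_neg h, ite_self]

instance finite_range_polyProj (k : ℤ) : Module.Finite K (LinearMap.range (polyProj K n k)) := by
  have h : LinearMap.range (polyProj K n k) ≤
      MvPolynomial.homogeneousSubmodule (Fin n) K k.toNat := by
    rintro _ ⟨f, rfl⟩
    unfold polyProj
    split_ifs
    · exact MvPolynomial.homogeneousComponent_mem _ _
    · exact Submodule.zero_mem _
  have : Module.Finite K (MvPolynomial.homogeneousSubmodule (Fin n) K k.toNat) :=
    Module.Finite.iff_fg.2 (MvPolynomial.homogeneousSubmodule_fg _ _ _)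
  exact Submodule.finiteDimensional_of_le h

theorem polyProj_of_neg {k : ℤ} (hk : k < 0) : polyProj K n k = 0 := by
  rw [polyProj, if_neg (by omega)]

theorem polyProj_mem_gradedMaximalIdeal {k : ℤ} (hk : 0 < k) (f : MvPolynomial (Fin n) K) :
    polyProj K n k f ∈ gradedMaximalIdeal K n := by
  rw [gradedMaximalIdeal, ← Set.image_univ, MvPolynomial.mem_ideal_span_X_image]
  intro s hs
  rw [MvPolynomial.mem_support_iff, coeff_polyProj] at hs
  by_contra! h
  refine hs (if_neg ?_)
  have : s = 0 := Finsupp.ext fun k => h k trivial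
  rw [this, map_zero]
  simp
  omega

/-- The projections of a free module onto its homogeneous components, where the basis vector
with index `j` has degree `e j`. -/
noncomputable def freeProj (K : Type*) [Field K] (n : ℕ) {r : ℕ} (e : Fin r → ℤ) (d : ℤ) :
    (Fin r → MvPolynomial (Fin n) K) →ₗ[K] (Fin r → MvPolynomial (Fin n) K) :=
  LinearMap.pi fun j => polyProj K n (d - e j) ∘ₗ LinearMap.proj j

theorem freeProj_apply {r : ℕ} (e : Fin r → ℤ) (d : ℤ) (f : Fin r → MvPolynomial (Fin n) K)
    (j : Fin r) : freeProj K n e d f j = polyProj K n (d - e j) (f j) := rfl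

theorem isGradingProj_freeProj {r : ℕ} (e : Fin r → ℤ) : IsGradingProj n (freeProj K n e) where
  idem d f := funext fun j => isGradingProj_polyProj.idem _ _
  orth d d' f h := funext fun j => isGradingProj_polyProj.orth _ _ _ (by omega)
  sum f := by
    choose T hT using fun j => (isGradingProj_polyProj (K := K) (n := n)).sum (f j)
    refine ⟨Finset.univ.biUnion fun j => (T j).image (· + e j), ?_⟩
    set T' := Finset.univ.biUnion fun j => (T j).image (· + e j) with hT'
    funext j
    rw [Finset.sum_apply]
    simp only [freeProj_apply]
    have h : T j ⊆ T'.image (· - e j) := by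
      intro d hd
      refine Finset.mem_image.2 ⟨d + e j, ?_, by ring⟩
      exact Finset.mem_biUnion.2 ⟨j, Finset.mem_univ _, Finset.mem_image_of_mem _ hd⟩
    have := sum_proj_of_subset isGradingProj_polyProj h (hT j)
    rwa [Finset.sum_image (by intro a _ b _ h; simpa using h)] at this
  smul_X d k f := funext fun j => by
    rw [freeProj_apply, Pi.smul_apply, Pi.smul_apply, freeProj_apply,
      show d + 1 - e j = d - e j + 1 by ring, isGradingProj_polyProj.smul_X]

instance finite_range_freeProj {r : ℕ} (e : Fin r → ℤ) (d : ℤ) :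
    Module.Finite K (LinearMap.range (freeProj K n e d)) := by
  let g : (∀ j : Fin r, LinearMap.range (polyProj K n (d - e j))) →ₗ[K]
      (Fin r → MvPolynomial (Fin n) K) :=
    LinearMap.pi fun j => (LinearMap.range (polyProj K n (d - e j))).subtype ∘ₗ LinearMap.proj j
  have hle : LinearMap.range (freeProj K n e d) ≤ LinearMap.range g := by
    rintro _ ⟨m, rfl⟩
    exact ⟨fun j => ⟨polyProj K n (d - e j) (m j), m j, rfl⟩, rfl⟩
  exact Submodule.finiteDimensional_of_le hle

end Polynomial

/-! ### Graded covers and bounds on internal degrees. -/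

section Cover

variable {K : Type*} [Field K] {n : ℕ} {M : Type*} [AddCommGroup M] [Module K M]
  [Module (MvPolynomial (Fin n) K) M] [IsScalarTower K (MvPolynomial (Fin n) K) M]
  {π : ℤ → M →ₗ[K] M}

theorem proj_smul_of_homogeneous (hπ : IsGradingProj n π) {e : ℤ} {m : M} (hm : π e m = m)
    (f : MvPolynomial (Fin n) K) (d : ℤ) : π d (f • m) = polyProj K n (d - e) f • m := by
  induction f using MvPolynomial.induction_on generalizing d with
  | C a =>
    rw [C_smul_eq, map_smul]
    have hp : polyProj K n (d - e) (MvPolynomial.C a) = if d = e then MvPolynomial.C a else 0 := by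
      ext s
      rw [coeff_polyProj]
      by_cases hs : 0 = s
      · subst hs
        rw [map_zero]
        by_cases h : d = e
        · simp [h]
        · rw [if_neg (by simp; omega), if_neg h]; simp
      · split_ifs <;> simp [MvPolynomial.coeff_C, hs]
    rw [hp]
    split_ifs with h
    · rw [C_smul_eq, h, hm]
    · rw [zero_smul, ← hm, hπ.orth _ _ _ h, smul_zero]
  | add f g hf hg => rw [add_smul, map_add, hf, hg, map_add, add_smul]
  | mul_X f k hf =>
    have h₁ := hπ.smul_X (d - 1) k (f • m)
    have h₂ := (isGradingProj_polyProj (K := K) (n := n)).smul_X (d - 1 - e) k f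
    rw [sub_add_cancel, hf] at h₁
    rw [show d - 1 - e + 1 = d - e by ring, smul_eq_mul, smul_eq_mul] at h₂
    rw [mul_comm, mul_smul, h₁, h₂, mul_smul]

/-- A finitely generated graded module is the image of a graded free module of finite rank. -/
theorem exists_graded_cover (hπ : IsGradingProj n π) [Module.Finite (MvPolynomial (Fin n) K) M] :
    ∃ (r : ℕ) (e : Fin r → ℤ) (q : (Fin r → MvPolynomial (Fin n) K) →ₗ[MvPolynomial (Fin n) K] M),
      Function.Surjective q ∧ ∀ d f, q (freeProj K n e d f) = π d (q f) := by
  classical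
  obtain ⟨G, hG⟩ := (Module.Finite.fg_top : (⊤ : Submodule (MvPolynomial (Fin n) K) M).FG)
  choose T hT using hπ.sum
  -- The homogeneous components of the generators, each paired with its degree, since a zero
  -- component does not determine one.
  let H : Finset (ℤ × M) := G.biUnion fun g => (T g).image fun d => (d, π d g)
  let E : Fin H.card ≃ H := H.equivFin.symm
  have hE : ∀ j, π (E j).1.1 (E j).1.2 = (E j).1.2 := by
    intro j
    obtain ⟨g, -, h⟩ := Finset.mem_biUnion.1 (E j).2
    obtain ⟨d, -, h⟩ := Finset.mem_image.1 h
    rw [← h]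
    exact hπ.idem _ _
  refine ⟨H.card, fun j => (E j).1.1, Fintype.linearCombination _ fun j => (E j).1.2, ?_, ?_⟩
  · rw [← LinearMap.range_eq_top, Fintype.range_linearCombination, eq_top_iff, ← hG,
      Submodule.span_le]
    intro g hg
    rw [← hT g]
    refine Submodule.sum_mem _ fun d hd => Submodule.subset_span ?_
    have hmem : (d, π d g) ∈ H := Finset.mem_biUnion.2 ⟨g, hg, Finset.mem_image_of_mem _ hd⟩
    exact ⟨E.symm ⟨_, hmem⟩, by simp⟩
  · intro d f
    rw [Fintype.linearCombination_apply, Fintype.linearCombination_apply, map_sum]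
    refine Finset.sum_congr rfl fun j _ => ?_
    rw [proj_smul_of_homogeneous hπ (hE j), freeProj_apply]

theorem finite_range_proj (hπ : IsGradingProj n π) [Module.Finite (MvPolynomial (Fin n) K) M]
    (d : ℤ) : Module.Finite K (LinearMap.range (π d)) := by
  obtain ⟨r, e, q, hq, h⟩ := exists_graded_cover hπ
  have hle : LinearMap.range (π d) ≤
      (LinearMap.range (freeProj K n e d)).map (q.restrictScalars K) := by
    rintro _ ⟨m, rfl⟩
    obtain ⟨f, rfl⟩ := hq m
    exact ⟨_, ⟨f, rfl⟩, h d f⟩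
  exact Submodule.finiteDimensional_of_le hle

theorem exists_proj_eq_zero_of_lt (hπ : IsGradingProj n π)
    [Module.Finite (MvPolynomial (Fin n) K) M] : ∃ B : ℤ, ∀ d < B, π d = 0 := by
  obtain ⟨r, e, q, hq, h⟩ := exists_graded_cover hπ
  obtain ⟨B, hB⟩ := Set.Finite.bddBelow (Set.finite_range e)
  refine ⟨B, fun d hd => LinearMap.ext fun m => ?_⟩
  obtain ⟨f, rfl⟩ := hq m
  rw [← h]
  have : freeProj K n e d f = 0 := by
    funext j
    have := hB ⟨j, rfl⟩
    rw [freeProj_apply, polyProj_of_neg (by omega)]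
    rfl
  rw [this, map_zero]
  rfl

theorem gradedMaximalIdeal_le_span (c : Fin n → Fin n → K) (hc : (Matrix.of c).det ≠ 0) :
    gradedMaximalIdeal K n ≤
      Ideal.span {r | ∃ j : ℕ, 1 ≤ j ∧ j < n + 1 ∧ r = linearForm c j} := by
  rw [gradedMaximalIdeal, Ideal.span_le]
  rintro _ ⟨k, rfl⟩
  rw [← sum_inv_mul_linearForm c hc k]
  refine Submodule.sum_mem _ fun l _ => Ideal.mul_mem_left _ _ (Ideal.subset_span ?_)
  exact ⟨l + 1, by omega, by omega, rfl⟩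

theorem linearForm_mem_gradedMaximalIdeal (c : Fin n → Fin n → K) (j : ℕ) :
    linearForm c j ∈ gradedMaximalIdeal K n := by
  unfold linearForm
  split_ifs
  · exact Submodule.sum_mem _ fun l _ => Ideal.mul_mem_left _ _ (Ideal.subset_span ⟨l, rfl⟩)
  · exact Submodule.zero_mem _

/-- H_0(n) is M/𝔪M, which vanishes above the largest degree of a generator. The ideal 𝔪 is the same
for every basis of linear forms, so `D` is uniform in `c`. -/
theorem exists_koszulVanish_zero (hπ : IsGradingProj n π)
    [Module.Finite (MvPolynomial (Fin n) K) M] :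
    ∃ D : ℤ, ∀ c : Fin n → Fin n → K, (Matrix.of c).det ≠ 0 → ∀ d > D,
      KoszulVanish π (linearForm c) n 0 d := by
  obtain ⟨r, e, q, hq, h⟩ := exists_graded_cover hπ
  obtain ⟨D, hD⟩ := Set.Finite.bddAbove (Set.finite_range e)
  refine ⟨D, fun c hc d hd v hv hvd => mem_bdy_zero_iff.2 ⟨(mem_cyc.1 hv).1, ?_⟩⟩
  obtain ⟨f, hf⟩ := hq (v ∅)
  have h₁ : v ∅ = q (freeProj K n e d f) := by
    rw [h, hf]
    conv_lhs => rw [← hvd]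
    rw [chainProj_apply]
    simp
  rw [h₁, pi_eq_sum_univ' (freeProj K n e d f), map_sum]
  refine Submodule.sum_mem _ fun j _ => ?_
  rw [map_smul]
  refine Submodule.smul_mem_smul (gradedMaximalIdeal_le_span c hc ?_) trivial
  have := hD ⟨j, rfl⟩
  exact polyProj_mem_gradedMaximalIdeal (by omega) _

/-- The restriction of the grading to a graded submodule. -/
noncomputable def restrictProj (π : ℤ → M →ₗ[K] M) (N : Submodule (MvPolynomial (Fin n) K) M)
    (hN : ∀ d, ∀ m ∈ N, π d m ∈ N) (d : ℤ) : N →ₗ[K] N where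
  toFun m := ⟨π d m, hN d m m.2⟩
  map_add' a b := Subtype.ext (map_add _ _ _)
  map_smul' a b := Subtype.ext (map_smul _ _ _)

theorem isGradingProj_restrictProj (hπ : IsGradingProj n π)
    (N : Submodule (MvPolynomial (Fin n) K) M) (hN : ∀ d, ∀ m ∈ N, π d m ∈ N) :
    IsGradingProj n (restrictProj π N hN) where
  idem d m := Subtype.ext (hπ.idem _ _)
  orth d e m h := Subtype.ext (hπ.orth _ _ _ h)
  sum m := by
    obtain ⟨T, hT⟩ := hπ.sum (m : M)
    refine ⟨T, Subtype.ext ?_⟩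
    rw [Submodule.coe_sum]
    exact hT
  smul_X d k m := Subtype.ext (hπ.smul_X _ _ _)

end Cover

/-- The Koszul homology of a finitely generated graded module with respect to all bases of the
space of linear forms vanishes in all degrees above a common bound. -/
theorem exists_koszulVanish {K : Type u} [Field K] {n : ℕ} (i : ℕ) :
    ∀ (M : Type u) [AddCommGroup M] [Module K M] [Module (MvPolynomial (Fin n) K) M]
      [IsScalarTower K (MvPolynomial (Fin n) K) M] [Module.Finite (MvPolynomial (Fin n) K) M]
      (π : ℤ → M →ₗ[K] M), IsGradingProj n π →
      ∃ D : ℤ, ∀ c : Fin n → Fin n → K, (Matrix.of c).det ≠ 0 → ∀ d > D,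
        KoszulVanish π (linearForm c) n i d := by
  induction i with
  | zero => intro M _ _ _ _ _ π hπ; exact exists_koszulVanish_zero hπ
  | succ i ih =>
    intro M _ _ _ _ _ π hπ
    -- Dimension shifting: for the free cover F, H_{i+1}(F) = 0, so H_{i+1}(M) embeds in H_i(ker q)
    -- preserving internal degree. A bound for the syzygy module therefore serves for M.
    obtain ⟨r, e, q, hq, h⟩ := exists_graded_cover hπ
    have hN : ∀ d, ∀ m ∈ LinearMap.ker q, freeProj K n e d m ∈ LinearMap.ker q := by
      intro d m hm
      rw [LinearMap.mem_ker] at hm ⊢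
      rw [h, hm, map_zero]
    have hF := isGradingProj_freeProj (K := K) (n := n) e
    obtain ⟨D, hD⟩ := ih (LinearMap.ker q) (restrictProj (freeProj K n e) _ hN)
      (isGradingProj_restrictProj hF _ hN)
    refine ⟨D, fun c hc d hd v hv hvd => ?_⟩
    have hv' := mem_cyc.1 hv
    choose g hg using hq
    -- The lift is cut off outside homological degree `i + 1`, because `g 0` need not be zero.
    let w₀ : Finset (Fin n) → (Fin r → MvPolynomial (Fin n) K) :=
      fun s => if s.card = i + 1 then g (v s) else 0
    have hw₀ : w₀ ∈ koszulChains (MvPolynomial (Fin n) K) _ n (i + 1) := fun s hs => if_neg hs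
    have hqw₀ : (fun s => q (w₀ s)) = v := by
      funext s
      by_cases hs : s.card = i + 1
      · simp only [w₀, if_pos hs, hg]
      · simp only [w₀, if_neg hs, map_zero, hv'.1 s hs]
    -- Taking the component of degree `d` makes the boundary of the lift homogeneous, so that the
    -- bound for `ker q` applies to it.
    let w := chainProj (freeProj K n e) d w₀
    have hw : w ∈ koszulChains (MvPolynomial (Fin n) K) _ n (i + 1) := chainProj_mem_chains d hw₀
    have hqw : (fun s => q (w s)) = v := by
      conv_rhs => rw [← hvd, ← hqw₀]
      funext s
      exact h _ _
    have hlin := isLinearSeq_linearForm hF c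
    have hker : ∀ s, kdiff _ (linearForm c) n w s ∈ LinearMap.ker q := by
      intro s
      have := congrFun (koszulDiff_comp q (fun k : Fin n => linearForm c (k + 1)) w) s
      rw [hqw] at this
      rw [LinearMap.mem_ker]
      exact this.symm.trans (congrFun hv'.2 s)
    let x : Finset (Fin n) → LinearMap.ker q := fun s => ⟨_, hker s⟩
    have hsub := fun a : Finset (Fin n) → LinearMap.ker q =>
      koszulDiff_comp (LinearMap.ker q).subtype (fun k : Fin n => linearForm c (k + 1)) a
    have hx : x ∈ cyc (LinearMap.ker q) (linearForm c) n i := by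
      refine mem_cyc.2 ⟨fun s hs => Subtype.ext (koszulDiff_mem _ hw s hs), ?_⟩
      funext s
      refine Subtype.ext ?_
      have := congrFun (hsub x) s
      refine this.symm.trans ?_
      exact congrFun (koszulDiff_koszulDiff _ w) s
    have hxd : chainProj (restrictProj (freeProj K n e) _ hN) d x = x := by
      funext s
      refine Subtype.ext ?_
      have := chainProj_kdiff hlin d w
      rw [chainProj_idem hF] at this
      exact congrFun this s
    obtain ⟨a, ha, hax⟩ := mem_bdy.1 (hD c hc d hd x hx hxd)
    have ha' : (fun s => (a s : Fin r → MvPolynomial (Fin n) K)) ∈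
        koszulChains (MvPolynomial (Fin n) K) _ n (i + 1) := fun s hs => by beta_reduce; rw [ha s hs]; rfl
    -- Correcting the lift by a chain in `ker q` turns it into a cycle of F without changing its
    -- image `v`; bounding this cycle in F and applying `q` bounds `v`.
    have hcyc : w - (fun s => (a s : Fin r → MvPolynomial (Fin n) K)) ∈
        cyc (Fin r → MvPolynomial (Fin n) K) (linearForm c) n (i + 1) := by
      refine mem_cyc.2 ⟨Submodule.sub_mem _ hw ha', ?_⟩
      rw [map_sub, sub_eq_zero]
      refine Eq.trans ?_ (hsub a).symm
      rw [show koszulDiff _ (fun k : Fin n => linearForm c (k + 1)) a = x from hax]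
      rfl
    obtain ⟨b, hb, hbw⟩ := mem_bdy.1 (cyc_le_bdy_free c hc r i hcyc)
    refine mem_bdy.2 ⟨fun s => q (b s), fun s hs => by beta_reduce; rw [hb s hs, map_zero], ?_⟩
    refine (koszulDiff_comp q (fun k : Fin n => linearForm c (k + 1)) b).trans ?_
    rw [show koszulDiff _ (fun k : Fin n => linearForm c (k + 1)) b = _ from hbw, ← hqw]
    funext s
    rw [Pi.sub_apply, map_sub, (a s).2, sub_zero]

/-! ### Generic properties and semicontinuity of rank. -/

section Generic

variable {K : Type u} [Field K] {n : ℕ}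

theorem Generically.mono {P Q : (Fin n → Fin n → K) → Prop} (h : Generically P)
    (hPQ : ∀ c, P c → Q c) : Generically Q := by
  obtain ⟨f, hf, h⟩ := h
  exact ⟨f, hf, fun c hc => hPQ c (h c hc)⟩

theorem Generically.and {P Q : (Fin n → Fin n → K) → Prop} (hP : Generically P)
    (hQ : Generically Q) : Generically fun c => P c ∧ Q c := by
  obtain ⟨f, hf, hP⟩ := hP
  obtain ⟨g, hg, hQ⟩ := hQ
  refine ⟨f * g, mul_ne_zero hf hg, fun c hc => ?_⟩
  rw [map_mul] at hc
  exact ⟨hP c (left_ne_zero_of_mul hc), hQ c (right_ne_zero_of_mul hc)⟩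

theorem Generically.forall_mem {ι : Type*} (s : Finset ι) {P : ι → (Fin n → Fin n → K) → Prop}
    (h : ∀ a ∈ s, Generically (P a)) : Generically fun c => ∀ a ∈ s, P a c := by
  classical
  induction s using Finset.induction_on with
  | empty => exact ⟨1, one_ne_zero, by simp⟩
  | insert a s _ ih =>
    refine ((h a (by simp)).and (ih fun b hb => h b (by simp [hb]))).mono fun c hc b hb => ?_
    rcases Finset.mem_insert.1 hb with rfl | hb
    · exact hc.1
    · exact hc.2 b hb

theorem Generically.of_eval {P : (Fin n → Fin n → K) → Prop} (c₀ : Fin n → Fin n → K)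
    (f : MvPolynomial (Fin n × Fin n) K) (hf : MvPolynomial.eval (fun q => c₀ q.1 q.2) f ≠ 0)
    (h : ∀ c : Fin n → Fin n → K, MvPolynomial.eval (fun q => c q.1 q.2) f ≠ 0 → P c) :
    Generically P :=
  ⟨f, fun h0 => hf (by rw [h0, map_zero]), h⟩

theorem exists_eval_ne_zero [Infinite K] {f : MvPolynomial (Fin n × Fin n) K} (hf : f ≠ 0) :
    ∃ c : Fin n → Fin n → K, MvPolynomial.eval (fun q => c q.1 q.2) f ≠ 0 := by
  by_contra! h
  refine hf (MvPolynomial.funext fun x => ?_)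
  rw [map_zero]
  exact h fun i j => x (i, j)

theorem Generically.exists [Infinite K] {P : (Fin n → Fin n → K) → Prop} (h : Generically P) :
    ∃ c, P c := by
  obtain ⟨f, hf, h⟩ := h
  obtain ⟨c, hc⟩ := exists_eval_ne_zero hf
  exact ⟨c, h c hc⟩

/-- Over an infinite field two nonempty basic open sets meet, so a generic value is unique. -/
theorem genericValue_eq [Infinite K] {F : (Fin n → Fin n → K) → ℕ} {a : ℕ}
    (h : Generically fun c => F c = a) : genericValue F = a := by
  have hex : ∃ a : ℕ, Generically (fun c => F c = a) := ⟨a, h⟩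
  rw [genericValue, dif_pos hex]
  obtain ⟨c, h₁, h₂⟩ := (hex.choose_spec.and h).exists
  rw [← h₁, h₂]

theorem generically_det_ne_zero : Generically fun c : Fin n → Fin n → K =>
    (Matrix.of c).det ≠ 0 := by
  refine Generically.of_eval (fun i j => (1 : Matrix (Fin n) (Fin n) K) i j)
    (Matrix.of fun i j => MvPolynomial.X (i, j)).det ?_ fun c hc => ?_
  · rw [RingHom.map_det]
    have : (MvPolynomial.eval fun q : Fin n × Fin n => (1 : Matrix (Fin n) (Fin n) K) q.1 q.2).mapMatrix
        (Matrix.of fun i j => MvPolynomial.X (i, j)) = 1 := by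
      ext i j; simp
    rw [this, Matrix.det_one]
    exact one_ne_zero
  · rw [RingHom.map_det] at hc
    have : (MvPolynomial.eval fun q : Fin n × Fin n => c q.1 q.2).mapMatrix
        (Matrix.of fun i j => MvPolynomial.X (i, j)) = Matrix.of c := by
      ext i j; simp
    rwa [this] at hc

variable {V W : Type*} [AddCommGroup V] [Module K V] [AddCommGroup W] [Module K W]
  [Module.Finite K V]

/-- The rank is lower semicontinuous in a linear family of linear maps. -/
theorem generically_rank_le (L : (Fin n → Fin n → K) →ₗ[K] V →ₗ[K] W) (c₀ : Fin n → Fin n → K) :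
    Generically fun c => Module.finrank K (LinearMap.range (L c₀)) ≤
      Module.finrank K (LinearMap.range (L c)) := by
  set r := Module.finrank K (LinearMap.range (L c₀)) with hr
  let b := Module.finBasis K (LinearMap.range (L c₀))
  choose v hv using fun j => (b j).2
  let ι : (Fin r → K) →ₗ[K] V := Fintype.linearCombination K v
  have hinj : LinearMap.ker (L c₀ ∘ₗ ι) = ⊥ := by
    rw [LinearMap.ker_eq_bot']
    intro x hx
    have h₁ : Fintype.linearCombination K (fun j => b j) x = 0 := by
      refine Subtype.ext ?_
      refine Eq.trans ?_ hx
      simp only [ι, LinearMap.comp_apply, Fintype.linearCombination_apply, map_sum, map_smul, hv]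
      rw [Submodule.coe_sum]
      rfl
    exact funext (Fintype.linearIndependent_iff.1 b.linearIndependent x
      (by simpa [Fintype.linearCombination_apply] using h₁))
  obtain ⟨ψ, hψ⟩ := LinearMap.exists_leftInverse_of_injective _ hinj
  -- The matrix of `ψ ∘ L c ∘ ι`, whose entries are linear forms in the entries of `c`. It is the
  -- identity at `c₀`, and wherever its determinant is nonzero `L c` has rank at least `r`.
  let P : Matrix (Fin r) (Fin r) (MvPolynomial (Fin n × Fin n) K) := Matrix.of fun i j =>
    ∑ q : Fin n × Fin n, MvPolynomial.X q *
      MvPolynomial.C (ψ (L (Pi.single q.1 (Pi.single q.2 1)) (ι (Pi.single j 1))) i)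
  have hP : ∀ c : Fin n → Fin n → K,
      (MvPolynomial.eval fun q : Fin n × Fin n => c q.1 q.2).mapMatrix P =
        LinearMap.toMatrix' (ψ ∘ₗ L c ∘ₗ ι) := by
    intro c
    have hc : c = ∑ q : Fin n × Fin n, c q.1 q.2 • Pi.single q.1 (Pi.single q.2 1) := by
      rw [Fintype.sum_prod_type]
      funext i j
      simp only [Finset.sum_apply, Pi.smul_apply]
      rw [Finset.sum_eq_single i, Finset.sum_eq_single j]
      · simp
      · intro l _ hl; simp [hl.symm]
      · simp
      · intro k _ hk
        refine Finset.sum_eq_zero fun l _ => ?_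
        rw [Pi.single_eq_of_ne hk.symm]; simp
      · simp
    ext i j
    rw [LinearMap.toMatrix'_apply]
    conv_rhs => rw [hc]
    simp only [P, RingHom.mapMatrix_apply, Matrix.map_apply, Matrix.of_apply, map_sum, map_mul,
      MvPolynomial.eval_X, MvPolynomial.eval_C, LinearMap.comp_apply, LinearMap.sum_apply,
      map_smul, LinearMap.smul_apply, Finset.sum_apply, Pi.smul_apply, smul_eq_mul]
  refine Generically.of_eval c₀ P.det ?_ fun c hc => ?_
  · rw [RingHom.map_det, hP, hψ, LinearMap.toMatrix'_id, Matrix.det_one]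
    exact one_ne_zero
  · rw [RingHom.map_det, hP, LinearMap.det_toMatrix'] at hc
    have hs : LinearMap.range (ψ ∘ₗ L c ∘ₗ ι) = ⊤ :=
      LinearMap.range_eq_top.2 ((LinearMap.equivOfDetNeZero _ hc).surjective)
    have h₁ : (⊤ : Submodule K (Fin r → K)) ≤ (LinearMap.range (L c)).map ψ := by
      rw [← hs]
      rintro _ ⟨x, rfl⟩
      exact ⟨_, ⟨_, rfl⟩, rfl⟩
    have h₂ := Submodule.finrank_mono h₁
    rw [finrank_top, Module.finrank_fin_fun] at h₂
    exact h₂.trans (Submodule.finrank_map_le _ _)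

/-- Ranks are bounded by the dimension of `V`, so a maximum is attained, and by semicontinuity it is
the generic value. -/
theorem exists_generically_rank_eq (L : (Fin n → Fin n → K) →ₗ[K] V →ₗ[K] W) :
    ∃ r, (Generically fun c => Module.finrank K (LinearMap.range (L c)) = r) ∧
      ∀ c, Module.finrank K (LinearMap.range (L c)) ≤ r := by
  have hb : BddAbove (Set.range fun c => Module.finrank K (LinearMap.range (L c))) := by
    refine ⟨Module.finrank K V, ?_⟩
    rintro _ ⟨c, rfl⟩
    exact LinearMap.finrank_range_le _
  obtain ⟨c₀, h₀⟩ := Nat.sSup_mem (Set.range_nonempty _) hb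
  refine ⟨_, (generically_rank_le L c₀).mono fun c hc => ?_, fun c => le_csSup hb ⟨c, rfl⟩⟩
  exact le_antisymm (le_csSup hb ⟨c, rfl⟩) (h₀ ▸ hc)

end Generic

/-! ### Koszul differentials as a linear family in the coefficient matrix. -/

section GenericWindow

variable {K : Type u} [Field K] {n : ℕ} {M : Type*} [AddCommGroup M] [Module K M]
  [Module (MvPolynomial (Fin n) K) M] [IsScalarTower K (MvPolynomial (Fin n) K) M]

theorem koszulDiff_add {p : ℕ} (z z' : Fin p → MvPolynomial (Fin n) K) (m : Finset (Fin p) → M) :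
    koszulDiff M (fun k => z k + z' k) m = koszulDiff M z m + koszulDiff M z' m := by
  funext t
  rw [Pi.add_apply]
  simp only [koszulDiff_apply, mul_add, add_smul, Finset.sum_add_distrib]

theorem koszulDiff_C_mul {p : ℕ} (a : K) (z : Fin p → MvPolynomial (Fin n) K)
    (m : Finset (Fin p) → M) :
    koszulDiff M (fun k => MvPolynomial.C a * z k) m = a • koszulDiff M z m := by
  funext t
  rw [Pi.smul_apply, ← C_smul_eq (n := n) a]
  simp only [koszulDiff_apply, Finset.smul_sum, smul_smul]
  exact Finset.sum_congr rfl fun j _ => by rw [mul_left_comm]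

theorem linearForm_add (c c' : Fin n → Fin n → K) (j : ℕ) :
    linearForm (c + c') j = linearForm c j + linearForm c' j := by
  unfold linearForm
  split_ifs
  · simp [add_mul, Finset.sum_add_distrib]
  · simp

theorem linearForm_smul (a : K) (c : Fin n → Fin n → K) (j : ℕ) :
    linearForm (a • c) j = MvPolynomial.C a * linearForm c j := by
  unfold linearForm
  split_ifs
  · simp [Finset.mul_sum, mul_assoc]
  · simp

/-- The Koszul differentials of the sequences of linear forms, as a linear family of maps on a
space of chains. -/
noncomputable def kdiffFamily {p : ℕ} (W : Submodule K (Finset (Fin p) → M)) :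
    (Fin n → Fin n → K) →ₗ[K] W →ₗ[K] (Finset (Fin p) → M) where
  toFun c := ((kdiff M (linearForm c) p).restrictScalars K).domRestrict W
  map_add' c c' := by
    ext1 x
    change koszulDiff M _ (x : Finset (Fin p) → M) = koszulDiff M _ _ + koszulDiff M _ _
    rw [← koszulDiff_add]
    simp only [linearForm_add]
    rfl
  map_smul' a c := by
    ext1 x
    change koszulDiff M _ (x : Finset (Fin p) → M) = a • koszulDiff M _ _
    rw [← koszulDiff_C_mul]
    simp only [linearForm_smul]
    rfl

theorem finrank_range_kdiffFamily {π : ℤ → M →ₗ[K] M} (p i : ℕ) (T : Finset ℤ)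
    (c : Fin n → Fin n → K) :
    Module.finrank K (LinearMap.range (kdiffFamily (windowChains n π p i T) c)) =
      windowRank π (linearForm c) p i T := by
  rw [windowRank, ← LinearMap.range_domRestrict]
  rfl

theorem exists_generically_windowRank_eq (π : ℤ → M →ₗ[K] M)
    [∀ d, Module.Finite K (LinearMap.range (π d))] (p i : ℕ) (T : Finset ℤ) :
    ∃ r, (Generically fun c : Fin n → Fin n → K => windowRank π (linearForm c) p i T = r) ∧
      ∀ c : Fin n → Fin n → K, windowRank π (linearForm c) p i T ≤ r := by
  simpa only [finrank_range_kdiffFamily] using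
    exists_generically_rank_eq (n := n) (kdiffFamily (windowChains n π p i T))

/-- Vanishing is a lower bound on ranks, and generic ranks are at least those at `c₀`. -/
theorem generically_koszulVanish {π : ℤ → M →ₗ[K] M} (hπ : IsGradingProj n π)
    [∀ d, Module.Finite K (LinearMap.range (π d))] {p i : ℕ} {d : ℤ} {c₀ : Fin n → Fin n → K}
    (h : KoszulVanish π (linearForm c₀) p i d) :
    Generically fun c : Fin n → Fin n → K => KoszulVanish π (linearForm c) p i d := by
  obtain ⟨r₁, h₁, h₁'⟩ := exists_generically_windowRank_eq (n := n) π p i {d}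
  obtain ⟨r₂, h₂, h₂'⟩ := exists_generically_windowRank_eq (n := n) π p (i + 1) {d}
  refine (h₁.and h₂).mono fun c hc => ?_
  rw [koszulVanish_iff_rank hπ (isLinearSeq_linearForm hπ _)] at h ⊢
  have := h₁' c₀
  have := h₂' c₀
  rw [hc.1, hc.2]
  omega

end GenericWindow

/-! ### Existence of a basis of linear forms with torsion annihilator modules. -/

section FilterRegular

variable {K : Type u} [Field K] {n : ℕ} {M : Type*} [AddCommGroup M]
  [Module (MvPolynomial (Fin n) K) M]

/-- The submodule of elements which are moved into `P` by the `k`-th power of `I`. -/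
def powTorsion {R : Type*} [CommRing R] {M : Type*} [AddCommGroup M] [Module R M] (I : Ideal R)
    (P : Submodule R M) : ℕ →o Submodule R M where
  toFun k :=
    { carrier := {x | ∀ f ∈ I ^ k, f • x ∈ P}
      add_mem' := fun ha hb f hf => by
        rw [smul_add]; exact P.add_mem (ha f hf) (hb f hf)
      zero_mem' := fun f _ => by rw [smul_zero]; exact P.zero_mem
      smul_mem' := fun r a ha f hf => by rw [smul_comm]; exact P.smul_mem r (ha f hf) }
  monotone' k l h x hx f hf := hx f (Ideal.pow_le_pow_right h hf)

theorem mem_powTorsion {R : Type*} [CommRing R] {M : Type*} [AddCommGroup M] [Module R M]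
    {I : Ideal R} {P : Submodule R M} {k : ℕ} {x : M} :
    x ∈ powTorsion I P k ↔ ∀ f ∈ I ^ k, f • x ∈ P := Iff.rfl

/-- A linear form outside finitely many proper subspaces is regular modulo `𝔪`-power torsion. -/
theorem exists_linear_form_torsion [Infinite K] [Module.Finite (MvPolynomial (Fin n) K) M]
    (P : Submodule (MvPolynomial (Fin n) K) M) (E : Submodule K (Fin n → K)) (hE : E ≠ ⊤) :
    ∃ w : Fin n → K, w ∉ E ∧ ∃ k : ℕ, ∀ f ∈ gradedMaximalIdeal K n ^ k, ∀ x : M,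
      (∑ l, MvPolynomial.C (w l) * MvPolynomial.X l : MvPolynomial (Fin n) K) • x ∈ P →
        f • x ∈ P := by
  classical
  set I := gradedMaximalIdeal K n with hI
  -- By the ascending chain condition the power torsion stabilizes; `T` is the saturation of `P`
  -- with respect to 𝔪, and M/T has no nonzero element killed by 𝔪.
  obtain ⟨k, hk⟩ := monotone_stabilizes_iff_noetherian.2
    (inferInstance : IsNoetherian (MvPolynomial (Fin n) K) M) (powTorsion I P)
  set T := powTorsion I P k with hT
  have hsat : ∀ x : M, (∀ f ∈ I, f • x ∈ T) → x ∈ T := by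
    intro x hx
    rw [hk (k + 1) (by omega), mem_powTorsion]
    intro f hf
    rw [pow_succ] at hf
    induction hf using Submodule.mul_induction_on' with
    | mem_mul_mem g hg f hf =>
      rw [mul_smul]
      exact hx f hf g hg
    | add f _ g _ hf hg =>
      rw [add_smul]
      exact P.add_mem hf hg
  let ℓ : (Fin n → K) →ₗ[K] MvPolynomial (Fin n) K :=
    Fintype.linearCombination K fun l => MvPolynomial.X l
  have hℓ : ∀ w, ℓ w = ∑ l, MvPolynomial.C (w l) * MvPolynomial.X l := by
    intro w
    simp only [ℓ, Fintype.linearCombination_apply, MvPolynomial.smul_eq_C_mul]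
  have hfin : (associatedPrimes (MvPolynomial (Fin n) K) (M ⧸ T)).Finite :=
    associatedPrimes.finite _ _
  -- Prime avoidance by linear algebra: the linear forms inside an associated prime of M/T form a
  -- subspace, and a vector space over an infinite field is not a finite union of proper subspaces.
  -- Avoiding `E` as well will give linear independence.
  let s : Finset (Submodule K (Fin n → K)) := insert E (hfin.toFinset.image fun p =>
    (p.restrictScalars K).comap ℓ)
  have hs : ⊤ ∉ s := by
    rw [Finset.mem_insert, not_or]
    refine ⟨hE.symm, fun h => ?_⟩
    obtain ⟨p, hp, hp'⟩ := Finset.mem_image.1 h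
    rw [Set.Finite.mem_toFinset, AssociatedPrimes.mem_iff, isAssociatedPrime_iff] at hp
    obtain ⟨hprime, x, hx⟩ := hp
    obtain ⟨x, rfl⟩ := Submodule.mkQ_surjective _ x
    -- An associated prime containing all linear forms would contain 𝔪; the element it annihilates
    -- would then lie in the saturated submodule `T`, a contradiction.
    have hle : I ≤ p := by
      rw [hI, gradedMaximalIdeal, Ideal.span_le]
      rintro _ ⟨l, rfl⟩
      have : Pi.single l 1 ∈ (p.restrictScalars K).comap ℓ := by rw [hp']; trivial
      have h₂ : ℓ (Pi.single l 1) ∈ p := this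
      simpa [ℓ] using h₂
    have hxT : x ∈ T := by
      refine hsat x fun f hf => ?_
      have := hle hf
      rw [hx, Submodule.mem_colon_singleton, ← map_smul, Submodule.mem_bot,
        Submodule.mkQ_apply, Submodule.Quotient.mk_eq_zero] at this
      exact this
    refine hprime.ne_top ?_
    rw [hx, Ideal.eq_top_iff_one, Submodule.mem_colon_singleton, one_smul, Submodule.mem_bot,
      Submodule.mkQ_apply, Submodule.Quotient.mk_eq_zero]
    exact hxT
  obtain ⟨w, hw⟩ : ∃ w, w ∉ ⋃ p ∈ s, (p : Set (Fin n → K)) := by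
    by_contra! h
    exact Subspace.biUnion_ne_univ_of_top_notMem hs (Set.eq_univ_of_forall h)
  simp only [Set.mem_iUnion, not_exists, SetLike.mem_coe] at hw
  refine ⟨w, hw E (Finset.mem_insert_self _ _), k, fun f hf x hx => ?_⟩
  rw [← hℓ] at hx
  have hreg : IsSMulRegular (M ⧸ T) (ℓ w) := by
    by_contra hn
    have hn : ℓ w ∈ {r : MvPolynomial (Fin n) K | IsSMulRegular (M ⧸ T) r}ᶜ := hn
    rw [← biUnion_associatedPrimes_eq_compl_regular] at hn
    obtain ⟨p, hp, hwp⟩ := Set.mem_iUnion₂.1 hn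
    exact hw _ (Finset.mem_insert_of_mem (Finset.mem_image_of_mem _
      (hfin.mem_toFinset.2 hp))) hwp
  have hP : P ≤ T := fun x hx f _ => P.smul_mem f hx
  have h₁ : ℓ w • (Submodule.Quotient.mk x : M ⧸ T) = 0 := by
    rw [← Submodule.Quotient.mk_smul, Submodule.Quotient.mk_eq_zero]
    exact hP hx
  have h₂ := hreg.right_eq_zero_of_smul h₁
  rw [Submodule.Quotient.mk_eq_zero] at h₂
  exact h₂ f hf

theorem partialSubmodule_congr {R : Type*} [CommRing R] {M : Type*} [AddCommGroup M] [Module R M]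
    {y y' : ℕ → R} {p : ℕ} (h : ∀ j, 1 ≤ j → j < p → y j = y' j) :
    partialSubmodule M y p = partialSubmodule M y' p := by
  rw [partialSubmodule, partialSubmodule]
  congr 2
  ext r
  constructor
  · rintro ⟨j, h1, h2, rfl⟩
    exact ⟨j, h1, h2, h j h1 h2⟩
  · rintro ⟨j, h1, h2, rfl⟩
    exact ⟨j, h1, h2, (h j h1 h2).symm⟩

theorem linearForm_congr {c c' : Fin n → Fin n → K} {p : ℕ}
    (h : ∀ k : Fin n, (k : ℕ) < p → c k = c' k) {j : ℕ} (hj : 1 ≤ j) (hjp : j ≤ p) :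
    linearForm c j = linearForm c' j := by
  unfold linearForm
  split_ifs with h₁
  · rw [h ⟨j - 1, by omega⟩ (by simp; omega)]
  · rfl

theorem annihilatorTorsion_congr {I : Ideal (MvPolynomial (Fin n) K)} {c c' : Fin n → Fin n → K}
    {p : ℕ} (h : ∀ k : Fin n, (k : ℕ) < p → c k = c' k) (hp : 1 ≤ p)
    (ht : AnnihilatorTorsion M I (linearForm c) p) :
    AnnihilatorTorsion M I (linearForm c') p := by
  obtain ⟨k, hk⟩ := ht
  refine ⟨k, fun f hf x hx => ?_⟩
  have h₁ := partialSubmodule_congr (M := M) (p := p)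
    fun j hj hjp => linearForm_congr h hj hjp.le
  have h₂ := linearForm_congr h hp le_rfl
  have h₃ := hk f hf x
  rw [colonSubmodule, Submodule.mem_comap, LinearMap.lsmul_apply] at h₃ hx
  rw [h₁, h₂] at h₃
  exact h₃ hx

/-- There is a basis of the space of linear forms all of whose annihilator modules are
`𝔪`-power torsion. -/
theorem exists_annihilatorTorsion [Infinite K] (M : Type*) [AddCommGroup M]
    [Module (MvPolynomial (Fin n) K) M] [Module.Finite (MvPolynomial (Fin n) K) M] :
    ∃ c : Fin n → Fin n → K, (Matrix.of c).det ≠ 0 ∧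
      ∀ q < n, AnnihilatorTorsion M (gradedMaximalIdeal K n) (linearForm c) (q + 1) := by
  -- The rows are chosen one at a time. A_q depends only on the first q rows, so replacing a later
  -- row preserves the torsion already obtained.
  have key : ∀ p, ∀ hp : p ≤ n, ∃ c : Fin n → Fin n → K,
      LinearIndependent K (fun k : Fin p => c (Fin.castLE hp k)) ∧
      ∀ q < p, AnnihilatorTorsion M (gradedMaximalIdeal K n) (linearForm c) (q + 1) := by
    intro p
    induction p with
    | zero => exact fun _ => ⟨0, linearIndependent_empty_type, by simp⟩
    | succ p ih =>
      intro hp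
      obtain ⟨c, hc, ht⟩ := ih (by omega)
      have hE : Submodule.span K (Set.range fun k : Fin p => c (Fin.castLE (by omega) k)) ≠ ⊤ := by
        intro h
        have h₁ := finrank_range_le_card (R := K) fun k : Fin p => c (Fin.castLE (by omega) k)
        rw [Set.finrank, h, finrank_top, Module.finrank_fin_fun, Fintype.card_fin] at h₁
        omega
      obtain ⟨w, hw, k, hk⟩ := exists_linear_form_torsion (M := M)
        (partialSubmodule M (linearForm c) (p + 1)) _ hE
      have hne : ∀ j : Fin n, (j : ℕ) < p → c j = Function.update c ⟨p, hp⟩ w j := by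
        intro j hj
        rw [Function.update_of_ne]
        rintro rfl
        exact lt_irrefl _ (show p < p from hj)
      refine ⟨Function.update c ⟨p, hp⟩ w, ?_, fun q hq => ?_⟩
      · rw [linearIndependent_finSucc']
        have hinit : Fin.init (fun j : Fin (p + 1) =>
            Function.update c ⟨p, hp⟩ w (Fin.castLE hp j)) =
            fun j : Fin p => c (Fin.castLE (by omega) j) := by
          funext j
          exact (hne (Fin.castLE (by omega) j) j.2).symm
        rw [hinit]
        refine ⟨hc, ?_⟩
        have hlast : Function.update c ⟨p, hp⟩ w (Fin.castLE hp (Fin.last p)) = w :=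
          Function.update_self (⟨p, hp⟩ : Fin n) w c
        rwa [hlast]
      · rcases Nat.lt_succ_iff_lt_or_eq.1 hq with hq | rfl
        · exact annihilatorTorsion_congr (p := q + 1) (fun j hj => hne j (by omega)) (by omega)
            (ht q hq)
        · refine ⟨k, fun f hf x hx => ?_⟩
          have h₁ := partialSubmodule_congr (M := M) (p := q + 1)
            fun j hj hjp => linearForm_congr hne hj (by omega)
          rw [colonSubmodule, Submodule.mem_comap, LinearMap.lsmul_apply, ← h₁,
            show q + 1 = ((⟨q, hp⟩ : Fin n) : ℕ) + 1 from rfl, linearForm_succ,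
            Function.update_self] at hx
          rw [← h₁]
          exact hk f hf x hx
  obtain ⟨c, hc, ht⟩ := key n le_rfl
  refine ⟨c, ?_, ht⟩
  have hc' : LinearIndependent K (Matrix.of c).row := hc
  rw [Matrix.linearIndependent_rows_iff_isUnit, Matrix.isUnit_iff_isUnit_det] at hc'
  exact hc'.ne_zero

end FilterRegular

/-! ### Null-homotopies, and vanishing criteria in terms of cycles. -/

section Homotopy

variable {R : Type*} [CommRing R] {M : Type*} [AddCommGroup M] [Module R M]

@[simp] theorem lowPart_neg {p : ℕ} (m : Finset (Fin (p + 1)) → M) :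
    lowPart (-m) = -lowPart m := rfl
@[simp] theorem highPart_neg {p : ℕ} (m : Finset (Fin (p + 1)) → M) :
    highPart (-m) = -highPart m := rfl

theorem signed_add {p : ℕ} (a b : Finset (Fin p) → M) :
    signed R (a + b) = signed R a + signed R b := by
  funext t; simp [signed]

theorem signed_smul {p : ℕ} (r : R) (a : Finset (Fin p) → M) :
    signed R (r • a) = r • signed R a := by
  funext t; simp [signed, smul_smul, mul_comm]

@[simp] theorem signed_signed {p : ℕ} (a : Finset (Fin p) → M) : signed R (signed R a) = a := by
  funext t; simp [signed, smul_smul, ← mul_pow]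

theorem lowPart_signed {p : ℕ} (a : Finset (Fin (p + 1)) → M) :
    lowPart (signed R a) = signed R (lowPart a) := by
  funext t; simp [signed, lowPart, card_embedSet]

theorem highPart_signed {p : ℕ} (a : Finset (Fin (p + 1)) → M) :
    highPart (signed R a) = -signed R (highPart a) := by
  funext t; simp [signed, highPart, card_insert_last, pow_succ]

theorem signed_mem_chains {p i : ℕ} {a : Finset (Fin p) → M} (ha : a ∈ koszulChains R M p i) :
    signed R a ∈ koszulChains R M p i := by
  rw [signed_of_mem ha]; exact Submodule.smul_mem _ _ ha

/-- Multiplication by a term of the sequence is homotopic to zero on the Koszul complex. -/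
theorem exists_koszul_homotopy {p : ℕ} (z : Fin p → R) (j : Fin p) :
    ∃ s : (Finset (Fin p) → M) →ₗ[R] (Finset (Fin p) → M),
      (∀ m, koszulDiff M z (s m) + s (koszulDiff M z m) = z j • m) ∧
      (∀ m, s (signed R m) = - signed R (s m)) ∧
      ∀ i, ∀ m ∈ koszulChains R M p i, s m ∈ koszulChains R M p (i + 1) := by
  induction p with
  | zero => exact j.elim0
  | succ p ih =>
    refine Fin.lastCases ?_ (fun j => ?_) j
    -- Exterior multiplication by the last basis vector, with the sign for moving it past the
    -- others.
    · refine ⟨{ toFun := fun m => glue 0 (signed R (lowPart m))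
                map_add' := fun a b => chain_ext (by simp) (by simp [signed_add])
                map_smul' := fun r a => chain_ext (by simp) (by simp [signed_smul]) }, ?_, ?_, ?_⟩
      · intro m
        refine chain_ext ?_ ?_
        · simp [lowPart_koszulDiff]
        · simp [highPart_koszulDiff, lowPart_koszulDiff, koszulDiff_signed, signed_add,
            signed_smul]
      · intro m
        refine chain_ext ?_ ?_
        · simp [lowPart_signed]
        · simp [highPart_signed, lowPart_signed]
      · intro i m hm
        refine mem_koszulChains_succ.2 ⟨by simp, ?_⟩
        simp only [LinearMap.coe_mk, AddHom.coe_mk, highPart_glue]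
        cases i with
        | zero => exact signed_mem_chains (mem_koszulChains_zero.1 hm).1
        | succ i => exact signed_mem_chains (mem_koszulChains_succ.1 hm).1
    -- Anticommutation of `s` with `signed` is carried through the induction because it cancels the
    -- two cross terms containing the last term of the sequence.
    · obtain ⟨s, h₁, h₂, h₃⟩ := ih (fun k => z k.castSucc) j
      refine ⟨{ toFun := fun m => glue (s (lowPart m)) (s (highPart m))
                map_add' := fun a b => chain_ext (by simp) (by simp)
                map_smul' := fun r a => chain_ext (by simp) (by simp) }, ?_, ?_, ?_⟩
      · intro m
        refine chain_ext ?_ ?_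
        · have := h₁ (lowPart m)
          simp only [LinearMap.coe_mk, AddHom.coe_mk, lowPart_add, lowPart_koszulDiff,
            lowPart_glue, highPart_glue, map_add, map_smul, h₂, lowPart_smul]
          rw [← this]
          simp only [smul_neg]
          abel
        · have := h₁ (highPart m)
          simpa [highPart_koszulDiff] using this
      · intro m
        refine chain_ext ?_ ?_
        · simp [lowPart_signed, h₂]
        · simp [highPart_signed, h₂]
      · intro i m hm
        refine mem_koszulChains_succ.2 ?_
        simp only [LinearMap.coe_mk, AddHom.coe_mk, highPart_glue, lowPart_glue]
        cases i with
        | zero =>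
          rw [mem_koszulChains_zero] at hm
          exact ⟨h₃ _ _ hm.1, by rw [hm.2, map_zero]; exact Submodule.zero_mem _⟩
        | succ i =>
          rw [mem_koszulChains_succ] at hm
          exact ⟨h₃ _ _ hm.1, h₃ _ _ hm.2⟩

theorem smul_mem_bdy_of_mem_cyc {y : ℕ → R} {p i j : ℕ} (hj : 1 ≤ j) (hjp : j ≤ p)
    {v : Finset (Fin p) → M} (hv : v ∈ cyc M y p i) : y j • v ∈ bdy M y p i := by
  obtain ⟨s, h₁, -, h₃⟩ := exists_koszul_homotopy (M := M) (fun k : Fin p => y (k + 1))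
    ⟨j - 1, by omega⟩
  rw [mem_cyc] at hv
  refine mem_bdy.2 ⟨s v, h₃ _ _ hv.1, ?_⟩
  have h := h₁ v
  rw [show koszulDiff M (fun k : Fin p => y (k + 1)) v = 0 from hv.2, map_zero, add_zero] at h
  simpa [Nat.sub_add_cancel hj] using h

theorem smul_top_eq_bot_iff {I : Ideal R} {y : ℕ → R} {p i : ℕ} :
    I • (⊤ : Submodule R (KoszulHomology M y p i)) = ⊥ ↔
      ∀ f ∈ I, ∀ v ∈ cyc M y p i, f • v ∈ bdy M y p i := by
  rw [eq_bot_iff, Submodule.smul_le]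
  constructor
  · intro h f hf v hv
    have := h f hf (hclass M y p i ⟨v, hv⟩) trivial
    rwa [Submodule.mem_bot, ← map_smul, hclass_eq_zero] at this
  · intro h f hf x _
    obtain ⟨v, rfl⟩ := hclass_surjective p i x
    rw [Submodule.mem_bot, ← map_smul, hclass_eq_zero]
    exact h f hf v v.2

theorem koszulMul_eq_zero_iff {y : ℕ → R} {a b : ℕ} :
    koszulMul M y a b = 0 ↔ ∀ v ∈ cyc M y b a, y (b + 1) • v ∈ bdy M y b a := by
  constructor
  · intro h v hv
    have := congrArg (fun g => g (hclass M y b a ⟨v, hv⟩)) h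
    change koszulMul M y a b (hclass M y b a ⟨v, hv⟩) = 0 at this
    rwa [koszulMul_hclass, hclass_eq_zero] at this
  · intro h
    refine LinearMap.ext fun x => ?_
    obtain ⟨v, rfl⟩ := hclass_surjective b a x
    rw [koszulMul_hclass, LinearMap.zero_apply, hclass_eq_zero]
    exact h v v.2

theorem subsingleton_koszulHomology {y : ℕ → R} {p i : ℕ} (h : p < i) :
    Subsingleton (KoszulHomology M y p i) := by
  refine subsingleton_of_forall_eq 0 fun x => ?_
  obtain ⟨v, rfl⟩ := hclass_surjective p i x
  rw [hclass_eq_zero, koszulChains_eq_zero h (mem_cyc.1 v.2).1]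
  exact Submodule.zero_mem _

end Homotopy

/-! ### The binomial recursion and the combinatorics of the index sets. -/

section Numerics

/-- `∑_{j=1}^{p-i+1} C(p-j, i-1) α_j`. -/
def binomialBound (α : ℕ → ℕ) (i p : ℕ) : ℕ :=
  ∑ j ∈ Finset.Icc 1 (p + 1 - i), (p - j).choose (i - 1) * α j

theorem binomialBound_zero (α : ℕ → ℕ) {i : ℕ} (hi : 1 ≤ i) : binomialBound α i 0 = 0 := by
  rw [binomialBound, Finset.Icc_eq_empty (by omega), Finset.sum_empty]

theorem binomialBound_one (α : ℕ → ℕ) (p : ℕ) :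
    binomialBound α 1 (p + 1) = binomialBound α 1 p + α (p + 1) := by
  simp only [binomialBound, Nat.add_sub_cancel, Nat.sub_self, Nat.choose_zero_right, one_mul]
  rw [Finset.sum_Icc_succ_top (by omega)]

/-- Pascal's rule term by term, once both sums run over the same range. -/
theorem binomialBound_succ (α : ℕ → ℕ) {i : ℕ} (hi : 1 ≤ i) (p : ℕ) :
    binomialBound α (i + 1) (p + 1) = binomialBound α (i + 1) p + binomialBound α i p := by
  have h : binomialBound α (i + 1) p =
      ∑ j ∈ Finset.Icc 1 (p + 1 - i), (p - j).choose i * α j := by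
    rw [binomialBound, Nat.add_sub_cancel]
    -- Extending the range can only add `j = p + 1 - i`, whose binomial coefficient is zero.
    refine Finset.sum_subset (Finset.Icc_subset_Icc_right (by omega)) fun j hj hj' => ?_
    rw [Finset.mem_Icc] at hj hj'
    rw [Nat.choose_eq_zero_of_lt (by omega), zero_mul]
  rw [h, binomialBound, binomialBound, ← Finset.sum_add_distrib,
    show p + 1 + 1 - (i + 1) = p + 1 - i by omega]
  refine Finset.sum_congr rfl fun j hj => ?_
  rw [Finset.mem_Icc] at hj
  obtain ⟨i, rfl⟩ : ∃ k, i = k + 1 := ⟨i - 1, by omega⟩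
  rw [show p + 1 - j = (p - j) + 1 by omega, Nat.add_sub_cancel, Nat.add_sub_cancel,
    Nat.choose_succ_succ]
  ring

theorem mem_indexSet {i p a b : ℕ} :
    (a, b) ∈ indexSet i p ↔ 1 ≤ b ∧ b < p ∧ i + b ≤ a + p ∧ 1 ≤ a ∧ a ≤ i := by
  change (1 ≤ b ∧ (b : ℤ) ≤ (p : ℤ) - 1 ∧ max ((i : ℤ) - (p : ℤ) + (b : ℤ)) 1 ≤ (a : ℤ) ∧ a ≤ i) ↔ _
  rw [max_le_iff]
  omega

/-- The bounds obey the recursion of `h` without the nonnegative defects `r`. Equality at `(i+1,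
p+1)` therefore means equality at `(i+1, p)` and `(i, p)` and zero defects there. Correspondingly,
for i ≥ 1, A_{i+1,p+1} is A_{i+1,p} ∪ A_{i,p} together with (i+1, p) and (i, p) when p ≥ 1. -/
theorem le_binomialBound_and_eq_iff {h r : ℕ → ℕ → ℕ} {α : ℕ → ℕ} {n : ℕ}
    (h_zero : ∀ i, 1 ≤ i → h i 0 = 0) (r_zero : ∀ i, 1 ≤ i → r i 0 = 0)
    (h_one : ∀ p < n, h 1 (p + 1) + r 1 p = h 1 p + α (p + 1))
    (h_succ : ∀ p < n, ∀ i, 1 ≤ i →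
      h (i + 1) (p + 1) + r (i + 1) p + r i p = h (i + 1) p + h i p) :
    ∀ p ≤ n, ∀ i, 1 ≤ i → h i p ≤ binomialBound α i p ∧
      (h i p = binomialBound α i p ↔ ∀ a b, (a, b) ∈ indexSet i p → r a b = 0) := by
  intro p
  induction p with
  | zero =>
    intro _ i hi
    rw [h_zero i hi, binomialBound_zero α hi]
    simp only [le_refl, mem_indexSet, true_and, true_iff]
    intro a b hab
    omega
  | succ p ih =>
    intro hp i hi
    have ih := ih (by omega)
    obtain ⟨i, rfl⟩ : ∃ k, i = k + 1 := ⟨i - 1, by omega⟩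
    rcases Nat.eq_zero_or_pos i with rfl | hi'
    · have e := h_one p (by omega)
      obtain ⟨h₁, h₂⟩ := ih 1 le_rfl
      rw [zero_add, binomialBound_one]
      refine ⟨by omega, ?_⟩
      have : h 1 (p + 1) = binomialBound α 1 p + α (p + 1) ↔
        h 1 p = binomialBound α 1 p ∧ r 1 p = 0 := by omega
      rw [this, h₂]
      constructor
      · rintro ⟨h₃, h₄⟩ a b hab
        rw [mem_indexSet] at hab
        obtain rfl : a = 1 := by omega
        by_cases hb : b = p
        · rwa [hb]
        · exact h₃ 1 b (by rw [mem_indexSet]; omega)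
      · intro h₃
        refine ⟨fun a b hab => h₃ a b (by rw [mem_indexSet] at hab ⊢; omega), ?_⟩
        -- The index sets omit `b = 0`, where the defect vanishes in any case.
        rcases Nat.eq_zero_or_pos p with rfl | hp'
        · exact r_zero 1 le_rfl
        · exact h₃ 1 p (by rw [mem_indexSet]; omega)
    · have e := h_succ p (by omega) i hi'
      obtain ⟨h₁, h₂⟩ := ih (i + 1) (by omega)
      obtain ⟨h₁', h₂'⟩ := ih i hi'
      rw [binomialBound_succ α hi']
      refine ⟨by omega, ?_⟩
      have : h (i + 1) (p + 1) = binomialBound α (i + 1) p + binomialBound α i p ↔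
        h (i + 1) p = binomialBound α (i + 1) p ∧ h i p = binomialBound α i p ∧
          r (i + 1) p = 0 ∧ r i p = 0 := by omega
      rw [this, h₂, h₂']
      constructor
      · rintro ⟨h₃, h₃', h₄, h₄'⟩ a b hab
        rw [mem_indexSet] at hab
        by_cases hb : b = p
        · subst hb
          obtain rfl | rfl : a = i ∨ a = i + 1 := by omega
          · exact h₄'
          · exact h₄
        · by_cases ha : a = i + 1
          · exact h₃ a b (by rw [mem_indexSet]; omega)
          · exact h₃' a b (by rw [mem_indexSet]; omega)
      · intro h₃
        refine ⟨fun a b hab => h₃ a b (by rw [mem_indexSet] at hab ⊢; omega),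
          fun a b hab => h₃ a b (by rw [mem_indexSet] at hab ⊢; omega), ?_⟩
        rcases Nat.eq_zero_or_pos p with rfl | hp'
        · exact ⟨r_zero _ (by omega), r_zero _ hi'⟩
        · exact ⟨h₃ _ _ (by rw [mem_indexSet]; omega), h₃ _ _ (by rw [mem_indexSet]; omega)⟩

end Numerics

/-! ### Passing from an internal direct sum to a family of projections. -/

section InternalGrading

variable {K : Type*} [Field K] {n : ℕ} {M : Type*} [AddCommGroup M] [Module K M]
  [Module (MvPolynomial (Fin n) K) M] [IsScalarTower K (MvPolynomial (Fin n) K) M]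
  {𝓜 : ℤ → Submodule K M}

/-- The projections onto the components of an internal direct sum. -/
noncomputable def componentProj (hdec : DirectSum.IsInternal 𝓜) (d : ℤ) : M →ₗ[K] M :=
  (𝓜 d).subtype ∘ₗ DirectSum.component K ℤ (fun e => 𝓜 e) d ∘ₗ
    (LinearEquiv.ofBijective (DirectSum.coeLinearMap 𝓜) hdec).symm.toLinearMap

theorem componentProj_mem (hdec : DirectSum.IsInternal 𝓜) (d : ℤ) (m : M) :
    componentProj hdec d m ∈ 𝓜 d := Submodule.coe_mem _

theorem componentProj_of_mem (hdec : DirectSum.IsInternal 𝓜) (d : ℤ) {e : ℤ} {m : M}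
    (hm : m ∈ 𝓜 e) : componentProj hdec d m = if e = d then m else 0 := by
  have h : (LinearEquiv.ofBijective (DirectSum.coeLinearMap 𝓜) hdec).symm m =
      DirectSum.lof K ℤ (fun e => 𝓜 e) e ⟨m, hm⟩ := by
    rw [LinearEquiv.symm_apply_eq]
    exact (DirectSum.coeLinearMap_lof 𝓜 e ⟨m, hm⟩).symm
  simp only [componentProj, LinearMap.comp_apply, LinearEquiv.coe_coe, h]
  split_ifs with he
  · subst he
    rw [DirectSum.component.lof_self]
    rfl
  · rw [DirectSum.component.of, dif_neg he, map_zero]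

theorem exists_sum_componentProj (hdec : DirectSum.IsInternal 𝓜) (m : M) :
    ∃ T : Finset ℤ, ∑ d ∈ T, componentProj hdec d m = m := by
  classical
  set x := (LinearEquiv.ofBijective (DirectSum.coeLinearMap 𝓜) hdec).symm m with hx
  refine ⟨DFinsupp.support x, ?_⟩
  have h : m = DirectSum.coeLinearMap 𝓜 x :=
    ((LinearEquiv.ofBijective (DirectSum.coeLinearMap 𝓜) hdec).apply_symm_apply m).symm
  conv_rhs => rw [h]
  exact (DirectSum.coeLinearMap_eq_dfinsuppSum 𝓜 x).symm

theorem isGradingProj_componentProj (hdec : DirectSum.IsInternal 𝓜)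
    (hdeg : ∀ (d : ℕ) (e : ℤ) (f : MvPolynomial (Fin n) K) (m : M),
      f ∈ MvPolynomial.homogeneousSubmodule (Fin n) K d → m ∈ 𝓜 e → f • m ∈ 𝓜 ((d : ℤ) + e)) :
    IsGradingProj n (componentProj hdec) where
  idem d m := by rw [componentProj_of_mem hdec d (componentProj_mem hdec d m), if_pos rfl]
  orth d e m h := by rw [componentProj_of_mem hdec d (componentProj_mem hdec e m), if_neg h.symm]
  sum := exists_sum_componentProj hdec
  smul_X d k m := by
    obtain ⟨T, hT⟩ := exists_sum_componentProj hdec m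
    have hX : ∀ e, (MvPolynomial.X k : MvPolynomial (Fin n) K) • componentProj hdec e m ∈
        𝓜 (1 + e) := fun e => by
      simpa using hdeg 1 e _ _ (MvPolynomial.isHomogeneous_X K k) (componentProj_mem hdec e m)
    conv_lhs => rw [← hT]
    conv_rhs => rw [← hT]
    rw [Finset.smul_sum, map_sum, map_sum, Finset.smul_sum]
    refine Finset.sum_congr rfl fun e _ => ?_
    rw [componentProj_of_mem hdec _ (hX e),
      componentProj_of_mem hdec _ (componentProj_mem hdec e m)]
    by_cases h : e = d
    · rw [if_pos (by omega), if_pos h]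
    · rw [if_neg (by omega), if_neg h, smul_zero]

end InternalGrading

/-! ### Generic constancy of dimensions and ranks, and the perturbation argument. -/

section GoodSequences

variable {K : Type u} [Field K] {n : ℕ}
  {M : Type u} [AddCommGroup M] [Module K M] [Module (MvPolynomial (Fin n) K) M]
  [IsScalarTower K (MvPolynomial (Fin n) K) M]

theorem koszulVanish_of_proj_eq_zero {π : ℤ → M →ₗ[K] M} {y : ℕ → MvPolynomial (Fin n) K} {B : ℤ}
    (hB : ∀ d < B, π d = 0) (p i : ℕ) {d : ℤ} (hd : d < B) : KoszulVanish π y p i d := by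
  intro v _ hvd
  have : v = 0 := by
    rw [← hvd]
    funext s
    rw [chainProj_apply, hB _ (by omega)]
    rfl
  rw [this]
  exact Submodule.zero_mem _

theorem exists_koszulVanish_bound [Module.Finite (MvPolynomial (Fin n) K) M] {π : ℤ → M →ₗ[K] M}
    (hπ : IsGradingProj n π) : ∃ D : ℤ, ∀ c : Fin n → Fin n → K, (Matrix.of c).det ≠ 0 →
      ∀ i, ∀ d > D, KoszulVanish π (linearForm c) n i d := by
  choose D hD using fun i => exists_koszulVanish (K := K) (n := n) i M π hπ
  obtain ⟨E, hE⟩ := ((Finset.range (n + 1)).image D).bddAbove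
  refine ⟨E, fun c hc i d hd => ?_⟩
  by_cases hi : i ≤ n
  · refine hD i c hc d (lt_of_le_of_lt (hE ?_) hd)
    exact Finset.mem_coe.2 (Finset.mem_image_of_mem _ (Finset.mem_range.2 (by omega)))
  · exact koszulVanish_of_lt (by omega) d

/-- The sequence with coefficient matrix `c` is a basis of the linear forms, and its Koszul homology
in positive degrees is finite-dimensional with dimensions given by `h`. -/
def IsGoodFor (M : Type u) [AddCommGroup M] [Module K M] [Module (MvPolynomial (Fin n) K) M]
    [IsScalarTower K (MvPolynomial (Fin n) K) M] (h : ℕ → ℕ → ℕ) (c : Fin n → Fin n → K) : Prop :=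
  (Matrix.of c).det ≠ 0 ∧ ∀ p ≤ n, ∀ i, 1 ≤ i →
    Module.Finite K (KoszulHomology M (linearForm c) p i) ∧
      Module.finrank K (KoszulHomology M (linearForm c) p i) = h i p

/-- Below `B` the module is zero; above `D` the homology of every prefix vanishes generically. On
the remaining window the dimensions are differences of generically constant ranks. -/
theorem exists_generically_isGoodFor [Infinite K] [Module.Finite (MvPolynomial (Fin n) K) M]
    {π : ℤ → M →ₗ[K] M} (hπ : IsGradingProj n π) :
    ∃ h : ℕ → ℕ → ℕ, Generically fun c : Fin n → Fin n → K => IsGoodFor M h c := by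
  obtain ⟨B, hB⟩ := exists_proj_eq_zero_of_lt hπ
  obtain ⟨D, hD⟩ := exists_koszulVanish_bound hπ
  have hfin : ∀ d, Module.Finite K (LinearMap.range (π d)) := finite_range_proj hπ
  obtain ⟨c₀, hc₀, ht⟩ := exists_annihilatorTorsion (K := K) (n := n) M
  have hvan := koszulVanish_of_annihilatorTorsion hπ (isLinearSeq_linearForm hπ c₀)
    (fun i _ d hd => hD c₀ hc₀ i d hd) (linearForm_mem_gradedMaximalIdeal c₀) ht
  -- Only degree `D + 1` is needed, and only finitely many pairs of indices; `c₀` shows that each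
  -- condition is satisfiable.
  have g₁ : Generically fun c : Fin n → Fin n → K =>
      ∀ q ∈ Finset.range (n + 1) ×ˢ Finset.Icc 1 n,
        KoszulVanish π (linearForm c) q.1 q.2 (D + 1) := by
    refine Generically.forall_mem _ fun q hq => ?_
    rw [Finset.mem_product, Finset.mem_range, Finset.mem_Icc] at hq
    exact generically_koszulVanish hπ (hvan q.1 (by omega) q.2 hq.2.1 (D + 1) (by omega))
  choose r hr _ using fun p i => exists_generically_windowRank_eq (n := n) π p i (Finset.Icc B D)
  have g₂ : Generically fun c : Fin n → Fin n → K =>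
      ∀ q ∈ Finset.range (n + 1) ×ˢ Finset.range (n + 2),
        windowRank π (linearForm c) q.1 q.2 (Finset.Icc B D) = r q.1 q.2 :=
    Generically.forall_mem _ fun q _ => hr q.1 q.2
  -- The ranks are controlled only up to homological degree `n + 1`; for `i > n` the homology is
  -- zero outright.
  refine ⟨fun i p => if n < i then 0 else
    Module.finrank K (windowChains n π p i (Finset.Icc B D)) - r p i - r p (i + 1), ?_⟩
  refine ((generically_det_ne_zero.and g₁).and g₂).mono fun c hc => ⟨hc.1.1, fun p hp i hi => ?_⟩
  have hlin := isLinearSeq_linearForm hπ c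
  have hall := koszulVanish_of_forall_degree hπ hlin (fun i _ d hd => hD c hc.1.1 i d hd)
    (fun p hp i hi => by
      by_cases hin : i ≤ n
      · exact hc.1.2 (p, i) (Finset.mem_product.2 ⟨Finset.mem_range.2 (by omega),
          Finset.mem_Icc.2 ⟨hi, hin⟩⟩)
      · exact koszulVanish_of_lt (by omega) _) p hp i hi
  have hT : ∀ d ∉ Finset.Icc B D, KoszulVanish π (linearForm c) p i d := by
    intro d hd
    rw [Finset.mem_Icc] at hd
    by_cases h : d < B
    · exact koszulVanish_of_proj_eq_zero hB p i h
    · exact hall d (by omega)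
  refine ⟨finite_koszulHomology_of_window hπ hlin hT, ?_⟩
  beta_reduce
  split_ifs with hin
  · have := subsingleton_koszulHomology (M := M) (y := linearForm c) (p := p) (i := i) (by omega)
    exact Module.finrank_zero_of_subsingleton
  · have h₁ := finrank_koszulHomology_of_window hπ hlin hT
    have h₂ := hc.2 (p, i) (Finset.mem_product.2 ⟨Finset.mem_range.2 (by omega),
          Finset.mem_range.2 (by omega)⟩)
    have h₃ := hc.2 (p, i + 1) (Finset.mem_product.2 ⟨Finset.mem_range.2 (by omega),
          Finset.mem_range.2 (by omega)⟩)
    simp only at h₂ h₃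
    rw [h₂, h₃] at h₁
    omega

theorem mulRank_eq_zero_of_lt {R : Type*} [CommRing R] [Algebra K R] {N : Type*} [AddCommGroup N]
    [Module K N] [Module R N] [IsScalarTower K R N] {y : ℕ → R} {a b : ℕ}
    (h : b < a) : mulRank K N y a b = 0 := by
  have := subsingleton_koszulHomology (M := N) (y := y) h
  exact Module.finrank_zero_of_subsingleton

theorem mulRank_eq_zero_iff {y : ℕ → MvPolynomial (Fin n) K} {a b : ℕ}
    [Module.Finite K (KoszulHomology M y b a)] :
    mulRank K M y a b = 0 ↔ koszulMul M y a b = 0 := by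
  rw [mulRank, Submodule.finrank_eq_zero, LinearMap.range_eq_bot]
  constructor
  · intro h
    exact LinearMap.ext fun x => congrArg (fun g => g x) h
  · intro h
    rw [h]
    rfl

variable {h : ℕ → ℕ → ℕ} {c c' : Fin n → Fin n → K}

theorem IsGoodFor.finrank_succ (hc : IsGoodFor M h c) {p i : ℕ} (hp : p < n) (hi : 1 ≤ i) :
    h (i + 1) (p + 1) + mulRank K M (linearForm c) (i + 1) p + mulRank K M (linearForm c) i p =
      h (i + 1) p + h i p := by
  have := (hc.2 p hp.le (i + 1) (by omega)).1
  have := (hc.2 p hp.le i hi).1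
  have := (hc.2 (p + 1) hp (i + 1) (by omega)).1
  have e := finrank_koszulHomology_succ (K := K) (M := M) (linearForm c) p i
  rwa [(hc.2 p hp.le (i + 1) (by omega)).2, (hc.2 p hp.le i hi).2,
    (hc.2 (p + 1) hp (i + 1) (by omega)).2] at e

theorem IsGoodFor.finrank_one (hc : IsGoodFor M h c) {p : ℕ} (hp : p < n) :
    Module.Finite K (AnnihilatorModule M (linearForm c) (p + 1)) ∧
    h 1 (p + 1) + mulRank K M (linearForm c) 1 p =
      h 1 p + Module.finrank K (AnnihilatorModule M (linearForm c) (p + 1)) := by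
  have := (hc.2 p hp.le 1 le_rfl).1
  have := (hc.2 (p + 1) hp 1 le_rfl).1
  refine ⟨finite_annihilatorModule (linearForm c) p, ?_⟩
  have e := finrank_koszulHomology_one (K := K) (M := M) (linearForm c) p
  rwa [(hc.2 p hp.le 1 le_rfl).2, (hc.2 (p + 1) hp 1 le_rfl).2] at e

/-- The recursion expresses the rank in degree `i` through `h` and the rank in degree `i + 1`, and
the ranks vanish for `i > p`. Hence `h` determines them all. -/
theorem IsGoodFor.mulRank_eq (hc : IsGoodFor M h c) (hc' : IsGoodFor M h c') {p i : ℕ}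
    (hp : p < n) (hi : 1 ≤ i) :
    mulRank K M (linearForm c) i p = mulRank K M (linearForm c') i p := by
  obtain ⟨k, hk⟩ : ∃ k, p < i + k := ⟨p + 1, by omega⟩
  induction k generalizing i with
  | zero => rw [mulRank_eq_zero_of_lt (by omega), mulRank_eq_zero_of_lt (by omega)]
  | succ k ih =>
    have := ih (i := i + 1) (by omega) (by omega)
    have := hc.finrank_succ hp hi
    have := hc'.finrank_succ hp hi
    omega

theorem IsGoodFor.finrank_annihilatorModule_eq (hc : IsGoodFor M h c) (hc' : IsGoodFor M h c')
    {p : ℕ} (hp : p < n) : Module.finrank K (AnnihilatorModule M (linearForm c) (p + 1)) =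
      Module.finrank K (AnnihilatorModule M (linearForm c') (p + 1)) := by
  have := (hc.finrank_one hp).2
  have := (hc'.finrank_one hp).2
  have := hc.mulRank_eq hc' hp le_rfl
  omega

theorem genericKoszulNumber_eq [Infinite K]
    (hg : Generically fun c : Fin n → Fin n → K => IsGoodFor M h c)
    {p i : ℕ} (hp : p ≤ n) (hi : 1 ≤ i) : genericKoszulNumber K n M i p = h i p :=
  genericValue_eq (hg.mono fun _ hc => (hc.2 p hp i hi).2)

theorem IsGoodFor.genericAnnihilatorNumber_eq [Infinite K]
    (hg : Generically fun c : Fin n → Fin n → K => IsGoodFor M h c)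
    (hc : IsGoodFor M h c) {p : ℕ} (hp : p < n) :
    genericAnnihilatorNumber K n M (p + 1) =
      Module.finrank K (AnnihilatorModule M (linearForm c) (p + 1)) :=
  genericValue_eq (hg.mono fun _ hc' => hc'.finrank_annihilatorModule_eq hc hp)

/-- The bound for the generic Koszul homology, and the characterization of equality. -/
theorem IsGoodFor.le_annihilatorBound_and_eq_iff [Infinite K]
    (hg : Generically fun c : Fin n → Fin n → K => IsGoodFor M h c)
    (hc : IsGoodFor M h c) {p i : ℕ} (hp : p ≤ n) (hi : 1 ≤ i) :
    h i p ≤ annihilatorBound K n M i p ∧ (h i p = annihilatorBound K n M i p ↔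
      ∀ a b, (a, b) ∈ indexSet i p → mulRank K M (linearForm c) a b = 0) := by
  refine le_binomialBound_and_eq_iff (α := genericAnnihilatorNumber K n M)
    (r := mulRank K M (linearForm c)) ?_ ?_ ?_ ?_ p hp i hi
  · intro i hi
    rw [← (hc.2 0 (Nat.zero_le n) i hi).2]
    have := subsingleton_koszulHomology (M := M) (y := linearForm c) (p := 0) (i := i) hi
    exact Module.finrank_zero_of_subsingleton
  · exact fun i hi => mulRank_eq_zero_of_lt hi
  · intro p hp
    rw [hc.genericAnnihilatorNumber_eq hg hp]
    exact (hc.finrank_one hp).2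
  · exact fun p hp i hi => hc.finrank_succ hp hi

/-- Restricted to the line through `x`, `f` becomes a nonzero polynomial in one variable;
multiplying it by the variable also excludes `t = 0`. -/
theorem exists_eval_line_ne_zero [Infinite K] {σ : Type*} (f : MvPolynomial σ K) (x w : σ → K)
    (hf : MvPolynomial.eval x f ≠ 0) : ∃ t : K, t ≠ 0 ∧ MvPolynomial.eval (x + t • w) f ≠ 0 := by
  let g : Polynomial K := MvPolynomial.aeval
    (fun s => Polynomial.C (x s) + Polynomial.X * Polynomial.C (w s)) f
  have hg : ∀ t, g.eval t = MvPolynomial.eval (x + t • w) f := by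
    intro t
    simp only [g]
    rw [← Polynomial.coe_evalRingHom, MvPolynomial.aeval_def, MvPolynomial.eval₂_eq_eval_map,
      MvPolynomial.eval_map, MvPolynomial.hom_eval₂]
    have : (Polynomial.evalRingHom t).comp (algebraMap K (Polynomial K)) = RingHom.id K := by
      ext a; simp
    rw [this, MvPolynomial.eval₂_id]
    congr 2
    funext s
    simp only [map_add, map_mul, Polynomial.coe_evalRingHom, Polynomial.eval_C, Polynomial.eval_X,
      Pi.add_apply, Pi.smul_apply, smul_eq_mul]
  have hne : g * Polynomial.X ≠ 0 := by
    refine mul_ne_zero (fun h0 => hf ?_) Polynomial.X_ne_zero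
    have := hg 0
    rw [h0, zero_smul, add_zero, Polynomial.eval_zero] at this
    exact this.symm
  obtain ⟨t, ht⟩ : ∃ t, (g * Polynomial.X).eval t ≠ 0 := by
    by_contra! h
    exact hne (Polynomial.funext fun t => by rw [h t, Polynomial.eval_zero])
  rw [Polynomial.eval_mul, Polynomial.eval_X, hg] at ht
  exact ⟨t, right_ne_zero_of_mul ht, left_ne_zero_of_mul ht⟩

theorem prefix_congr {R : Type*} {y y' : ℕ → R} {p : ℕ} (h : ∀ j, 1 ≤ j → j ≤ p → y j = y' j) :
    (fun k : Fin p => y (k + 1)) = fun k : Fin p => y' (k + 1) :=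
  funext fun k => h _ (by omega) (by omega)

/-- If multiplication by `y_{b+1}` vanishes on `H_a(b)` for one generic sequence then the whole
maximal ideal annihilates `H_a(b)`. -/
theorem smul_top_eq_bot_of_koszulMul_eq_zero [Infinite K] {f : MvPolynomial (Fin n × Fin n) K}
    (hf : ∀ c : Fin n → Fin n → K, MvPolynomial.eval (fun q => c q.1 q.2) f ≠ 0 → IsGoodFor M h c)
    (hc : MvPolynomial.eval (fun q => c q.1 q.2) f ≠ 0) {a b : ℕ} (ha : 1 ≤ a) (hb : b < n)
    (hφ : koszulMul M (linearForm c) a b = 0) :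
    gradedMaximalIdeal K n •
      (⊤ : Submodule (MvPolynomial (Fin n) K) (KoszulHomology M (linearForm c) b a)) = ⊥ := by
  have hX : ∀ l : Fin n, ∀ v ∈ cyc M (linearForm c) b a,
      (MvPolynomial.X l : MvPolynomial (Fin n) K) • v ∈ bdy M (linearForm c) b a := by
    intro l v hv
    -- The perturbation replaces `y_{b+1}` by `y_{b+1} + t x_l` and leaves the first `b` forms,
    -- hence H_a(b), unchanged.
    let w : Fin n → Fin n → K := Pi.single ⟨b, hb⟩ (Pi.single l 1)
    obtain ⟨t, ht, h₁⟩ := exists_eval_line_ne_zero f (fun q => c q.1 q.2) (fun q => w q.1 q.2) hc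
    have hc' : IsGoodFor M h (c + t • w) := hf _ h₁
    have := ((hf c hc).2 b hb.le a ha).1
    have := (hc'.2 b hb.le a ha).1
    -- Both matrices are good, so the two multiplications have equal rank, namely zero. The
    -- difference of the two multipliers is `t x_l` with `t ≠ 0`.
    have h₂ : koszulMul M (linearForm (c + t • w)) a b = 0 := by
      rw [← mulRank_eq_zero_iff, ← (hf c hc).mulRank_eq hc' hb ha, mulRank_eq_zero_iff]
      exact hφ
    have h₃ : (fun k : Fin b => linearForm c (k + 1)) =
        fun k : Fin b => linearForm (c + t • w) (k + 1) := by
      refine prefix_congr fun j hj hjb => linearForm_congr (p := b) (fun k hk => ?_) hj hjb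
      have hk' : k ≠ ⟨b, hb⟩ := by rintro rfl; exact lt_irrefl _ (show b < b from hk)
      simp only [w, Pi.add_apply, Pi.smul_apply, Pi.single_eq_of_ne hk', smul_zero, add_zero]
    rw [koszulMul_eq_zero_iff] at hφ h₂
    have h₄ := hφ v hv
    have h₅ := h₂ v (by rw [cyc, ← h₃]; exact hv)
    rw [bdy, ← h₃, linearForm_add, linearForm_smul, add_smul] at h₅
    have h₆ := (Submodule.add_mem_iff_right _ h₄).1 h₅
    have h₇ : linearForm w (b + 1) = MvPolynomial.X l := by
      rw [show b + 1 = ((⟨b, hb⟩ : Fin n) : ℕ) + 1 from rfl, linearForm_succ,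
        Finset.sum_eq_single l]
      · simp [w]
      · intro k _ hk
        simp [w, hk]
      · simp
    rw [h₇] at h₆
    have h₈ := Submodule.smul_mem _ (MvPolynomial.C t⁻¹ : MvPolynomial (Fin n) K) h₆
    rwa [smul_smul, ← mul_assoc, ← map_mul, inv_mul_cancel₀ ht, map_one, one_mul] at h₈
  rw [smul_top_eq_bot_iff]
  intro g hg v hv
  rw [gradedMaximalIdeal] at hg
  induction hg using Submodule.span_induction with
  | mem x hx => obtain ⟨l, rfl⟩ := hx; exact hX l v hv
  | zero => rw [zero_smul]; exact Submodule.zero_mem _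
  | add x y _ _ hx hy => rw [add_smul]; exact Submodule.add_mem _ hx hy
  | smul r x _ hx => rw [smul_assoc]; exact Submodule.smul_mem _ _ hx

theorem koszulMul_eq_zero_of_smul_top_eq_bot {a b : ℕ}
    (h : gradedMaximalIdeal K n •
      (⊤ : Submodule (MvPolynomial (Fin n) K) (KoszulHomology M (linearForm c) b a)) = ⊥) :
    koszulMul M (linearForm c) a b = 0 := by
  rw [smul_top_eq_bot_iff] at h
  exact koszulMul_eq_zero_iff.2 fun v hv => h _ (linearForm_mem_gradedMaximalIdeal c _) v hv

/-- For the full sequence the forms generate 𝔪, and each acts null-homotopically. This covers `b =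
n`, which no index set A_{i,n} contains. -/
theorem smul_top_koszulHomology_eq_bot (hc : (Matrix.of c).det ≠ 0) (a : ℕ) :
    gradedMaximalIdeal K n •
      (⊤ : Submodule (MvPolynomial (Fin n) K) (KoszulHomology M (linearForm c) n a)) = ⊥ := by
  rw [smul_top_eq_bot_iff]
  intro g hg' v hv
  have hg := gradedMaximalIdeal_le_span c hc hg'
  clear hg'
  induction hg using Submodule.span_induction with
  | mem x hx =>
    obtain ⟨j, hj, hjn, rfl⟩ := hx
    exact smul_mem_bdy_of_mem_cyc hj (by omega) hv
  | zero => rw [zero_smul]; exact Submodule.zero_mem _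
  | add x y _ _ hx hy => rw [add_smul]; exact Submodule.add_mem _ hx hy
  | smul r x _ hx => rw [smul_assoc]; exact Submodule.smul_mem _ _ hx

end GoodSequences

/-! ### The Koszul complex as a chain complex, and base change to a module. -/

section KoszulComplex

variable {R : Type u} [CommRing R] {p : ℕ} (N : Type u) [AddCommGroup N] [Module R N]
  (z : Fin p → R)

/-- The Koszul differential from degree `i + 1` to degree `i`. -/
def koszulDiffDeg (i : ℕ) : koszulChains R N p (i + 1) →ₗ[R] koszulChains R N p i :=
  (koszulDiff N z).restrict fun _ hm => koszulDiff_mem z hm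

theorem coe_koszulDiffDeg (i : ℕ) (m : koszulChains R N p (i + 1)) :
    (koszulDiffDeg N z i m : Finset (Fin p) → N) = koszulDiff N z m := rfl

theorem koszulDiffDeg_koszulDiffDeg (i : ℕ) (m : koszulChains R N p (i + 1 + 1)) :
    koszulDiffDeg N z i (koszulDiffDeg N z (i + 1) m) = 0 :=
  Subtype.ext (koszulDiff_koszulDiff z _)

/-- The Koszul complex as a chain complex of modules. -/
noncomputable def koszulComplex : ChainComplex (ModuleCat.{u} R) ℕ :=
  ChainComplex.of (fun i => ModuleCat.of R (koszulChains R N p i))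
    (fun i => ModuleCat.ofHom (koszulDiffDeg N z i)) fun i => by
      ext m : 2
      exact koszulDiffDeg_koszulDiffDeg N z i m

theorem koszulComplex_d (i : ℕ) :
    (koszulComplex N z).d (i + 1) i = ModuleCat.ofHom (koszulDiffDeg N z i) :=
  ChainComplex.of_d (fun i => ModuleCat.of R (koszulChains R N p i))
    (fun i => ModuleCat.ofHom (koszulDiffDeg N z i)) i

/-- The Koszul chains of degree `i` as functions on the subsets with `i` elements. -/
noncomputable def chainsEquivFun (R : Type u) [CommRing R] (N : Type u) [AddCommGroup N]
    [Module R N] (p i : ℕ) :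
    koszulChains R N p i ≃ₗ[R] ({s : Finset (Fin p) // s.card = i} → N) where
  toFun m s := (m : Finset (Fin p) → N) s
  map_add' _ _ := rfl
  map_smul' _ _ := rfl
  invFun f := ⟨fun s => if h : s.card = i then f ⟨s, h⟩ else 0, fun s hs => dif_neg hs⟩
  left_inv m := by
    refine Subtype.ext (funext fun s => ?_)
    by_cases h : s.card = i
    · simp [h]
    · simp [h, m.2 s h]
  right_inv f := by
    funext s
    simp [s.2]

/-- The Koszul complex of a module is the tensor product of the Koszul complex of the ring. -/
noncomputable def chainsTensorEquiv (i : ℕ) :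
    TensorProduct R (koszulChains R R p i) N ≃ₗ[R] koszulChains R N p i :=
  TensorProduct.congr (chainsEquivFun R R p i) (LinearEquiv.refl R N) ≪≫ₗ
    TensorProduct.comm R _ _ ≪≫ₗ
    TensorProduct.piScalarRight R R N {s : Finset (Fin p) // s.card = i} ≪≫ₗ
    (chainsEquivFun R N p i).symm

theorem chainsTensorEquiv_tmul (i : ℕ) (f : koszulChains R R p i) (m : N) :
    (chainsTensorEquiv N i (f ⊗ₜ m) : Finset (Fin p) → N) =
      fun s => (f : Finset (Fin p) → R) s • m := by
  funext s
  by_cases h : s.card = i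
  · simp [chainsTensorEquiv, chainsEquivFun, h]
  · simp [chainsTensorEquiv, chainsEquivFun, h, f.2 s h]

theorem chainsTensorEquiv_comm (i : ℕ) (x : TensorProduct R (koszulChains R R p (i + 1)) N) :
    chainsTensorEquiv N i ((koszulDiffDeg R z i).rTensor N x) =
      koszulDiffDeg N z i (chainsTensorEquiv N (i + 1) x) := by
  induction x using TensorProduct.induction_on with
  | zero => simp
  | add x y hx hy => simp only [map_add, hx, hy]
  | tmul f m =>
    refine Subtype.ext ?_
    rw [LinearMap.rTensor_tmul, chainsTensorEquiv_tmul, coe_koszulDiffDeg, coe_koszulDiffDeg,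
      chainsTensorEquiv_tmul]
    exact (koszulDiff_comp (LinearMap.toSpanSingleton R N m) z f).symm

/-- The short complex of Koszul chains in degrees `i + 2`, `i + 1`, `i`. -/
noncomputable def koszulShortComplex (i : ℕ) : ShortComplex (ModuleCat.{u} R) :=
  ShortComplex.mk (ModuleCat.ofHom (koszulDiffDeg N z (i + 1)))
    (ModuleCat.ofHom (koszulDiffDeg N z i))
    (by ext m : 2; exact koszulDiffDeg_koszulDiffDeg N z i m)

/-- The homology of a short complex of Koszul chains is Koszul homology. -/
noncomputable def koszulShortComplexHomology (y : ℕ → R) (p i : ℕ) :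
    (LinearMap.ker (koszulShortComplex N (fun k : Fin p => y (k + 1)) i).g.hom ⧸
      LinearMap.range (koszulShortComplex N (fun k : Fin p => y (k + 1)) i).moduleCatToCycles)
      ≃ₗ[R] KoszulHomology N y p (i + 1) :=
  Submodule.Quotient.equiv _ _
    { toFun := fun m => ⟨m.1.1, mem_cyc.2 ⟨m.1.2, congrArg Subtype.val m.2⟩⟩
      map_add' := fun _ _ => rfl
      map_smul' := fun _ _ => rfl
      invFun := fun m => ⟨⟨m, (mem_cyc.1 m.2).1⟩, Subtype.ext (mem_cyc.1 m.2).2⟩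
      left_inv := fun _ => rfl
      right_inv := fun _ => rfl } (by
    ext m
    constructor
    · rintro ⟨_, ⟨x, rfl⟩, rfl⟩
      exact mem_bdy.2 ⟨_, x.2, rfl⟩
    · intro hm
      have hm : (m : Finset (Fin p) → N) ∈ bdy N y p (i + 1) := hm
      obtain ⟨a, ha, h⟩ := mem_bdy.1 hm
      refine ⟨⟨⟨m, (mem_cyc.1 m.2).1⟩, Subtype.ext (mem_cyc.1 m.2).2⟩, ⟨⟨a, ha⟩, ?_⟩, rfl⟩
      exact Subtype.ext (Subtype.ext h))

/-- The homology of a complex isomorphic to the Koszul complex. -/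
theorem nonempty_homology_iso (C : ChainComplex (ModuleCat.{u} R) ℕ) (y : ℕ → R) (p : ℕ)
    (e : ∀ i, C.X i ≃ₗ[R] koszulChains R N p i)
    (he : ∀ i (x : C.X (i + 1)), e i ((C.d (i + 1) i).hom x) =
      koszulDiffDeg N (fun k : Fin p => y (k + 1)) i (e (i + 1) x)) (i : ℕ) :
    Nonempty (C.homology (i + 1) ≅ ModuleCat.of R (KoszulHomology N y p (i + 1))) := by
  let S := koszulShortComplex N (fun k : Fin p => y (k + 1)) i
  let e₁ : C.sc' (i + 1 + 1) (i + 1) i ≅ S := ShortComplex.isoMk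
    (LinearEquiv.toModuleIso (e (i + 1 + 1))) (LinearEquiv.toModuleIso (e (i + 1)))
    (LinearEquiv.toModuleIso (e i))
    (by ext x; exact (he (i + 1) x).symm)
    (by ext x; exact (he i x).symm)
  exact ⟨ShortComplex.homologyMapIso (C.isoSc' (i + 1 + 1) (i + 1) i (by simp) (by simp)) ≪≫
    ShortComplex.homologyMapIso e₁ ≪≫ S.moduleCatHomologyIso ≪≫
    LinearEquiv.toModuleIso (koszulShortComplexHomology N y p i)⟩

end KoszulComplex

/-! ### The Koszul resolution of the residue field and Tor. -/

section Resolution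

variable {K : Type u} [Field K] {n : ℕ} (c : Fin n → Fin n → K)

theorem koszulComplex_exactAt_succ (hc : (Matrix.of c).det ≠ 0) (i : ℕ) :
    (koszulComplex (MvPolynomial (Fin n) K) (fun k : Fin n => linearForm c (k + 1))).ExactAt
      (i + 1) := by
  rw [HomologicalComplex.exactAt_iff' _ (i + 1 + 1) (i + 1) i (by simp) (by simp),
    ShortComplex.moduleCat_exact_iff]
  intro x hx
  change ((koszulComplex (MvPolynomial (Fin n) K)
    (fun k : Fin n => linearForm c (k + 1))).d (i + 1) i).hom x = 0 at hx
  rw [koszulComplex_d] at hx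
  have hx' : (x : koszulChains (MvPolynomial (Fin n) K) (MvPolynomial (Fin n) K) n (i + 1)).1 ∈
      cyc (MvPolynomial (Fin n) K) (linearForm c) n (i + 1) :=
    mem_cyc.2 ⟨x.2, congrArg Subtype.val hx⟩
  obtain ⟨a, ha, h⟩ := mem_bdy.1 (cyc_le_bdy_polynomial c hc i hx')
  refine ⟨⟨a, ha⟩, ?_⟩
  change ((koszulComplex (MvPolynomial (Fin n) K)
    (fun k : Fin n => linearForm c (k + 1))).d (i + 1 + 1) (i + 1)).hom _ = x
  rw [koszulComplex_d]
  exact Subtype.ext h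

/-- The augmentation of the Koszul complex. -/
noncomputable def koszulAugmentation (K : Type u) [Field K] (n : ℕ) :
    koszulChains (MvPolynomial (Fin n) K) (MvPolynomial (Fin n) K) n 0 →ₗ[MvPolynomial (Fin n) K]
      MvPolynomial (Fin n) K ⧸ gradedMaximalIdeal K n :=
  (gradedMaximalIdeal K n).mkQ ∘ₗ LinearMap.proj ∅ ∘ₗ Submodule.subtype _

theorem koszulAugmentation_eq_zero_iff (hc : (Matrix.of c).det ≠ 0)
    (x : koszulChains (MvPolynomial (Fin n) K) (MvPolynomial (Fin n) K) n 0) :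
    koszulAugmentation K n x = 0 ↔
      ∃ a, koszulDiffDeg (MvPolynomial (Fin n) K) (fun k : Fin n => linearForm c (k + 1)) 0 a = x := by
  have hI : partialSubmodule (MvPolynomial (Fin n) K) (linearForm c) (n + 1) =
      gradedMaximalIdeal K n := by
    rw [partialSubmodule, smul_eq_mul, Ideal.mul_top]
    refine le_antisymm (Ideal.span_le.2 ?_) (gradedMaximalIdeal_le_span c hc)
    rintro _ ⟨j, -, -, rfl⟩
    exact linearForm_mem_gradedMaximalIdeal c j
  have h := mem_bdy_zero_iff (y := linearForm c) (p := n)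
    (v := (x : Finset (Fin n) → MvPolynomial (Fin n) K))
  rw [hI, mem_bdy] at h
  have h₁ : koszulAugmentation K n x = 0 ↔
      (x : Finset (Fin n) → MvPolynomial (Fin n) K) ∅ ∈ gradedMaximalIdeal K n :=
    Submodule.Quotient.mk_eq_zero _
  rw [h₁]
  constructor
  · intro hx
    obtain ⟨a, ha, h⟩ := h.2 ⟨x.2, hx⟩
    exact ⟨⟨a, ha⟩, Subtype.ext h⟩
  · rintro ⟨a, rfl⟩
    exact (h.1 ⟨a, a.2, rfl⟩).2

theorem koszulAugmentation_surjective : Function.Surjective (koszulAugmentation K n) := by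
  intro x
  obtain ⟨f, rfl⟩ := Submodule.mkQ_surjective _ x
  refine ⟨⟨Pi.single ∅ f, single_mem_chains f⟩, ?_⟩
  change (gradedMaximalIdeal K n).mkQ
    ((Pi.single ∅ f : Finset (Fin n) → MvPolynomial (Fin n) K) ∅) = _
  rw [Pi.single_eq_same]

theorem koszulComplex_d_augmentation (hc : (Matrix.of c).det ≠ 0) :
    (koszulComplex (MvPolynomial (Fin n) K) (fun k : Fin n => linearForm c (k + 1))).d 1 0 ≫
      ModuleCat.ofHom (koszulAugmentation K n) = 0 := by
  rw [koszulComplex_d]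
  exact ModuleCat.hom_ext (LinearMap.ext fun a =>
    (koszulAugmentation_eq_zero_iff c hc _).2 ⟨a, rfl⟩)

/-- The Koszul complex of a basis of the linear forms is a projective resolution of the residue
field. -/
noncomputable def koszulResolution (hc : (Matrix.of c).det ≠ 0) :
    ProjectiveResolution
      (ModuleCat.of (MvPolynomial (Fin n) K) (MvPolynomial (Fin n) K ⧸ gradedMaximalIdeal K n)) where
  complex := koszulComplex (MvPolynomial (Fin n) K) (fun k : Fin n => linearForm c (k + 1))
  projective i := by
    have : Module.Free (MvPolynomial (Fin n) K)
        (koszulChains (MvPolynomial (Fin n) K) (MvPolynomial (Fin n) K) n i) :=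
      Module.Free.of_equiv (chainsEquivFun (MvPolynomial (Fin n) K) (MvPolynomial (Fin n) K) n i).symm
    exact (IsProjective.iff_projective
      (koszulChains (MvPolynomial (Fin n) K) (MvPolynomial (Fin n) K) n i)).1 inferInstance
  π := (ChainComplex.toSingle₀Equiv _ _).symm ⟨ModuleCat.ofHom (koszulAugmentation K n),
    koszulComplex_d_augmentation c hc⟩
  quasiIso := ⟨fun i => by
    cases i with
    | zero =>
      rw [ChainComplex.quasiIsoAt₀_iff, ShortComplex.quasiIso_iff_of_zeros']
      · refine (ShortComplex.exact_and_epi_g_iff_of_iso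
          (S₂ := ShortComplex.mk (ModuleCat.ofHom (koszulDiffDeg (MvPolynomial (Fin n) K)
            (fun k : Fin n => linearForm c (k + 1)) 0)) (ModuleCat.ofHom (koszulAugmentation K n))
            (by ext a; exact (koszulAugmentation_eq_zero_iff c hc _).2 ⟨a, rfl⟩)) ?_).2 ⟨?_, ?_⟩
        · refine ShortComplex.isoMk (Iso.refl _) (Iso.refl _) (Iso.refl _) ?_ ?_
          · exact ModuleCat.hom_ext (LinearMap.ext fun x =>
              (congrArg (fun f => f.hom x) (koszulComplex_d (MvPolynomial (Fin n) K)
                (fun k : Fin n => linearForm c (k + 1)) 0)).symm)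
          · refine ModuleCat.hom_ext (LinearMap.ext fun x => ?_)
            have h := ChainComplex.toSingle₀Equiv_symm_apply_f_zero
              (C := koszulComplex (MvPolynomial (Fin n) K) (fun k : Fin n => linearForm c (k + 1)))
              (ModuleCat.ofHom (koszulAugmentation K n)) (koszulComplex_d_augmentation c hc)
            exact (congrArg (fun f => f.hom x) h).symm
        · exact (ShortComplex.moduleCat_exact_iff _).2 fun x hx =>
            (koszulAugmentation_eq_zero_iff c hc x).1 hx
        · exact (ModuleCat.epi_iff_surjective _).2 koszulAugmentation_surjective
      all_goals rfl
    | succ i =>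
      rw [quasiIsoAt_iff_exactAt']
      · exact koszulComplex_exactAt_succ c hc i
      · apply ChainComplex.exactAt_succ_single_obj⟩

variable (M : Type u) [AddCommGroup M] [Module K M] [Module (MvPolynomial (Fin n) K) M]
  [IsScalarTower K (MvPolynomial (Fin n) K) M]

/-- `Tor'` derives the tensor product in its first argument, so tensoring the Koszul resolution of
S/𝔪 with M computes it, and the result is the Koszul complex of M. -/
theorem nonempty_tor_iso (hc : (Matrix.of c).det ≠ 0) (i : ℕ) :
    Nonempty ((((Tor' (ModuleCat.{u} (MvPolynomial (Fin n) K)) (i + 1)).obj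
      (ModuleCat.of _ (MvPolynomial (Fin n) K ⧸ gradedMaximalIdeal K n))).obj (ModuleCat.of _ M)) ≅
      ModuleCat.of (MvPolynomial (Fin n) K) (KoszulHomology M (linearForm c) n (i + 1))) := by
  let F := (MonoidalCategory.tensoringRight (ModuleCat.{u} (MvPolynomial (Fin n) K))).obj
    (ModuleCat.of _ M)
  obtain ⟨e⟩ := nonempty_homology_iso M
    ((F.mapHomologicalComplex _).obj (koszulResolution c hc).complex) (linearForm c) n
    (fun i => chainsTensorEquiv M i) (fun i x => by
      change chainsTensorEquiv M i ((F.map ((koszulComplex (MvPolynomial (Fin n) K)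
        (fun k : Fin n => linearForm c (k + 1))).d (i + 1) i)).hom x) = _
      rw [koszulComplex_d]
      exact chainsTensorEquiv_comm M (fun k : Fin n => linearForm c (k + 1)) i x) i
  exact ⟨(koszulResolution c hc).isoLeftDerivedObj F (i + 1) ≪≫ e⟩

theorem nonempty_torSpace_equiv (hc : (Matrix.of c).det ≠ 0) (i : ℕ) :
    Nonempty (TorSpace K n M (i + 1) ≃ₗ[K] KoszulHomology M (linearForm c) n (i + 1)) := by
  obtain ⟨e⟩ := nonempty_tor_iso c M hc i
  exact ⟨{ e.toLinearEquiv.toAddEquiv with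
    map_smul' := fun a x => by
      refine (e.toLinearEquiv.map_smul (MvPolynomial.C a) x).trans ?_
      exact C_smul_eq a _ }⟩

end Resolution

/-! ### Betti numbers and the equality criteria. -/

section Main

variable {K : Type u} [Field K] {n : ℕ} {M : Type u} [AddCommGroup M] [Module K M]
  [Module (MvPolynomial (Fin n) K) M] [IsScalarTower K (MvPolynomial (Fin n) K) M]
  {h : ℕ → ℕ → ℕ} {c : Fin n → Fin n → K}

theorem finite_torSpace_and_bettiNumber_eq (hc : IsGoodFor M h c) {i : ℕ} (hi : 1 ≤ i) :
    Module.Finite K (TorSpace K n M i) ∧ bettiNumber K n M i = h i n := by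
  obtain ⟨i, rfl⟩ : ∃ j, i = j + 1 := ⟨i - 1, by omega⟩
  obtain ⟨e⟩ := nonempty_torSpace_equiv c M hc.1 i
  obtain ⟨hfin, hrank⟩ := hc.2 n le_rfl (i + 1) hi
  exact ⟨Module.Finite.equiv e.symm, e.finrank_eq.trans hrank⟩

theorem IsGoodFor.eq_annihilatorBound_iff [Infinite K]
    (hg : Generically fun c : Fin n → Fin n → K => IsGoodFor M h c) (hc : IsGoodFor M h c)
    {p i : ℕ} (hp : p ≤ n) (hi : 1 ≤ i) :
    h i p = annihilatorBound K n M i p ↔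
      ∀ a b, (a, b) ∈ indexSet i p → koszulMul M (linearForm c) a b = 0 := by
  refine (hc.le_annihilatorBound_and_eq_iff hg hp hi).2.trans
    (forall_congr' fun a => forall_congr' fun b => forall_congr' fun hab => ?_)
  obtain ⟨-, hb, -, ha, -⟩ := mem_indexSet.1 hab
  have := (hc.2 b (by omega) a ha).1
  exact mulRank_eq_zero_iff

theorem koszulMul_eq_zero_iff_smul_top_eq_bot [Infinite K] {f : MvPolynomial (Fin n × Fin n) K}
    (hf : ∀ c : Fin n → Fin n → K, MvPolynomial.eval (fun q => c q.1 q.2) f ≠ 0 → IsGoodFor M h c)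
    (hc : MvPolynomial.eval (fun q => c q.1 q.2) f ≠ 0) {p i : ℕ} (hp : p ≤ n) :
    (∀ a b, (a, b) ∈ indexSet i p → koszulMul M (linearForm c) a b = 0) ↔
      ∀ a b, (a, b) ∈ indexSet i p → gradedMaximalIdeal K n •
        (⊤ : Submodule (MvPolynomial (Fin n) K) (KoszulHomology M (linearForm c) b a)) = ⊥ := by
  refine forall_congr' fun a => forall_congr' fun b => forall_congr' fun hab => ?_
  obtain ⟨-, hb, -, ha, -⟩ := mem_indexSet.1 hab
  exact ⟨smul_top_eq_bot_of_koszulMul_eq_zero hf hc ha (by omega),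
    koszulMul_eq_zero_of_smul_top_eq_bot⟩

end Main

end RigidBetti

theorem proposition1p1 {K : Type u} [Field K] [Infinite K] (n : ℕ)
    (M : Type u) [AddCommGroup M] [Module K M] [Module (MvPolynomial (Fin n) K) M]
    [IsScalarTower K (MvPolynomial (Fin n) K) M] [Module.Finite (MvPolynomial (Fin n) K) M]
    (𝓜 : ℤ → Submodule K M) (hdec : DirectSum.IsInternal 𝓜)
    (hdeg : ∀ (d : ℕ) (e : ℤ) (f : MvPolynomial (Fin n) K) (m : M),
      f ∈ MvPolynomial.homogeneousSubmodule (Fin n) K d → m ∈ 𝓜 e → f • m ∈ 𝓜 ((d : ℤ) + e)) :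
    -- the generic numbers `α_p` and `h_i(p)` are finite and well defined
    (RigidBetti.Generically fun c : Fin n → Fin n → K =>
      ∀ p : ℕ, 1 ≤ p → p ≤ n →
        (Module.Finite K (RigidBetti.AnnihilatorModule M (RigidBetti.linearForm c) p) ∧
          Module.finrank K (RigidBetti.AnnihilatorModule M (RigidBetti.linearForm c) p)
            = RigidBetti.genericAnnihilatorNumber K n M p) ∧
        ∀ i : ℕ, 1 ≤ i →
          Module.Finite K (RigidBetti.KoszulHomology M (RigidBetti.linearForm c) p i) ∧
          Module.finrank K (RigidBetti.KoszulHomology M (RigidBetti.linearForm c) p i)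
            = RigidBetti.genericKoszulNumber K n M i p) ∧
    -- the upper bound for generic Koszul homology
    (∀ i p : ℕ, 1 ≤ i → 1 ≤ p → p ≤ n →
      RigidBetti.genericKoszulNumber K n M i p ≤ RigidBetti.annihilatorBound K n M i p) ∧
    -- the characterization of equality
    (RigidBetti.Generically fun c : Fin n → Fin n → K =>
      ∀ i p : ℕ, 1 ≤ i → 1 ≤ p → p ≤ n →
        [RigidBetti.genericKoszulNumber K n M i p = RigidBetti.annihilatorBound K n M i p,
         ∀ a b : ℕ, (a, b) ∈ RigidBetti.indexSet i p →
          RigidBetti.koszulMul M (RigidBetti.linearForm c) a b = 0,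
         ∀ a b : ℕ, (a, b) ∈ RigidBetti.indexSet i p →
          RigidBetti.gradedMaximalIdeal K n •
            (⊤ : Submodule (MvPolynomial (Fin n) K)
              (RigidBetti.KoszulHomology M (RigidBetti.linearForm c) b a)) = ⊥].TFAE) ∧
    -- the upper bound for Betti numbers (which are finite)
    (∀ i : ℕ, 1 ≤ i → Module.Finite K (RigidBetti.TorSpace K n M i) ∧
      RigidBetti.bettiNumber K n M i ≤ RigidBetti.annihilatorBound K n M i n) ∧
    -- the characterizations of equality, for one `i` and for all `i`
    (RigidBetti.Generically fun c : Fin n → Fin n → K =>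
      (∀ i : ℕ, 1 ≤ i →
        (RigidBetti.bettiNumber K n M i = RigidBetti.annihilatorBound K n M i n ↔
          ∀ a b : ℕ, (a, b) ∈ RigidBetti.indexSet i n →
            RigidBetti.gradedMaximalIdeal K n •
              (⊤ : Submodule (MvPolynomial (Fin n) K)
                (RigidBetti.KoszulHomology M (RigidBetti.linearForm c) b a)) = ⊥)) ∧
      ((∀ i : ℕ, 1 ≤ i →
          RigidBetti.bettiNumber K n M i = RigidBetti.annihilatorBound K n M i n) ↔
        ∀ a b : ℕ, 1 ≤ a → 1 ≤ b → b ≤ n →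
          RigidBetti.gradedMaximalIdeal K n •
            (⊤ : Submodule (MvPolynomial (Fin n) K)
              (RigidBetti.KoszulHomology M (RigidBetti.linearForm c) b a)) = ⊥)) := by
  have hπ := RigidBetti.isGradingProj_componentProj hdec hdeg
  obtain ⟨h, hg⟩ := RigidBetti.exists_generically_isGoodFor hπ
  obtain ⟨c₀, hc₀⟩ := hg.exists
  -- The open set is fixed explicitly, since the perturbation argument has to stay inside the set
  -- where goodness is guaranteed; `hg` is kept for the generic values.
  obtain ⟨f, hf0, hf⟩ := id hg
  refine ⟨hg.mono fun c hc p hp hpn => ⟨?_, fun i hi => ?_⟩, fun i p hi _ hpn => ?_,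
    ⟨f, hf0, fun c hc i p hi _ hpn => ?_⟩, fun i hi => ?_, ⟨f, hf0, fun c hc => ?_⟩⟩
  · obtain ⟨q, rfl⟩ : ∃ q, p = q + 1 := ⟨p - 1, by omega⟩
    exact ⟨(hc.finrank_one hpn).1, (hc.genericAnnihilatorNumber_eq hg hpn).symm⟩
  · rw [RigidBetti.genericKoszulNumber_eq hg hpn hi]
    exact hc.2 p hpn i hi
  · rw [RigidBetti.genericKoszulNumber_eq hg hpn hi]
    exact (hc₀.le_annihilatorBound_and_eq_iff hg hpn hi).1
  · rw [RigidBetti.genericKoszulNumber_eq hg hpn hi]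
    have h₁ := (hf c hc).eq_annihilatorBound_iff hg hpn hi
    have h₂ := RigidBetti.koszulMul_eq_zero_iff_smul_top_eq_bot hf hc hpn (i := i)
    tfae_have 1 ↔ 2 := h₁
    tfae_have 2 ↔ 3 := h₂
    tfae_finish
  · obtain ⟨hfin, hβ⟩ := RigidBetti.finite_torSpace_and_bettiNumber_eq hc₀ hi
    exact ⟨hfin, hβ ▸ (hc₀.le_annihilatorBound_and_eq_iff hg le_rfl hi).1⟩
  · have key : ∀ i : ℕ, 1 ≤ i → (RigidBetti.bettiNumber K n M i =
        RigidBetti.annihilatorBound K n M i n ↔ ∀ a b : ℕ, (a, b) ∈ RigidBetti.indexSet i n →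
          RigidBetti.gradedMaximalIdeal K n • (⊤ : Submodule (MvPolynomial (Fin n) K)
            (RigidBetti.KoszulHomology M (RigidBetti.linearForm c) b a)) = ⊥) := fun i hi => by
      rw [(RigidBetti.finite_torSpace_and_bettiNumber_eq hc₀ hi).2]
      exact ((hf c hc).eq_annihilatorBound_iff hg le_rfl hi).trans
        (RigidBetti.koszulMul_eq_zero_iff_smul_top_eq_bot hf hc le_rfl)
    refine ⟨key, fun H a b ha hb hbn => ?_, fun H i hi => (key i hi).2 fun a b hab => ?_⟩
    -- For `b = n` the annihilation is automatic; for `b < n` the pair `(a, b)` lies in A_{a,n},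
    -- because a - n + b ≤ a.
    · obtain rfl | hlt := hbn.eq_or_lt
      · exact RigidBetti.smul_top_koszulHomology_eq_bot (hf c hc).1 a
      · exact (key a ha).1 (H a ha) a b
          (RigidBetti.mem_indexSet.2 ⟨hb, hlt, by omega, ha, le_rfl⟩)
    · obtain ⟨hb, hbn, -, ha, -⟩ := RigidBetti.mem_indexSet.1 hab
      exact H a b ha hb hbn.le
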